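/- Let $G$ be a td-group, i.e. a locally compact, second countable, totally disconnected Hausdorff topological group. A smooth $G$-CW-complex is a $G$-CW-complex all of whose isotropy groups are open. Let $\mathcal{H}^G_*$ be a smooth $G$-homology theory: a $\mathbb{Z}$-graded family of functors from pairs of smooth $G$-CW-complexes to abelian groups with natural boundary maps, satisfying $G$-homotopy invariance, the long exact sequence of a pair, excision, and the disjoint union axiom. For a conjugation-closed set $\mathcal{F}$ of open subgroups of $G$, let $\mathrm{Or}_{\mathcal F}(G)$ be the category of homogeneous spaces $G/H$, $H\in\mathcal F$, and $G$-maps, and let $\mathrm{Sub}_{\mathcal F}(G)$ be the category with object set $\mathcal F$ and morphisms $\mathrm{Inn}(K)\backslash \mathrm{conhom}_G(H,K)$, where $\mathrm{conhom}_G(H,K)$ is the set of homomorphisms $c(g)\colon H\to K$, $h\mapsto ghg^{-1}$, with $g\in G$ and $gHg^{-1}\subseteq K$. For a smooth $G$-CW-complex $X$ and covariant functors $M$ on $\mathrm{Or}_{\mathcal F}(G)$ and $N$ on $\mathrm{Sub}_{\mathcal F}(G)$ with values in abelian groups put $$BH^{G,\mathcal F}_n(X;M)=H_n\bigl(C_*^{\mathrm{Or}}(X)\otimes_{\mathbb{Z}\mathrm{Or}_{\mathcal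 F}(G)}M\bigr),\qquad SH^{G,\mathcal F}_n(X;N)=H_n\bigl(C_*^{\mathrm{Sub}}(X)\otimes_{\mathbb{Z}\mathrm{Sub}_{\mathcal F}(G)}N\bigr),$$ where $C^{\mathrm{Or}}_*(X)(G/H)$ and $C^{\mathrm{Sub}}_*(X)(H)$ are the cellular chain complexes, with chain groups $H_n^{\mathrm{sing}}(Y_n,Y_{n-1})$, of the spaces $Y=X^H$ and $Y=C_GH\backslash X^H$ filtered by the skeleta of $X$. 1. Suppose that $\mathcal{H}^G_q(G/H)=0$ for all $H\in\mathcal F$ and all $q<0$. Then $\mathcal{H}^G_q(X,A)=0$ for all $q<0$ and every pair $(X,A)$ of $G$-CW-complexes whose isotropy groups all belong to $\mathcal F$. 2. Let $X$ be a model for the classifying space $E_{\mathrm{Cop}}G$ for smooth proper $G$-actions, i.e. a $G$-CW-complex all of whose isotropy groups are compact open and for which $X^H$ is weakly contractible for every compact open subgroup $H\subseteq G$. Let $\mathcal I$ be the set of isotropy groups of points of $X$, and suppose that $\mathcal{H}^G_q(G/H)=0$ for all $H\in\mathcal I$ and all $q<0$. (a) We have $\mathcal{H}^G_q(X)=0$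 for all $q<0$. For every conjugation-closed set $\mathcal F\supseteq\mathcal I$ of open subgroups of $G$, the edge homomorphism of the equivariant Atiyah–Hirzebruch spectral sequence (that of the skeletal filtration of $X$, with $BH^{G,\mathcal F}_0(X;\mathcal{H}^G_0)$ identified with its term $E^2_{0,0}$) is an isomorphism $$BH^{G,\mathcal F}_0(X;\mathcal{H}^G_0)\xrightarrow{\ \cong\ }\mathcal{H}^G_0(X).$$ The canonical map $$\operatorname*{colim}_{G/H\in \mathrm{Or}_{\mathcal I}(G)}\mathcal{H}^G_0(G/H)\longrightarrow \mathcal{H}^G_0(X),$$ given on $\mathcal{H}^G_0(G/H)$ by any $G$-map $G/H\to X$, is well defined and bijective. (b) Suppose in addition that $\mathcal{H}^G_*$ satisfies Condition $(\mathrm{Sub}_{\mathcal I})$: for all $H\in\mathcal I$, all $g$ in the centralizer $C_GH$ and all $q\in\mathbb{Z}$, the $G$-map $G/H\to G/H$, $g'H\mapsto g'g^{-1}H$, induces the identity on $\mathcal{H}^G_q(G/H)$. Let $\overline{\mathcal{H}^G_0}$ be the resulting covariant functor on $\mathrm{Sub}_{\mathcal I}(G)$, which sends $H$ to $\mathcal{H}^G_0(G/H)$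 and the class of $c(g)\colon H\to K$ to the map induced by $G/H\to G/K$, $g'H\mapsto g'g^{-1}K$. Then the edge homomorphism induces an isomorphism $$SH^{G,\mathcal I}_0(X;\overline{\mathcal{H}^G_0})\xrightarrow{\ \cong\ }\mathcal{H}^G_0(X),$$ and the canonical map $$\operatorname*{colim}_{H\in \mathrm{Sub}_{\mathcal I}(G)}\overline{\mathcal{H}^G_0}(H)\longrightarrow \mathcal{H}^G_0(X),$$ given on $\overline{\mathcal{H}^G_0}(H)=\mathcal{H}^G_0(G/H)$ by any $G$-map $G/H\to X$, is well defined and bijective. -/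

import Mathlib

open CategoryTheory Limits TensorProduct

universe u

noncomputable section

namespace SmoothBredon

/-! ### Equivariant CW-complexes -/

/-- The closed unit disk `D^n`. -/
abbrev Disk (n : ℕ) : Type := Metric.closedBall (0 : EuclideanSpace ℝ (Fin n)) 1

/-- The Euclidean norm of a point of the disk. -/
def Disk.norm {n : ℕ} (d : Disk n) : ℝ := ‖(d : EuclideanSpace ℝ (Fin n))‖

/-- A `G`-CW-structure on a `G`-space `X`.  The set `skLT n` is the skeleton `X_{n-1}`, so that
`skLT 0` is empty.  The fields say that `X_n` is obtained from `X_{n-1}` as a `G`-pushout by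
attaching the equivariant cells `G/H_i × D^n` along `G/H_i × S^{n-1}`, with `H_i` closed in `G`,
and that `X` carries the colimit topology. -/
structure GCWStructure (G : Type u) [Group G] [TopologicalSpace G]
    (X : Type u) [TopologicalSpace X] [MulAction G X] where
  /-- the index set of the equivariant `n`-cells -/
  cell : ℕ → Type u
  /-- the subgroup `H_i` -/
  typ : ∀ n, cell n → Subgroup G
  isClosed_typ : ∀ n i, IsClosed (typ n i : Set G)
  /-- `skLT n` is `X_{n-1}` -/
  skLT : ℕ → Set X
  /-- the characteristic map `Q_i : G/H_i × D^n → X` -/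
  char : ∀ (n : ℕ) (i : cell n), (G ⧸ typ n i) × Disk n → X
  continuous_char : ∀ n i, Continuous (char n i)
  char_smul : ∀ n i (g : G) (a : G ⧸ typ n i) (d : Disk n),
    char n i (g • a, d) = g • char n i (a, d)
  char_boundary : ∀ n i (a : G ⧸ typ n i) (d : Disk n), d.norm = 1 → char n i (a, d) ∈ skLT n
  bijOn_char : ∀ n, Set.BijOn
    (fun p : Σ i : cell n, (G ⧸ typ n i) × Disk n => char n p.1 p.2)
    {p | p.2.2.norm < 1} (skLT (n + 1) \ skLT n)
  skLT_zero : skLT 0 = ∅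
  skLT_subset : ∀ n, skLT n ⊆ skLT (n + 1)
  iUnion_skLT : ⋃ n, skLT n = Set.univ
  isClosed_skLT : ∀ n, IsClosed (skLT n)
  /-- `X_n` carries the quotient topology of `X_{n-1} ⊔ ∐ G/H_i × D^n` -/
  isClosed_of_char : ∀ n (C : Set X), C ⊆ skLT (n + 1) → IsClosed (C ∩ skLT n) →
    (∀ i, IsClosed (char n i ⁻¹' C)) → IsClosed C
  /-- `X` is the colimit of its skeleta -/
  isClosed_of_skLT : ∀ C : Set X, (∀ n, IsClosed (C ∩ skLT n)) → IsClosed C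

lemma conj_mem_of_mem_centralizer {G : Type u} [Group G] {H : Subgroup G} {g : G}
    (hg : g ∈ Subgroup.centralizer (H : Set G)) : ∀ h ∈ H, g * h * g⁻¹ ∈ H := fun h hh => by
  have := (Subgroup.mem_centralizer_iff.1 hg) h hh
  rwa [← this, mul_inv_cancel_right]

/-- The `G`-map `G/H → X`, `gH ↦ gx`, given by a point `x ∈ X^H`. -/
def orbitMap {G : Type u} [Group G] {X : Type u} [MulAction G X] {H : Subgroup G}
    (x : MulAction.fixedPoints H X) : G ⧸ H → X :=
  Quotient.lift (s := QuotientGroup.leftRel H) (fun g : G => g • (x : X)) (by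
    intro a b hab
    have h1 : (a⁻¹ * b) • (x : X) = x := x.2 ⟨_, QuotientGroup.leftRel_apply.1 hab⟩
    change a • (x : X) = b • (x : X)
    rw [← h1, smul_smul, mul_inv_cancel_left, h1])

lemma orbitMap_smul {G : Type u} [Group G] {X : Type u} [MulAction G X] {H : Subgroup G}
    (x : MulAction.fixedPoints H X) (g : G) (a : G ⧸ H) :
    orbitMap x (g • a) = g • orbitMap x a := by
  obtain ⟨y, rfl⟩ := QuotientGroup.mk_surjective a
  exact mul_smul g y (x : X)

lemma orbitMap_mk {G : Type u} [Group G] {X : Type u} [MulAction G X] {H : Subgroup G}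
    (x : MulAction.fixedPoints H X) (g : G) : orbitMap x (g : G ⧸ H) = g • (x : X) := rfl

namespace GCWStructure

variable {G : Type u} [Group G] [TopologicalSpace G]
  {X : Type u} [TopologicalSpace X] [MulAction G X] (cw : GCWStructure G X)

/-- The open equivariant cell `G/H_i × int D^n` in `X`. -/
def openCell (n : ℕ) (i : cw.cell n) : Set X := cw.char n i '' {p | p.2.norm < 1}

/-- A subcomplex: a closed subset which is a union of open equivariant cells. -/
def IsSubcomplex (A : Set X) : Prop :=
  IsClosed A ∧ ∀ n i, cw.openCell n i ⊆ A ∨ Disjoint (cw.openCell n i) A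

lemma skLT_mono {m n : ℕ} (h : m ≤ n) : cw.skLT m ⊆ cw.skLT n :=
  monotone_nat_of_le_succ (f := cw.skLT) cw.skLT_subset h

lemma openCell_subset (n : ℕ) (i : cw.cell n) :
    cw.openCell n i ⊆ cw.skLT (n + 1) \ cw.skLT n := by
  rintro _ ⟨p, hp, rfl⟩
  exact (cw.bijOn_char n).mapsTo (x := ⟨i, p⟩) hp

lemma exists_openCell (x : X) : ∃ n i, x ∈ cw.openCell n i := by
  classical
  have hx : ∃ n, x ∈ cw.skLT n := by
    have : x ∈ ⋃ n, cw.skLT n := by rw [cw.iUnion_skLT]; trivial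
    simpa using this
  obtain ⟨n, hn⟩ : ∃ n, Nat.find hx = n + 1 := by
    refine Nat.exists_eq_succ_of_ne_zero fun h0 => ?_
    have := Nat.find_spec hx
    rw [h0, cw.skLT_zero] at this
    exact this
  have h1 : x ∈ cw.skLT (n + 1) := hn ▸ Nat.find_spec hx
  have h2 : x ∉ cw.skLT n := Nat.find_min hx (by omega)
  obtain ⟨p, hp, rfl⟩ := (cw.bijOn_char n).surjOn ⟨h1, h2⟩
  exact ⟨n, p.1, p.2, hp, rfl⟩

lemma smul_mem_openCell {n : ℕ} {i : cw.cell n} {x : X} (g : G) (hx : x ∈ cw.openCell n i) :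
    g • x ∈ cw.openCell n i := by
  obtain ⟨⟨a, d⟩, hp, rfl⟩ := hx
  exact ⟨(g • a, d), hp, cw.char_smul n i g a d⟩

lemma char_mem_skLT_succ {n : ℕ} (i : cw.cell n) (p : (G ⧸ cw.typ n i) × Disk n) :
    cw.char n i p ∈ cw.skLT (n + 1) := by
  obtain ⟨a, d⟩ := p
  have hd : d.norm ≤ 1 := by
    have := d.2
    rwa [mem_closedBall_zero_iff] at this
  rcases hd.lt_or_eq with h | h
  · exact ((cw.bijOn_char n).mapsTo (x := ⟨i, (a, d)⟩) h).1
  · exact cw.skLT_subset n (cw.char_boundary n i a d h)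

variable {cw} in
lemma IsSubcomplex.smul_mem {A : Set X} (hA : cw.IsSubcomplex A) (g : G) {x : X} (hx : x ∈ A) :
    g • x ∈ A := by
  obtain ⟨n, i, hi⟩ := cw.exists_openCell x
  rcases hA.2 n i with h | h
  · exact h (cw.smul_mem_openCell g hi)
  · exact absurd hx (Set.disjoint_left.1 h hi)

lemma isSubcomplex_empty : cw.IsSubcomplex ∅ :=
  ⟨isClosed_empty, fun _ _ => Or.inr (Set.disjoint_empty _)⟩

lemma isSubcomplex_skLT (m : ℕ) : cw.IsSubcomplex (cw.skLT m) := by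
  refine ⟨cw.isClosed_skLT m, fun n i => ?_⟩
  rcases lt_or_ge n m with h | h
  · exact Or.inl fun x hx => cw.skLT_mono h (cw.openCell_subset n i hx).1
  · exact Or.inr (Set.disjoint_left.2 fun x hx hxm =>
      (cw.openCell_subset n i hx).2 (cw.skLT_mono h hxm))

/-- A closed cell is contained in the closure of the open cell. -/
lemma char_mem_closure {n : ℕ} (i : cw.cell n) (p : (G ⧸ cw.typ n i) × Disk n) :
    cw.char n i p ∈ closure (cw.openCell n i) := by
  have hp : p ∈ closure {p : (G ⧸ cw.typ n i) × Disk n | p.2.norm < 1} := by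
    obtain ⟨a, d⟩ := p
    let γ : ℝ → (G ⧸ cw.typ n i) × Disk n := fun t =>
      (a, ⟨(max 0 (min t 1)) • (d : EuclideanSpace ℝ (Fin n)), by
        have hd := d.2
        rw [mem_closedBall_zero_iff] at hd ⊢
        rw [norm_smul, Real.norm_of_nonneg (le_max_left _ _)]
        exact mul_le_one₀ (max_le zero_le_one (min_le_right _ _)) (norm_nonneg _) hd⟩)
    have hγ : Continuous γ := by fun_prop
    have h1 : γ 1 = (a, d) := by simp [γ]
    rw [← h1]
    have hcl : (1 : ℝ) ∈ closure (Set.Iio (1 : ℝ)) := by simp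
    refine map_mem_closure hγ hcl fun t ht => ?_
    have hd := d.2
    rw [mem_closedBall_zero_iff] at hd
    change ‖(max 0 (min t 1)) • (d : EuclideanSpace ℝ (Fin n))‖ < 1
    rw [norm_smul, Real.norm_of_nonneg (le_max_left _ _)]
    have h2 : max 0 (min t 1) < 1 := max_lt zero_lt_one (min_lt_of_left_lt ht)
    have h3 : 0 ≤ max 0 (min t 1) := le_max_left _ _
    nlinarith [norm_nonneg (d : EuclideanSpace ℝ (Fin n))]
  exact map_mem_closure (cw.continuous_char n i) hp fun q hq => ⟨q, hq, rfl⟩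

lemma char_mem_of_openCell_subset {A : Set X} (hA : cw.IsSubcomplex A) {n : ℕ} {i : cw.cell n}
    (hi : cw.openCell n i ⊆ A) (p : (G ⧸ cw.typ n i) × Disk n) : cw.char n i p ∈ A :=
  hA.1.closure_subset_iff.2 hi (cw.char_mem_closure i p)

/-- The action on an invariant subset. -/
abbrev subAction {A : Set X} (hA : ∀ (g : G) {x : X}, x ∈ A → g • x ∈ A) : MulAction G A where
  smul g x := ⟨g • (x : X), hA g x.2⟩
  one_smul x := Subtype.ext (one_smul G (x : X))
  mul_smul g h x := Subtype.ext (mul_smul g h (x : X))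

lemma char_injective {n : ℕ} {i j : cw.cell n} {p : (G ⧸ cw.typ n i) × Disk n}
    {q : (G ⧸ cw.typ n j) × Disk n} (hp : p.2.norm < 1) (hq : q.2.norm < 1)
    (h : cw.char n i p = cw.char n j q) :
    (⟨i, p⟩ : Σ i : cw.cell n, (G ⧸ cw.typ n i) × Disk n) = ⟨j, q⟩ := by
  have key := (cw.bijOn_char n).injOn
  rw [Set.InjOn] at key
  refine key ?_ ?_ ?_
  · rw [Set.mem_ofPred_eq]; exact hp
  · rw [Set.mem_ofPred_eq]; exact hq
  · dsimp only; exact h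

lemma subtype_isClosed_of_char {A : Set X} (hA : cw.IsSubcomplex A) (n : ℕ) (C : Set A)
    (hC : C ⊆ {x : A | (x : X) ∈ cw.skLT (n + 1)})
    (h0 : IsClosed (C ∩ {x : A | (x : X) ∈ cw.skLT n}))
    (h1 : ∀ i : {i : cw.cell n // cw.openCell n i ⊆ A}, IsClosed
      ((fun p => (⟨cw.char n i.1 p, cw.char_mem_of_openCell_subset hA i.2 p⟩ : A)) ⁻¹' C)) :
    IsClosed C := by
  rw [hA.1.isClosedEmbedding_subtypeVal.isClosed_iff_image_isClosed] at h0 ⊢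
  have hint : Subtype.val '' (C ∩ {x : A | (x : X) ∈ cw.skLT n}) =
      Subtype.val '' C ∩ cw.skLT n := by
    ext x; constructor
    · rintro ⟨y, ⟨hy, hy'⟩, rfl⟩; exact ⟨⟨y, hy, rfl⟩, hy'⟩
    · rintro ⟨⟨y, hy, rfl⟩, hy'⟩; exact ⟨y, ⟨hy, hy'⟩, rfl⟩
  rw [hint] at h0
  refine cw.isClosed_of_char n _ ?_ h0 fun i => ?_
  · rintro _ ⟨y, hy, rfl⟩
    exact hC hy
  · rcases hA.2 n i with hi | hi
    · convert h1 ⟨i, hi⟩ using 1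
      ext p; constructor
      · rintro ⟨y, hy, hyp⟩
        have : y = ⟨cw.char n i p, cw.char_mem_of_openCell_subset hA hi p⟩ := Subtype.ext hyp
        rw [Set.mem_preimage]
        exact (congrArg (· ∈ C) this).mp hy
      · intro hp
        exact ⟨_, hp, rfl⟩
    · convert h0.preimage (cw.continuous_char n i) using 1
      ext p; constructor
      · rintro ⟨y, hy, hyp⟩
        refine ⟨⟨y, hy, hyp⟩, ?_⟩
        have hd : p.2.norm ≤ 1 := by
          have := p.2.2
          rwa [mem_closedBall_zero_iff] at this
        rcases hd.lt_or_eq with h | h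
        · exact absurd (hyp ▸ y.2 : cw.char n i p ∈ A)
            (Set.disjoint_left.1 hi ⟨p, h, rfl⟩)
        · exact cw.char_boundary n i p.1 p.2 h
      · exact fun hp => hp.1

lemma subtype_isClosed_of_skLT {A : Set X} (hA : cw.IsSubcomplex A) (C : Set A)
    (h : ∀ n, IsClosed (C ∩ {x : A | (x : X) ∈ cw.skLT n})) : IsClosed C := by
  rw [hA.1.isClosedEmbedding_subtypeVal.isClosed_iff_image_isClosed]
  refine cw.isClosed_of_skLT _ fun n => ?_
  have := h n
  rw [hA.1.isClosedEmbedding_subtypeVal.isClosed_iff_image_isClosed] at this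
  convert this using 1
  ext x; constructor
  · rintro ⟨⟨y, hy, rfl⟩, hy'⟩; exact ⟨y, ⟨hy, hy'⟩, rfl⟩
  · rintro ⟨y, ⟨hy, hy'⟩, rfl⟩; exact ⟨⟨y, hy, rfl⟩, hy'⟩

/-- The `G`-CW-structure of a subcomplex. -/
def restrict {A : Set X} (hA : cw.IsSubcomplex A) :
    letI := subAction (G := G) hA.smul_mem
    GCWStructure G A :=
  letI := subAction (G := G) hA.smul_mem
  { cell := fun n => {i : cw.cell n // cw.openCell n i ⊆ A}
    typ := fun n i => cw.typ n i.1
    isClosed_typ := fun n i => cw.isClosed_typ n i.1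
    skLT := fun n => {x : A | (x : X) ∈ cw.skLT n}
    char := fun n i p => ⟨cw.char n i.1 p, cw.char_mem_of_openCell_subset hA i.2 p⟩
    continuous_char := fun n i => (cw.continuous_char n i.1).subtype_mk _
    char_smul := fun n i g a d => Subtype.ext (cw.char_smul n i.1 g a d)
    char_boundary := fun n i a d h => cw.char_boundary n i.1 a d h
    bijOn_char := by
      intro n
      refine ⟨?_, ?_, ?_⟩
      · rintro ⟨i, p⟩ hp
        exact cw.openCell_subset n i.1 ⟨p, hp, rfl⟩
      · rintro ⟨⟨i, hi⟩, p⟩ hp ⟨⟨j, hj⟩, q⟩ hq h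
        have h' := cw.char_injective hp hq (congrArg Subtype.val h)
        obtain ⟨rfl, h2⟩ := Sigma.mk.inj h'
        obtain rfl := eq_of_heq h2
        rfl
      · rintro ⟨x, hxA⟩ hx
        obtain ⟨⟨i, p⟩, hp, hpx⟩ := (cw.bijOn_char n).surjOn (a := x) hx
        have hmem : x ∈ cw.openCell n i := ⟨p, hp, hpx⟩
        have hi : cw.openCell n i ⊆ A := (hA.2 n i).resolve_right fun h =>
          Set.disjoint_left.1 h hmem hxA
        exact ⟨⟨⟨i, hi⟩, p⟩, hp, Subtype.ext hpx⟩
    skLT_zero := by ext x; simp [cw.skLT_zero]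
    skLT_subset := fun n x hx => cw.skLT_subset n hx
    iUnion_skLT := by
      ext x
      have : (x : X) ∈ ⋃ n, cw.skLT n := by rw [cw.iUnion_skLT]; trivial
      simpa using this
    isClosed_skLT := fun n => (cw.isClosed_skLT n).preimage continuous_subtype_val
    isClosed_of_char := cw.subtype_isClosed_of_char hA
    isClosed_of_skLT := cw.subtype_isClosed_of_skLT hA }

end GCWStructure

variable (G : Type u) [Group G] [TopologicalSpace G]

/-- A smooth `G`-CW-complex: a `G`-CW-complex all of whose isotropy groups are open. -/
structure SmoothGCW where
  carrier : Type u
  [top : TopologicalSpace carrier]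
  [act : MulAction G carrier]
  [contAct : ContinuousSMul G carrier]
  cw : GCWStructure G carrier
  isOpen_stabilizer : ∀ x : carrier, IsOpen (MulAction.stabilizer G x : Set G)

attribute [instance] SmoothGCW.top SmoothGCW.act SmoothGCW.contAct

/-- A smooth `G`-CW-pair `(X, A)`: a smooth `G`-CW-complex with a subcomplex. -/
structure SmoothGCWPair where
  X : SmoothGCW G
  A : Set X.carrier
  isSubcomplex : X.cw.IsSubcomplex A

variable {G}

/-- A subcomplex of a smooth `G`-CW-complex, as a smooth `G`-CW-complex. -/
def SmoothGCW.restrict (X : SmoothGCW G) (A : Set X.carrier) (hA : X.cw.IsSubcomplex A) :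
    SmoothGCW G :=
  letI : MulAction G A := GCWStructure.subAction hA.smul_mem
  { carrier := A
    contAct := ⟨(continuous_fst.smul (continuous_subtype_val.comp continuous_snd)).subtype_mk _⟩
    cw := X.cw.restrict hA
    isOpen_stabilizer := fun x => by
      have : MulAction.stabilizer G x = MulAction.stabilizer G (x : X.carrier) := by
        ext g
        exact Subtype.ext_iff
      rw [this]
      exact X.isOpen_stabilizer x }

/-- `X` as the pair `(X, ∅)`. -/
def SmoothGCW.toPair (X : SmoothGCW G) : SmoothGCWPair G :=
  ⟨X, ∅, X.cw.isSubcomplex_empty⟩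

namespace SmoothGCWPair

/-- Morphisms of smooth `G`-CW-pairs are the (not necessarily cellular) continuous `G`-maps of
pairs. -/
@[ext]
structure Hom (P Q : SmoothGCWPair G) where
  toFun : P.X.carrier → Q.X.carrier
  continuous_toFun : Continuous toFun
  map_smul : ∀ (g : G) x, toFun (g • x) = g • toFun x
  mapsTo : Set.MapsTo toFun P.A Q.A

instance instCategory : Category (SmoothGCWPair G) where
  Hom := Hom
  id P := ⟨id, continuous_id, fun _ _ => rfl, fun _ h => h⟩
  comp f g := ⟨g.toFun ∘ f.toFun, g.continuous_toFun.comp f.continuous_toFun,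
    fun a x => by simp [f.map_smul, g.map_smul], g.mapsTo.comp f.mapsTo⟩

/-- The functor sending `(X, A)` to `(A, ∅)`. -/
def bd : SmoothGCWPair G ⥤ SmoothGCWPair G where
  obj P := (P.X.restrict P.A P.isSubcomplex).toPair
  map {_ Q} f :=
    { toFun := fun x => (⟨f.toFun x.1, f.mapsTo x.2⟩ : Q.A)
      continuous_toFun :=
        (f.continuous_toFun.comp continuous_subtype_val).subtype_mk _
      map_smul := fun g x => Subtype.ext (f.map_smul g x.1)
      mapsTo := fun _ h => h.elim }
  map_id _ := rfl
  map_comp _ _ := rfl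

/-- The inclusion `(A, ∅) → (X, ∅)`. -/
def bdIncl (P : SmoothGCWPair G) : bd.obj P ⟶ P.X.toPair where
  toFun := Subtype.val
  continuous_toFun := continuous_subtype_val
  map_smul _ _ := rfl
  mapsTo _ h := h.elim

/-- The inclusion `(X, ∅) → (X, A)`. -/
def absIncl (P : SmoothGCWPair G) : P.X.toPair ⟶ P where
  toFun := id
  continuous_toFun := continuous_id
  map_smul _ _ := rfl
  mapsTo _ h := h.elim

/-- Two morphisms of pairs are `G`-homotopic (as maps of pairs). -/
def GHomotopic {P Q : SmoothGCWPair G} (f₀ f₁ : P ⟶ Q) : Prop :=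
  ∃ h : P.X.carrier × unitInterval → Q.X.carrier, Continuous h ∧
    (∀ (g : G) x t, h (g • x, t) = g • h (x, t)) ∧
    (∀ x t, x ∈ P.A → h (x, t) ∈ Q.A) ∧
    (∀ x, h (x, 0) = f₀.toFun x) ∧ (∀ x, h (x, 1) = f₁.toFun x)

/-- A morphism of pairs `(X, A) → (Y, B)` is a pushout if `Y` is obtained from `B` by glueing `X`
along `A → B`, that is, if `Y` is the `G`-pushout of `X ← A → B`. -/
def IsPushout {P Q : SmoothGCWPair G} (f : P ⟶ Q) : Prop :=
  Set.BijOn f.toFun P.Aᶜ Q.Aᶜ ∧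
    ∀ C : Set Q.X.carrier, IsClosed (C ∩ Q.A) → IsClosed (f.toFun ⁻¹' C) → IsClosed C

end SmoothGCWPair

/-- A family of morphisms `X_i → Y` of absolute smooth `G`-CW-complexes exhibits `Y` as the
disjoint union of the `X_i`. -/
def IsDisjointUnion {ι : Type u} {X : ι → SmoothGCW G} {Y : SmoothGCW G}
    (f : ∀ i, (X i).toPair ⟶ Y.toPair) : Prop :=
  IsHomeomorph (fun p : Σ i, (X i).carrier => ((f p.1).toFun p.2 : Y.carrier))

variable (G) in
/-- A smooth `G`-homology theory: a `ℤ`-graded family of functors from smooth `G`-CW-pairs to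
abelian groups with natural boundary maps, satisfying `G`-homotopy invariance, the long exact
sequence of a pair, excision, and the disjoint union axiom. -/
structure SmoothGHomologyTheory where
  H : ℤ → (SmoothGCWPair G ⥤ AddCommGrpCat.{u})
  boundary : ∀ n : ℤ, H (n + 1) ⟶ SmoothGCWPair.bd ⋙ H n
  homotopy_invariance : ∀ (n : ℤ) (P Q : SmoothGCWPair G) (f₀ f₁ : P ⟶ Q),
    SmoothGCWPair.GHomotopic f₀ f₁ → (H n).map f₀ = (H n).map f₁
  exact_abs : ∀ (n : ℤ) (P : SmoothGCWPair G),
    Function.Exact ((H n).map P.bdIncl) ((H n).map P.absIncl)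
  exact_pair : ∀ (n : ℤ) (P : SmoothGCWPair G),
    Function.Exact ((H (n + 1)).map P.absIncl) ((boundary n).app P)
  exact_bd : ∀ (n : ℤ) (P : SmoothGCWPair G),
    Function.Exact ((boundary n).app P) ((H n).map P.bdIncl)
  excision : ∀ (n : ℤ) (P Q : SmoothGCWPair G) (f : P ⟶ Q),
    SmoothGCWPair.IsPushout f → IsIso ((H n).map f)
  disjoint_union : ∀ (n : ℤ) (ι : Type u) (X : ι → SmoothGCW G) (Y : SmoothGCW G)
    (f : ∀ i, (X i).toPair ⟶ Y.toPair), IsDisjointUnion f →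
    letI := Classical.decEq ι
    Function.Bijective (DirectSum.toAddMonoid fun i => ((H n).map (f i)).hom)

/-! ### Homogeneous spaces, the orbit category and the subgroup category -/

/-- The `0`-dimensional `G`-CW-structure on `G/H` with one equivariant cell. -/
def orbitGCWStructure [IsTopologicalGroup G] (H : Subgroup G) (hH : IsOpen (H : Set G)) :
    GCWStructure G (G ⧸ H) where
  cell n := ULift (PLift (n = 0))
  typ _ _ := H
  isClosed_typ _ _ := H.isClosed_of_isOpen hH
  skLT n := {_x | 0 < n}
  char _ _ p := p.1
  continuous_char _ _ := continuous_fst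
  char_smul _ _ _ _ _ := rfl
  char_boundary n i a d h := by
    obtain ⟨⟨rfl⟩⟩ := i
    have : d.norm = 0 := by
      unfold Disk.norm
      rw [Subsingleton.elim (d : EuclideanSpace ℝ (Fin 0)) 0, norm_zero]
    rw [this] at h
    exact absurd h zero_ne_one
  bijOn_char n := by
    refine ⟨?_, ?_, ?_⟩
    · rintro ⟨⟨⟨rfl⟩⟩, p⟩ _
      exact ⟨Nat.one_pos, fun h => lt_irrefl 0 h⟩
    · rintro ⟨⟨⟨rfl⟩⟩, a, d⟩ _ ⟨⟨⟨_⟩⟩, b, e⟩ _ h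
      obtain rfl : a = b := h
      have hd : d = e := Subtype.ext (Subsingleton.elim _ _)
      rw [hd]
    · rintro x ⟨_, hx⟩
      have hn : n = 0 := Nat.eq_zero_of_not_pos hx
      subst hn
      refine ⟨⟨⟨⟨rfl⟩⟩, x, ⟨0, by simp⟩⟩, ?_, rfl⟩
      rw [Set.mem_ofPred_eq]
      simp [Disk.norm]
  skLT_zero := by ext; simp
  skLT_subset n x h := Nat.lt_succ_of_lt h
  iUnion_skLT := by
    ext x
    simp only [Set.mem_iUnion, Set.mem_univ, iff_true]
    exact ⟨1, Nat.one_pos⟩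
  isClosed_skLT n := by
    have := QuotientGroup.discreteTopology hH
    exact isClosed_discrete _
  isClosed_of_char n C _ _ _ := by
    have := QuotientGroup.discreteTopology hH
    exact isClosed_discrete _
  isClosed_of_skLT C _ := by
    have := QuotientGroup.discreteTopology hH
    exact isClosed_discrete _

/-- The homogeneous space `G/H` for an open subgroup `H`, as a smooth `G`-CW-complex. -/
def orbit [IsTopologicalGroup G] (H : Subgroup G) (hH : IsOpen (H : Set G)) : SmoothGCW G where
  carrier := G ⧸ H
  cw := orbitGCWStructure H hH
  isOpen_stabilizer x := by
    have := QuotientGroup.discreteTopology hH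
    have hc : Continuous fun g : G => g • x := continuous_id.smul continuous_const
    exact (isOpen_discrete ({x} : Set (G ⧸ H))).preimage hc

variable (G) in
/-- A set of open subgroups of `G` which is closed under conjugation. -/
structure OpenFamily where
  mem : Set (Subgroup G)
  isOpen : ∀ H ∈ mem, IsOpen (H : Set G)
  conj_mem : ∀ H ∈ mem, ∀ g : G, H.map (MulAut.conj g).toMonoidHom ∈ mem

/-- The set of isotropy groups of points of a smooth `G`-CW-complex. -/
def isotropyFamily (X : SmoothGCW G) : OpenFamily G where
  mem := Set.range fun x : X.carrier => MulAction.stabilizer G x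
  isOpen := by
    rintro _ ⟨x, rfl⟩
    exact X.isOpen_stabilizer x
  conj_mem := by
    rintro _ ⟨x, rfl⟩ g
    exact ⟨g • x, MulAction.stabilizer_smul_eq_stabilizer_map_conj g x⟩

/-- The orbit category `Or_F(G)`: its objects are the homogeneous spaces `G/H` with `H ∈ F`, its
morphisms are the `G`-maps. -/
structure OrbitCat (F : OpenFamily G) where
  H : Subgroup G
  mem : H ∈ F.mem

instance (F : OpenFamily G) : Category (OrbitCat F) where
  Hom a b := (G ⧸ a.H) →[G] (G ⧸ b.H)
  id a := MulActionHom.id G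
  comp f g := g.comp f

/-- The subgroup category `Sub_F(G)`: its objects are the elements of `F`. -/
structure SubCat (F : OpenFamily G) where
  H : Subgroup G
  mem : H ∈ F.mem

/-- `f : H → K` is given by conjugation with `g`, i.e. `f h = g h g⁻¹`. -/
def IsConjBy {H K : Subgroup G} (f : H →* K) (g : G) : Prop :=
  ∀ h : H, (f h : G) = g * h * g⁻¹

/-- The set `conhom_G(H, K)` of group homomorphisms `H → K` given by conjugation with some element
of `G`. -/
def Conhom (H K : Subgroup G) : Type u := {f : H →* K // ∃ g : G, IsConjBy f g}

/-- The orbit relation of the action of `Inn(K)` on `conhom_G(H, K)` by composition. -/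
instance conhomSetoid (H K : Subgroup G) : Setoid (Conhom H K) where
  r f f' := ∃ k : K, ∀ h, f'.1 h = k * f.1 h * k⁻¹
  iseqv :=
    { refl := fun f => ⟨1, fun h => by simp⟩
      symm := fun ⟨k, hk⟩ => ⟨k⁻¹, fun h => by rw [hk h]; group⟩
      trans := fun ⟨k, hk⟩ ⟨l, hl⟩ => ⟨l * k, fun h => by rw [hl h, hk h]; group⟩ }

/-- Composition of conjugation homomorphisms. -/
def Conhom.comp {H K L : Subgroup G} (f : Conhom H K) (f' : Conhom K L) : Conhom H L :=
  ⟨f'.1.comp f.1, by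
    obtain ⟨g, hg⟩ := f.2
    obtain ⟨g', hg'⟩ := f'.2
    exact ⟨g' * g, fun h => by
      rw [MonoidHom.comp_apply, hg' (f.1 h), hg h]; group⟩⟩

/-- The morphisms of the subgroup category are the elements of `Inn(K) \ conhom_G(H, K)`. -/
instance (F : OpenFamily G) : Category (SubCat F) where
  Hom a b := Quotient (conhomSetoid a.H b.H)
  id a := ⟦⟨MonoidHom.id _, 1, fun h => by simp⟩⟧
  comp {a b c} := Quotient.map₂ Conhom.comp (by
    rintro f₁ f₂ ⟨k, hk⟩ f₁' f₂' ⟨l, hl⟩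
    refine ⟨l * f₁'.1 k, fun h => ?_⟩
    change f₂'.1 (f₂.1 h) = _ * f₁'.1 (f₁.1 h) * _
    rw [hk h, hl]
    simp only [map_mul, map_inv]
    group)
  id_comp := by rintro a b ⟨f⟩; rfl
  comp_id := by rintro a b ⟨f⟩; rfl
  assoc := by rintro a b c d ⟨f⟩ ⟨f'⟩ ⟨f''⟩; rfl

variable {F : OpenFamily G}

/-- Conjugation with `g` as an element of `conhom_G(H, K)`, if `gHg⁻¹ ⊆ K`. -/
def conjHom {H K : Subgroup G} (g : G) (hg : ∀ h ∈ H, g * h * g⁻¹ ∈ K) : Conhom H K :=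
  ⟨((MulAut.conj g).toMonoidHom.comp H.subtype).codRestrict K fun h => hg h h.2,
    g, fun _ => rfl⟩

/-- The class `[c(g)]` as a morphism of the subgroup category. -/
def SubCat.homMk {a b : SubCat F} (g : G) (hg : ∀ h ∈ a.H, g * h * g⁻¹ ∈ b.H) : a ⟶ b :=
  (⟦conjHom g hg⟧ : Quotient (conhomSetoid a.H b.H))

/-- The `G`-map `R_{g⁻¹} : G/H → G/K`, `g'H ↦ g'g⁻¹K`, if `gHg⁻¹ ⊆ K`. -/
def rightMul {H K : Subgroup G} (g : G) (hg : ∀ h ∈ H, g * h * g⁻¹ ∈ K) :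
    (G ⧸ H) →[G] (G ⧸ K) where
  toFun := Quotient.map' (fun x => x * g⁻¹) (by
    intro x y hxy
    rw [QuotientGroup.leftRel_apply] at hxy ⊢
    have := hg _ hxy
    convert this using 1
    group)
  map_smul' := by
    rintro m ⟨x⟩
    exact congrArg (QuotientGroup.mk (s := K)) (mul_assoc m x g⁻¹)

/-- `R_{g⁻¹}` as a morphism of the orbit category. -/
def OrbitCat.homMk {a b : OrbitCat F} (g : G) (hg : ∀ h ∈ a.H, g * h * g⁻¹ ∈ b.H) : a ⟶ b :=
  rightMul g hg

/-- The `G`-map underlying a morphism of the orbit category. -/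
def OrbitCat.toMap {a b : OrbitCat F} (f : a ⟶ b) : (G ⧸ a.H) →[G] (G ⧸ b.H) := f

lemma OrbitCat.hom_ext {a b : OrbitCat F} {f f' : a ⟶ b}
    (h : OrbitCat.toMap f ((1 : G) : G ⧸ a.H) = OrbitCat.toMap f' ((1 : G) : G ⧸ a.H)) :
    f = f' := by
  change OrbitCat.toMap f = OrbitCat.toMap f'
  refine MulActionHom.ext ?_
  rintro ⟨x⟩
  have hx : (Quot.mk _ x : G ⧸ a.H) = x • ((1 : G) : G ⧸ a.H) :=
    congrArg (QuotientGroup.mk (s := a.H)) (mul_one x).symm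
  rw [hx]
  rw [MulActionHom.map_smul, MulActionHom.map_smul, h]

/-- Every `G`-map `G/H → G/K` is of the form `R_{g⁻¹}`. -/
lemma OrbitCat.exists_homMk {a b : OrbitCat F} (f : a ⟶ b) :
    ∃ (g : G) (hg : ∀ h ∈ a.H, g * h * g⁻¹ ∈ b.H), f = OrbitCat.homMk g hg := by
  let f' := OrbitCat.toMap f
  obtain ⟨y, hy⟩ := QuotientGroup.mk_surjective (f' ((1 : G) : G ⧸ a.H))
  have hg : ∀ h ∈ a.H, y⁻¹ * h * y⁻¹⁻¹ ∈ b.H := by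
    intro h hh
    have h1 : h • ((1 : G) : G ⧸ a.H) = ((1 : G) : G ⧸ a.H) := by
      change ((h * 1 : G) : G ⧸ a.H) = _
      rw [QuotientGroup.eq]
      simpa using hh
    have h2 : h • (y : G ⧸ b.H) = y := by
      rw [hy, ← MulActionHom.map_smul, h1]
    have h3 : ((y : G) : G ⧸ b.H) = ((h * y : G) : G ⧸ b.H) := h2.symm
    rw [QuotientGroup.eq] at h3
    simpa [mul_assoc] using h3
  refine ⟨y⁻¹, hg, OrbitCat.hom_ext ?_⟩
  change f' _ = ((1 * y⁻¹⁻¹ : G) : G ⧸ b.H)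
  rw [← hy]
  simp

lemma OrbitCat.homMk_eq_iff {a b : OrbitCat F} (g g' : G) (hg : ∀ h ∈ a.H, g * h * g⁻¹ ∈ b.H)
    (hg' : ∀ h ∈ a.H, g' * h * g'⁻¹ ∈ b.H) :
    (OrbitCat.homMk g hg : a ⟶ b) = OrbitCat.homMk g' hg' ↔ g' * g⁻¹ ∈ b.H := by
  have key : g' * g⁻¹ ∈ b.H ↔ ((1 * g⁻¹ : G) : G ⧸ b.H) = ((1 * g'⁻¹ : G) : G ⧸ b.H) := by
    rw [eq_comm, QuotientGroup.eq]; simp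
  rw [key]
  constructor
  · intro h
    exact congrArg (fun f : a ⟶ b => OrbitCat.toMap f ((1 : G) : G ⧸ a.H)) h
  · exact fun h => OrbitCat.hom_ext h

lemma SubCat.homMk_eq_iff {a b : SubCat F} (g g' : G) (hg : ∀ h ∈ a.H, g * h * g⁻¹ ∈ b.H)
    (hg' : ∀ h ∈ a.H, g' * h * g'⁻¹ ∈ b.H) :
    (SubCat.homMk g hg : a ⟶ b) = SubCat.homMk g' hg' ↔
      ∃ k ∈ b.H, ∃ c ∈ Subgroup.centralizer (a.H : Set G), g' = k * g * c := by
  constructor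
  · intro h
    obtain ⟨k, hk⟩ := Quotient.exact h
    refine ⟨k, k.2, (k * g)⁻¹ * g', ?_, by group⟩
    rw [Subgroup.mem_centralizer_iff]
    intro h hh
    have := congrArg Subtype.val (hk ⟨h, hh⟩)
    change g' * h * g'⁻¹ = (k : G) * (g * h * g⁻¹) * (k : G)⁻¹ at this
    have h2 : g' * h = (k : G) * (g * h * g⁻¹) * (k : G)⁻¹ * g' := by
      rw [← this]; group
    simp only [mul_assoc, h2]
    group
  · rintro ⟨k, hk, c, hc, rfl⟩
    refine Quotient.sound ⟨⟨k, hk⟩, fun h => Subtype.ext ?_⟩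
    change k * g * c * h * (k * g * c)⁻¹ = k * (g * h * g⁻¹) * k⁻¹
    have := (Subgroup.mem_centralizer_iff.1 hc) h h.2
    have h2 : c * h * c⁻¹ = h := by rw [← this]; group
    calc k * g * c * h * (k * g * c)⁻¹ = k * g * (c * h * c⁻¹) * g⁻¹ * k⁻¹ := by group
      _ = _ := by rw [h2]; group

lemma SubCat.exists_homMk {a b : SubCat F} (f : a ⟶ b) :
    ∃ (g : G) (hg : ∀ h ∈ a.H, g * h * g⁻¹ ∈ b.H), f = SubCat.homMk g hg := by
  obtain ⟨⟨f, g, hg⟩⟩ := f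
  have hg' : ∀ h ∈ a.H, g * h * g⁻¹ ∈ b.H := fun h hh => by
    have := hg ⟨h, hh⟩
    rw [← this]
    exact (f ⟨h, hh⟩).2
  refine ⟨g, hg', ?_⟩
  refine Quotient.sound ⟨1, fun h => Subtype.ext ?_⟩
  change g * h * g⁻¹ = _
  rw [one_mul, inv_one, mul_one, hg]

lemma OrbitCat.homMk_comp {a b c : OrbitCat F} (g g' : G) (hg : ∀ h ∈ a.H, g * h * g⁻¹ ∈ b.H)
    (hg' : ∀ h ∈ b.H, g' * h * g'⁻¹ ∈ c.H) :
    (OrbitCat.homMk g hg : a ⟶ b) ≫ (OrbitCat.homMk g' hg' : b ⟶ c) =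
      OrbitCat.homMk (g' * g) (fun h hh => by
        simpa [mul_assoc] using hg' _ (hg h hh)) := by
  refine OrbitCat.hom_ext ?_
  change ((1 * g⁻¹ * g'⁻¹ : G) : G ⧸ c.H) = ((1 * (g' * g)⁻¹ : G) : G ⧸ c.H)
  simp

lemma SubCat.homMk_comp {a b c : SubCat F} (g g' : G) (hg : ∀ h ∈ a.H, g * h * g⁻¹ ∈ b.H)
    (hg' : ∀ h ∈ b.H, g' * h * g'⁻¹ ∈ c.H) :
    (SubCat.homMk g hg : a ⟶ b) ≫ (SubCat.homMk g' hg' : b ⟶ c) =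
      SubCat.homMk (g' * g) (fun h hh => by
        simpa [mul_assoc] using hg' _ (hg h hh)) := by
  refine Quotient.sound ⟨1, fun h => Subtype.ext ?_⟩
  change g' * g * h * (g' * g)⁻¹ = (1 : G) * (g' * (g * h * g⁻¹) * g'⁻¹) * (1 : G)⁻¹
  group

lemma OrbitCat.id_eq_homMk (a : OrbitCat F) :
    𝟙 a = OrbitCat.homMk 1 (fun h hh => by simpa using hh) := by
  refine OrbitCat.hom_ext ?_
  change ((1 : G) : G ⧸ a.H) = ((1 * 1⁻¹ : G) : G ⧸ a.H)
  simp

lemma SubCat.id_eq_homMk (a : SubCat F) :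
    𝟙 a = SubCat.homMk 1 (fun h hh => by simpa using hh) := by
  refine Quotient.sound ⟨1, fun h => Subtype.ext ?_⟩
  change (1 : G) * h * (1 : G)⁻¹ = (1 : G) * h * (1 : G)⁻¹
  rfl

/-! ### The coefficient systems of a smooth `G`-homology theory -/

section Coefficients

variable [IsTopologicalGroup G]

/-- The functor `Or_F(G) → ` smooth `G`-CW-pairs, sending `G/H` to `(G/H, ∅)`. -/
def orbitFunctor (F : OpenFamily G) : OrbitCat F ⥤ SmoothGCWPair G where
  obj a := (orbit a.H (F.isOpen a.H a.mem)).toPair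
  map {a b} f :=
    { toFun := OrbitCat.toMap f
      continuous_toFun := by
        have := QuotientGroup.discreteTopology (F.isOpen a.H a.mem)
        exact continuous_of_discreteTopology (α := G ⧸ a.H)
      map_smul := fun g x => MulActionHom.map_smul (OrbitCat.toMap f) g x
      mapsTo := fun _ h => h.elim }
  map_id _ := rfl
  map_comp _ _ := rfl

namespace SmoothGHomologyTheory

variable (ℋ : SmoothGHomologyTheory G)

/-- The homology group `ℋ_q(X) = ℋ_q(X, ∅)`. -/
abbrev abs (q : ℤ) (X : SmoothGCW G) : AddCommGrpCat.{u} := (ℋ.H q).obj X.toPair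

/-- The covariant `ℤOr_F(G)`-module `ℋ_q`, sending `G/H` to `ℋ_q(G/H)`. -/
def orbitModule (F : OpenFamily G) (q : ℤ) : OrbitCat F ⥤ AddCommGrpCat.{u} :=
  orbitFunctor F ⋙ ℋ.H q

/-- Condition (Sub) for the family `F`: for every `H ∈ F` and `g ∈ C_G H` the `G`-map
`R_{g⁻¹} : G/H → G/H` induces the identity on `ℋ_q(G/H)` for all `q`. -/
def ConditionSub (F : OpenFamily G) : Prop :=
  ∀ (a : OrbitCat F) (g : G) (hg : g ∈ Subgroup.centralizer (a.H : Set G)) (q : ℤ),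
    (ℋ.orbitModule F q).map
      (OrbitCat.homMk g (conj_mem_of_mem_centralizer hg) : a ⟶ a) = 𝟙 _

variable {ℋ} in
lemma ConditionSub.map_eq (hS : ℋ.ConditionSub F) (q : ℤ) {a b : OrbitCat F} (g g' : G)
    (hg : ∀ h ∈ a.H, g * h * g⁻¹ ∈ b.H) (hg' : ∀ h ∈ a.H, g' * h * g'⁻¹ ∈ b.H)
    (h : (SubCat.homMk g hg : (⟨a.H, a.mem⟩ : SubCat F) ⟶ ⟨b.H, b.mem⟩) = SubCat.homMk g' hg') :
    (ℋ.orbitModule F q).map (OrbitCat.homMk g hg : a ⟶ b) =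
      (ℋ.orbitModule F q).map (OrbitCat.homMk g' hg') := by
  obtain ⟨k, hk, c, hc, rfl⟩ := (SubCat.homMk_eq_iff g g' hg hg').1 h
  have : (OrbitCat.homMk (k * g * c) hg' : a ⟶ b) =
      (OrbitCat.homMk c (conj_mem_of_mem_centralizer hc) : a ⟶ a) ≫ OrbitCat.homMk g hg := by
    rw [OrbitCat.homMk_comp, OrbitCat.homMk_eq_iff]
    simpa [mul_assoc] using hk
  rw [this, Functor.map_comp, hS a c hc q, Category.id_comp]

/-- The covariant `ℤSub_F(G)`-module induced by `ℋ_q` under Condition (Sub).  It sends `H` to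
`ℋ_q(G/H)` and the class `[c(g)]` to the map induced by `R_{g⁻¹}`. -/
def subModule (hS : ℋ.ConditionSub F) (q : ℤ) : SubCat F ⥤ AddCommGrpCat.{u} where
  obj a := (ℋ.orbitModule F q).obj ⟨a.H, a.mem⟩
  map {a b} f := (ℋ.orbitModule F q).map
    (OrbitCat.homMk (a := ⟨a.H, a.mem⟩) (b := ⟨b.H, b.mem⟩)
      (SubCat.exists_homMk f).choose (SubCat.exists_homMk f).choose_spec.choose)
  map_id a := by
    have h := (SubCat.exists_homMk (𝟙 a)).choose_spec.choose_spec
    refine Eq.trans ?_ ((ℋ.orbitModule F q).map_id ⟨a.H, a.mem⟩)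
    rw [OrbitCat.id_eq_homMk]
    exact hS.map_eq q _ _ _ _ (h.symm.trans (SubCat.id_eq_homMk a))
  map_comp {a b c} f f' := by
    have h := (SubCat.exists_homMk (f ≫ f')).choose_spec.choose_spec
    have h1 := (SubCat.exists_homMk f).choose_spec.choose_spec
    have h2 := (SubCat.exists_homMk f').choose_spec.choose_spec
    rw [← Functor.map_comp, OrbitCat.homMk_comp]
    refine hS.map_eq q _ _ _ _ (h.symm.trans ?_)
    refine Eq.trans ?_ (SubCat.homMk_comp (b := b) _ _ (SubCat.exists_homMk f).choose_spec.choose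
      (SubCat.exists_homMk f').choose_spec.choose)
    exact congrArg₂ (fun (x : a ⟶ b) (y : b ⟶ c) => x ≫ y) h1 h2

lemma subModule_map_homMk (hS : ℋ.ConditionSub F) (q : ℤ) {a b : SubCat F} (g : G)
    (hg : ∀ h ∈ a.H, g * h * g⁻¹ ∈ b.H) :
    (ℋ.subModule hS q).map (SubCat.homMk g hg : a ⟶ b) =
      (ℋ.orbitModule F q).map
        (OrbitCat.homMk g hg : (⟨a.H, a.mem⟩ : OrbitCat F) ⟶ ⟨b.H, b.mem⟩) :=
  hS.map_eq q _ _ _ _ (SubCat.exists_homMk (SubCat.homMk g hg : a ⟶ b)).choose_spec.choose_spec.symm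

end SmoothGHomologyTheory

/-- The `G`-map `G/H → X`, `gH ↦ gx`, given by a point `x ∈ X^H`, as a morphism of smooth
`G`-CW-complexes. -/
def pointMap (X : SmoothGCW G) {H : Subgroup G} (hH : IsOpen (H : Set G))
    (x : MulAction.fixedPoints H X.carrier) : (orbit H hH).toPair ⟶ X.toPair where
  toFun := orbitMap x
  continuous_toFun := by
    have := QuotientGroup.discreteTopology hH
    exact continuous_of_discreteTopology (α := G ⧸ H)
  map_smul := orbitMap_smul x
  mapsTo _ h := h.elim

end Coefficients

/-! ### The cellular chain complex of a filtered space -/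

/-- The cokernel sequence `S → T → T/S → 0` of a natural transformation `S → T`, as a functor. -/
def cokernelSeq {C D : Type*} [Category* C] [Category* D] [HasZeroMorphisms D] [HasCokernels D]
    {S T : C ⥤ D} (i : S ⟶ T) : C ⥤ ShortComplex D where
  obj Y := ShortComplex.mk (i.app Y) (cokernel.π (i.app Y)) (cokernel.condition _)
  map {Y Z} f :=
    { τ₁ := S.map f
      τ₂ := T.map f
      τ₃ := cokernel.map (i.app Y) (i.app Z) (S.map f) (T.map f) (i.naturality f).symm
      comm₁₂ := i.naturality f
      comm₂₃ := (cokernel.π_desc _ _ _).symm }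
  map_id Y := by
    ext1
    · exact S.map_id Y
    · exact T.map_id Y
    · apply coequalizer.hom_ext
      exact (cokernel.π_desc _ _ _).trans (by simp)
  map_comp {Y Z W} f g := by
    ext1
    · exact S.map_comp f g
    · exact T.map_comp f g
    · apply coequalizer.hom_ext
      exact (cokernel.π_desc _ _ _).trans (by simp)

/-- A filtered space: a topological space `Y` with an increasing sequence of subspaces, where
`fil n` is `Y_{n-1}`. -/
structure FiltSpace where
  Y : TopCat.{u}
  fil : ℕ → Set Y
  mono : ∀ n, fil n ⊆ fil (n + 1)

namespace FiltSpace

/-- Filtration preserving continuous maps. -/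
@[ext]
structure Hom (Y Z : FiltSpace.{u}) where
  map : Y.Y ⟶ Z.Y
  mapsTo : ∀ n, Set.MapsTo map (Y.fil n) (Z.fil n)

instance instCategory : Category FiltSpace.{u} where
  Hom := Hom
  id Y := ⟨𝟙 Y.Y, fun _ _ h => h⟩
  comp f g := ⟨f.map ≫ g.map, fun n _ h => g.mapsTo n (f.mapsTo n h)⟩

/-- The functor sending `Y` to `Y_{n-1}`. -/
def part (n : ℕ) : FiltSpace.{u} ⥤ TopCat.{u} where
  obj Y := TopCat.of (Y.fil n)
  map f := TopCat.ofHom ⟨fun y => ⟨f.map y.1, f.mapsTo n y.2⟩,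
    (f.map.hom.continuous.comp continuous_subtype_val).subtype_mk _⟩
  map_id _ := rfl
  map_comp _ _ := rfl

/-- The inclusion `Y_{n-1} → Y_n`. -/
def incl (n : ℕ) : part.{u} n ⟶ part (n + 1) where
  app Y := TopCat.ofHom ⟨fun y => ⟨y.1, Y.mono n y.2⟩, continuous_subtype_val.subtype_mk _⟩
  naturality _ _ _ := rfl

instance (n : ℕ) (Y : FiltSpace.{u}) : Mono ((incl n).app Y) := by
  rw [TopCat.mono_iff_injective]
  intro a b h
  exact Subtype.ext (congrArg (fun y : Y.fil (n + 1) => (y : Y.Y)) h)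

/-- The integral singular chain complex functor. -/
abbrev singularChains : TopCat.{u} ⥤ ChainComplex AddCommGrpCat.{u} ℕ :=
  (AlgebraicTopology.singularChainComplexFunctor AddCommGrpCat.{u}).obj
    (AddCommGrpCat.of (ULift.{u} ℤ))

lemma mono_singularChains_map {X Y : TopCat.{u}} (f : X ⟶ Y) [Mono f] :
    Mono (singularChains.map f) := by
  have hf := (TopCat.mono_iff_injective f).1 inferInstance
  refine HomologicalComplex.mono_of_mono_f _ fun n => ?_
  refine MonoCoprod.mono_map'_of_injective (fun _ => AddCommGrpCat.of (ULift.{u} ℤ))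
    (((TopCat.toSSet.map f).app (Opposite.op (SimplexCategory.mk n)))) ?_
  intro σ τ h
  have h1 : Mono ((TopCat.toSSet.map f).app (Opposite.op (SimplexCategory.mk n))) := inferInstance
  exact (mono_iff_injective _).1 h1 h

/-- The inclusion of singular chain complexes `S(Y_{n-1}) → S(Y_n)`. -/
def chainIncl (n : ℕ) : part.{u} n ⋙ singularChains ⟶ part (n + 1) ⋙ singularChains :=
  Functor.whiskerRight (incl n) singularChains

instance (n : ℕ) (Y : FiltSpace.{u}) : Mono ((chainIncl n).app Y) :=
  mono_singularChains_map ((incl n).app Y)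

/-- The short exact sequence `0 → S(Y_{n-1}) → S(Y_n) → S(Y_n, Y_{n-1}) → 0` of singular chain
complexes of the pair `(Y_n, Y_{n-1})`. -/
abbrev pairSeq (n : ℕ) : FiltSpace.{u} ⥤ ShortComplex (ChainComplex AddCommGrpCat.{u} ℕ) :=
  cokernelSeq (chainIncl n)

lemma pairSeq_shortExact (n : ℕ) (Y : FiltSpace.{u}) : ((pairSeq n).obj Y).ShortExact where
  exact := ShortComplex.exact_cokernel ((chainIncl n).app Y)
  mono_f := inferInstanceAs (Mono ((chainIncl n).app Y))
  epi_g := inferInstanceAs (Epi (cokernel.π ((chainIncl n).app Y)))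

/-- The `n`-th cellular chain group `H_n(Y_n, Y_{n-1})` (singular homology). -/
def cellGroup (n : ℕ) : FiltSpace.{u} ⥤ AddCommGrpCat.{u} :=
  pairSeq n ⋙ ShortComplex.π₃ ⋙ HomologicalComplex.homologyFunctor _ _ n

lemma comp_square_aux {C : Type*} [Category* C] {X₁ X₂ X₃ Y₁ Y₂ Y₃ : C} {a : X₁ ⟶ X₂}
    {b : X₂ ⟶ X₃} {a' : Y₁ ⟶ Y₂} {b' : Y₂ ⟶ Y₃} {f₁ : X₁ ⟶ Y₁} {f₂ : X₂ ⟶ Y₂} {f₃ : X₃ ⟶ Y₃}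
    (h1 : a ≫ f₂ = f₁ ≫ a') (h2 : f₂ ≫ b' = b ≫ f₃) : f₁ ≫ a' ≫ b' = (a ≫ b) ≫ f₃ := by
  rw [← Category.assoc, ← h1, Category.assoc, Category.assoc, h2]

lemma comp_zero_aux {C : Type*} [Category* C] [HasZeroMorphisms C] {X₁ X₂ X₃ X₄ X₅ : C}
    (a : X₁ ⟶ X₂) {b : X₂ ⟶ X₃} {c : X₃ ⟶ X₄} (d : X₄ ⟶ X₅) (h : b ≫ c = 0) :
    (a ≫ b) ≫ c ≫ d = 0 := by
  rw [Category.assoc, reassoc_of% h, zero_comp, comp_zero]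

lemma down_rel (n : ℕ) : (ComplexShape.down ℕ).Rel (n + 1) n := by simp

/-- The differential of the cellular chain complex: the composite of the boundary operator
`H_{n+1}(Y_{n+1}, Y_n) → H_n(Y_n)` with `H_n(Y_n) → H_n(Y_n, Y_{n-1})`. -/
def cellDiff (n : ℕ) : cellGroup.{u} (n + 1) ⟶ cellGroup n where
  app Y := (pairSeq_shortExact (n + 1) Y).δ (n + 1) n (down_rel n) ≫
    HomologicalComplex.homologyMap ((pairSeq n).obj Y).g n
  naturality Y Z f := by
    have h1 := HomologicalComplex.HomologySequence.δ_naturality ((pairSeq (n + 1)).map f)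
      (pairSeq_shortExact (n + 1) Y) (pairSeq_shortExact (n + 1) Z) (n + 1) n (down_rel n)
    have h2 := congrArg (fun φ => HomologicalComplex.homologyMap φ n) ((pairSeq n).map f).comm₂₃
    simp only [HomologicalComplex.homologyMap_comp] at h2
    change HomologicalComplex.homologyMap ((pairSeq (n + 1)).map f).τ₃ (n + 1) ≫ _ = 
      _ ≫ HomologicalComplex.homologyMap ((pairSeq n).map f).τ₃ n
    exact comp_square_aux h1 h2

lemma cellDiff_comp (n : ℕ) : cellDiff.{u} (n + 1) ≫ cellDiff n = 0 := by
  ext1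
  ext1 Y
  change ((pairSeq_shortExact (n + 2) Y).δ (n + 2) (n + 1) (down_rel (n + 1)) ≫
    HomologicalComplex.homologyMap ((pairSeq (n + 1)).obj Y).g (n + 1)) ≫
    (pairSeq_shortExact (n + 1) Y).δ (n + 1) n (down_rel n) ≫
    HomologicalComplex.homologyMap ((pairSeq n).obj Y).g n = 0
  exact comp_zero_aux _ _ ((pairSeq_shortExact (n + 1) Y).comp_δ _ _ (down_rel n))

/-- The class in `H_0(Z)` (singular homology) of a point `z` of a topological space `Z`. -/
def singularPointClass (Z : TopCat.{u}) (z : Z) : (singularChains.obj Z).homology 0 :=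
  (((TopCat.toSSet.obj Z).chainComplex (AddCommGrpCat.of (ULift.{u} ℤ))).liftCycles
      ((TopCat.toSSet.obj Z).ιChainComplex (TopCat.toSSetObj₀Equiv.symm z)) 0 (by simp)
      (by simp) ≫
    ((TopCat.toSSet.obj Z).chainComplex (AddCommGrpCat.of (ULift.{u} ℤ))).homologyπ 0)
    (ULift.up (1 : ℤ))

/-- The class in `H_0(Y_0, Y_{-1})` of a point `y ∈ Y_0`. -/
def pointClass (Y : FiltSpace.{u}) (y : Y.fil 1) : (cellGroup.{u} 0).obj Y :=
  HomologicalComplex.homologyMap ((pairSeq 0).obj Y).g 0 (singularPointClass ((part 1).obj Y) y)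

end FiltSpace

/-! ### Tensor products over a category, Bredon homology -/

section Tensor

variable {K : Type u} [Category.{u} K]

/-- The relations `cf ⊗ m = c ⊗ fm` defining the tensor product over the category `K`. -/
def tensorRel (C : Kᵒᵖ ⥤ AddCommGrpCat.{u}) (M : K ⥤ AddCommGrpCat.{u}) :
    letI := Classical.decEq K
    AddSubgroup (DirectSum K fun k => (C.obj (Opposite.op k) : Type u) ⊗[ℤ] (M.obj k : Type u)) :=
  letI := Classical.decEq K
  AddSubgroup.closure {z | ∃ (a b : K) (f : a ⟶ b) (c : C.obj (Opposite.op b)) (m : M.obj a),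
    z = DirectSum.of (fun k => (C.obj (Opposite.op k) : Type u) ⊗[ℤ] (M.obj k : Type u)) a
          (C.map f.op c ⊗ₜ[ℤ] m) -
        DirectSum.of (fun k => (C.obj (Opposite.op k) : Type u) ⊗[ℤ] (M.obj k : Type u)) b
          (c ⊗ₜ[ℤ] M.map f m)}

/-- The map induced on the sum of the tensor products by a natural transformation. -/
def tensorSumMap {C D : Kᵒᵖ ⥤ AddCommGrpCat.{u}} (φ : C ⟶ D) (M : K ⥤ AddCommGrpCat.{u}) :
    (DirectSum K fun k => (C.obj (Opposite.op k) : Type u) ⊗[ℤ] (M.obj k : Type u)) →+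
      DirectSum K fun k => (D.obj (Opposite.op k) : Type u) ⊗[ℤ] (M.obj k : Type u) :=
  letI := Classical.decEq K
  DirectSum.map fun k =>
    (TensorProduct.map (φ.app (Opposite.op k)).hom.toIntLinearMap LinearMap.id).toAddMonoidHom

lemma tensorSumMap_of {C D : Kᵒᵖ ⥤ AddCommGrpCat.{u}} (φ : C ⟶ D) (M : K ⥤ AddCommGrpCat.{u})
    (k : K) (c : C.obj (Opposite.op k)) (m : M.obj k) :
    letI := Classical.decEq K
    tensorSumMap φ M (DirectSum.of (fun k => (C.obj (Opposite.op k) : Type u) ⊗[ℤ]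
      (M.obj k : Type u)) k (c ⊗ₜ[ℤ] m)) =
    DirectSum.of (fun k => (D.obj (Opposite.op k) : Type u) ⊗[ℤ] (M.obj k : Type u)) k
      (φ.app (Opposite.op k) c ⊗ₜ[ℤ] m) := by
  classical
  simp only [tensorSumMap]
  erw [DirectSum.map_of]
  rfl

lemma tensorSumMap_id (C : Kᵒᵖ ⥤ AddCommGrpCat.{u}) (M : K ⥤ AddCommGrpCat.{u})
    (z : DirectSum K fun k => (C.obj (Opposite.op k) : Type u) ⊗[ℤ] (M.obj k : Type u)) :
    tensorSumMap (𝟙 C) M z = z := by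
  classical
  refine DFunLike.congr_fun (f := tensorSumMap (𝟙 C) M) (g := AddMonoidHom.id _) ?_ z
  refine DirectSum.addHom_ext fun k t => ?_
  induction t with
  | zero => simp
  | add x y hx hy => rw [map_add, map_add, map_add, hx, hy]
  | tmul c m => exact tensorSumMap_of _ _ _ _ _

lemma tensorSumMap_comp {C D E : Kᵒᵖ ⥤ AddCommGrpCat.{u}} (φ : C ⟶ D) (ψ : D ⟶ E)
    (M : K ⥤ AddCommGrpCat.{u})
    (z : DirectSum K fun k => (C.obj (Opposite.op k) : Type u) ⊗[ℤ] (M.obj k : Type u)) :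
    tensorSumMap (φ ≫ ψ) M z = tensorSumMap ψ M (tensorSumMap φ M z) := by
  classical
  refine DFunLike.congr_fun (f := tensorSumMap (φ ≫ ψ) M)
    (g := (tensorSumMap ψ M).comp (tensorSumMap φ M)) ?_ z
  refine DirectSum.addHom_ext fun k t => ?_
  induction t with
  | zero => simp
  | add x y hx hy => rw [map_add, map_add, map_add, hx, hy]
  | tmul c m =>
    rw [AddMonoidHom.comp_apply, tensorSumMap_of, tensorSumMap_of, tensorSumMap_of]
    rfl

lemma tensorSumMap_zero (C D : Kᵒᵖ ⥤ AddCommGrpCat.{u}) (M : K ⥤ AddCommGrpCat.{u})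
    (z : DirectSum K fun k => (C.obj (Opposite.op k) : Type u) ⊗[ℤ] (M.obj k : Type u)) :
    tensorSumMap (0 : C ⟶ D) M z = 0 := by
  classical
  refine DFunLike.congr_fun (f := tensorSumMap (0 : C ⟶ D) M) (g := 0) ?_ z
  refine DirectSum.addHom_ext fun k t => ?_
  induction t with
  | zero => simp
  | add x y hx hy => rw [map_add, map_add, map_add, hx, hy]
  | tmul c m =>
    rw [tensorSumMap_of]
    change DirectSum.of (fun k => (D.obj (Opposite.op k) : Type u) ⊗[ℤ] (M.obj k : Type u)) k
      ((0 : D.obj (Opposite.op k)) ⊗ₜ[ℤ] m) = 0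
    rw [TensorProduct.zero_tmul, map_zero]

lemma tensorRel_le {C D : Kᵒᵖ ⥤ AddCommGrpCat.{u}} (φ : C ⟶ D) (M : K ⥤ AddCommGrpCat.{u}) :
    tensorRel C M ≤ (tensorRel D M).comap (tensorSumMap φ M) := by
  refine (AddSubgroup.closure_le _).2 ?_
  rintro _ ⟨a, b, f, c, m, rfl⟩
  refine AddSubgroup.subset_closure ⟨a, b, f, φ.app _ c, m, ?_⟩
  rw [map_sub, tensorSumMap_of, tensorSumMap_of]
  congr 3
  exact ConcreteCategory.congr_hom (φ.naturality f.op) c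

/-- The functor `C ↦ C ⊗_{ℤK} M` from contravariant to abelian groups, for a covariant
`ℤK`-module `M`. -/
def tensorOver (M : K ⥤ AddCommGrpCat.{u}) : (Kᵒᵖ ⥤ AddCommGrpCat.{u}) ⥤ AddCommGrpCat.{u} where
  obj C := AddCommGrpCat.of
    ((DirectSum K fun k => (C.obj (Opposite.op k) : Type u) ⊗[ℤ] (M.obj k : Type u)) ⧸
      tensorRel C M)
  map φ := AddCommGrpCat.ofHom
    (QuotientAddGroup.map _ _ (tensorSumMap φ M) (tensorRel_le φ M))
  map_id C := by
    ext z
    exact congrArg (QuotientAddGroup.mk (s := tensorRel C M)) (tensorSumMap_id C M z)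
  map_comp {C D E} f g := by
    ext z
    exact congrArg (QuotientAddGroup.mk (s := tensorRel E M)) (tensorSumMap_comp f g M z)

/-- The class of `c ⊗ m` in `C ⊗_{ℤK} M`. -/
def tmulClass {C : Kᵒᵖ ⥤ AddCommGrpCat.{u}} {M : K ⥤ AddCommGrpCat.{u}} {k : K}
    (c : C.obj (Opposite.op k)) (m : M.obj k) : (tensorOver M).obj C :=
  letI := Classical.decEq K
  QuotientAddGroup.mk
    (DirectSum.of (fun k => (C.obj (Opposite.op k) : Type u) ⊗[ℤ] (M.obj k : Type u)) k
      (c ⊗ₜ[ℤ] m))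

instance (M : K ⥤ AddCommGrpCat.{u}) : (tensorOver M).PreservesZeroMorphisms where
  map_zero C D := by
    ext z
    obtain ⟨z, rfl⟩ := QuotientAddGroup.mk_surjective (s := tensorRel C M) z
    exact congrArg (QuotientAddGroup.mk (s := tensorRel D M)) (tensorSumMap_zero C D M z)

/-- The cellular chain complex of a contravariant functor from `K` to filtered spaces, as a chain
complex of contravariant `ℤK`-modules. -/
def cellComplex (O : Kᵒᵖ ⥤ FiltSpace.{u}) : ChainComplex (Kᵒᵖ ⥤ AddCommGrpCat.{u}) ℕ :=
  ChainComplex.of (fun n => O ⋙ FiltSpace.cellGroup n)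
    (fun n => Functor.whiskerLeft O (FiltSpace.cellDiff n)) (fun n => by
      rw [← Functor.whiskerLeft_comp, FiltSpace.cellDiff_comp]
      rfl)

/-- The chain complex `C_*(O) ⊗_{ℤK} M`. -/
def tensorComplex (O : Kᵒᵖ ⥤ FiltSpace.{u}) (M : K ⥤ AddCommGrpCat.{u}) :
    ChainComplex AddCommGrpCat.{u} ℕ :=
  ((tensorOver M).mapHomologicalComplex _).obj (cellComplex O)

/-- The homology `H_n(C_*(O) ⊗_{ℤK} M)`. -/
def tensorHomology (O : Kᵒᵖ ⥤ FiltSpace.{u}) (M : K ⥤ AddCommGrpCat.{u}) (n : ℕ) :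
    AddCommGrpCat.{u} :=
  (tensorComplex O M).homology n

/-- The class in `H_0(C_*(O) ⊗_{ℤK} M)` of `[y] ⊗ m`, for a point `y` of the zeroth filtration
step of `O(k)` and `m ∈ M(k)`. -/
def pointTensorClass (O : Kᵒᵖ ⥤ FiltSpace.{u}) (M : K ⥤ AddCommGrpCat.{u}) {k : K}
    (y : (O.obj (Opposite.op k)).fil 1) (m : M.obj k) : tensorHomology O M 0 :=
  ((tensorComplex O M).liftCycles (𝟙 ((tensorComplex O M).X 0)) 0 (by simp) (by simp) ≫
    (tensorComplex O M).homologyπ 0)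
    (tmulClass (C := O ⋙ FiltSpace.cellGroup 0) (FiltSpace.pointClass _ y) m)

end Tensor
/-! ### Bredon homology -/

section Bredon

/-- The contravariant functor from `Or_F(G)` to filtered spaces which sends `G/H` to
`map_G(G/H, X) = X^H`, filtered by the fixed point sets of the skeleta of `X`.  A `G`-map
`f : G/H → G/K` sends `x ∈ X^K`, viewed as the map `gK ↦ gx`, to its composite with `f`. -/
def fixedFilt (X : SmoothGCW G) (F : OpenFamily G) : (OrbitCat F)ᵒᵖ ⥤ FiltSpace.{u} where
  obj a :=
    { Y := TopCat.of (MulAction.fixedPoints a.unop.H X.carrier)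
      fil := fun n => {x | (x : X.carrier) ∈ X.cw.skLT n}
      mono := fun n x h => X.cw.skLT_subset n h }
  map {a b} f :=
    { map := TopCat.ofHom
        { toFun := fun x => ⟨orbitMap x (OrbitCat.toMap f.unop ((1 : G) : G ⧸ b.unop.H)), by
            intro h
            change (h : G) • orbitMap x (OrbitCat.toMap f.unop ((1 : G) : G ⧸ b.unop.H)) =
              orbitMap x (OrbitCat.toMap f.unop ((1 : G) : G ⧸ b.unop.H))
            rw [← orbitMap_smul, ← MulActionHom.map_smul]
            congr 2
            change ((h * 1 : G) : G ⧸ b.unop.H) = _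
            rw [QuotientGroup.eq]
            simp⟩
          continuous_toFun := by
            refine Continuous.subtype_mk ?_ _
            obtain ⟨y, hy⟩ := QuotientGroup.mk_surjective
              (OrbitCat.toMap f.unop ((1 : G) : G ⧸ b.unop.H))
            rw [← hy]
            exact (continuous_const_smul y).comp continuous_subtype_val }
      mapsTo := by
        intro n x hx
        obtain ⟨y, hy⟩ := QuotientGroup.mk_surjective
          (OrbitCat.toMap f.unop ((1 : G) : G ⧸ b.unop.H))
        change orbitMap x (OrbitCat.toMap f.unop ((1 : G) : G ⧸ b.unop.H)) ∈ X.cw.skLT n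
        rw [← hy]
        exact (X.cw.isSubcomplex_skLT n).smul_mem y hx }
  map_id a := by
    refine FiltSpace.Hom.ext ?_
    ext x
    exact one_smul G (x : X.carrier)
  map_comp {a b c} f f' := by
    refine FiltSpace.Hom.ext ?_
    ext x
    change orbitMap x (OrbitCat.toMap f.unop (OrbitCat.toMap f'.unop ((1 : G) : G ⧸ c.unop.H))) =
      orbitMap _ (OrbitCat.toMap f'.unop ((1 : G) : G ⧸ c.unop.H))
    obtain ⟨y, hy⟩ := QuotientGroup.mk_surjective
      (OrbitCat.toMap f'.unop ((1 : G) : G ⧸ c.unop.H))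
    rw [← hy, orbitMap_mk]
    have h1 : (y : G ⧸ b.unop.H) = y • ((1 : G) : G ⧸ b.unop.H) :=
      congrArg (QuotientGroup.mk (s := b.unop.H)) (mul_one y).symm
    rw [h1, MulActionHom.map_smul, orbitMap_smul]
    rfl

/-- The orbit relation of the action of the centralizer `C_G H` on `X^H`. -/
def centSetoid (X : SmoothGCW G) (H : Subgroup G) :
    Setoid (MulAction.fixedPoints H X.carrier) where
  r x y := ∃ c ∈ Subgroup.centralizer (H : Set G), c • (x : X.carrier) = y
  iseqv :=
    { refl := fun x => ⟨1, one_mem _, one_smul _ _⟩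
      symm := fun ⟨c, hc, h⟩ => ⟨c⁻¹, inv_mem hc, by rw [← h, inv_smul_smul]⟩
      trans := fun ⟨c, hc, h⟩ ⟨d, hd, h'⟩ => ⟨d * c, mul_mem hd hc, by rw [mul_smul, h, h']⟩ }

/-- The space `C_G H \ X^H` with the quotient topology. -/
abbrev CentQuotient (X : SmoothGCW G) (H : Subgroup G) : Type u := Quotient (centSetoid X H)

/-- The map `X^K → X^H`, `x ↦ g⁻¹x`, for `gHg⁻¹ ⊆ K`. -/
def fixedMap (X : SmoothGCW G) {H K : Subgroup G} (g : G) (hg : ∀ h ∈ H, g * h * g⁻¹ ∈ K)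
    (x : MulAction.fixedPoints K X.carrier) : MulAction.fixedPoints H X.carrier :=
  ⟨g⁻¹ • (x : X.carrier), by
    intro h
    have h1 : (g * h * g⁻¹) • (x : X.carrier) = x := x.2 ⟨_, hg h h.2⟩
    change (h : G) • g⁻¹ • (x : X.carrier) = g⁻¹ • (x : X.carrier)
    conv_rhs => rw [← h1]
    rw [smul_smul, smul_smul]
    congr 1
    group⟩

lemma fixedMap_equiv (X : SmoothGCW G) {a b : SubCat F} (g g' : G)
    (hg : ∀ h ∈ a.H, g * h * g⁻¹ ∈ b.H) (hg' : ∀ h ∈ a.H, g' * h * g'⁻¹ ∈ b.H)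
    (h : (SubCat.homMk g hg : a ⟶ b) = SubCat.homMk g' hg')
    (x y : MulAction.fixedPoints b.H X.carrier) (hxy : (centSetoid X b.H).r x y) :
    (centSetoid X a.H).r (fixedMap X g hg x) (fixedMap X g' hg' y) := by
  obtain ⟨k, hk, c, hc, rfl⟩ := (SubCat.homMk_eq_iff g g' hg hg').1 h
  obtain ⟨d, hd, hdx⟩ := hxy
  refine ⟨c⁻¹ * (g⁻¹ * d * g), mul_mem (inv_mem hc) ?_, ?_⟩
  · rw [Subgroup.mem_centralizer_iff] at hd ⊢
    intro h hh
    have h1 := hd _ (hg h hh)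
    calc h * (g⁻¹ * d * g) = g⁻¹ * (g * h * g⁻¹ * d) * g := by group
      _ = g⁻¹ * (d * (g * h * g⁻¹)) * g := by rw [h1]
      _ = g⁻¹ * d * g * h := by group
  · have h2 : k⁻¹ • (y : X.carrier) = y := y.2 ⟨_, inv_mem hk⟩
    change (c⁻¹ * (g⁻¹ * d * g)) • g⁻¹ • (x : X.carrier) = (k * g * c)⁻¹ • (y : X.carrier)
    rw [mul_inv_rev, mul_inv_rev, mul_smul c⁻¹ (g⁻¹ * k⁻¹), mul_smul g⁻¹ k⁻¹, h2, ← hdx]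
    simp only [smul_smul]
    congr 1
    group

/-- The map `C_G K \ X^K → C_G H \ X^H` induced by a morphism `H → K` of the subgroup category:
if the morphism is the class of `c(g)`, it is induced by `x ↦ g⁻¹x`. -/
def centMap (X : SmoothGCW G) {a b : SubCat F} (f : a ⟶ b) :
    CentQuotient X b.H → CentQuotient X a.H :=
  Quotient.map (sa := centSetoid X b.H) (sb := centSetoid X a.H)
    (fixedMap X (SubCat.exists_homMk f).choose (SubCat.exists_homMk f).choose_spec.choose)
    (fun x y hxy => fixedMap_equiv X _ _ _ _ rfl x y hxy)

lemma centMap_homMk (X : SmoothGCW G) {a b : SubCat F} (g : G)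
    (hg : ∀ h ∈ a.H, g * h * g⁻¹ ∈ b.H) (x : MulAction.fixedPoints b.H X.carrier) :
    centMap X (SubCat.homMk g hg : a ⟶ b) (Quotient.mk (centSetoid X b.H) x) =
      Quotient.mk (centSetoid X a.H) (fixedMap X g hg x) :=
  Quotient.sound (s := centSetoid X a.H) (fixedMap_equiv X _ _ _ _
    (SubCat.exists_homMk (SubCat.homMk g hg : a ⟶ b)).choose_spec.choose_spec.symm x x
    ((centSetoid X b.H).refl x))

/-- The contravariant functor from `Sub_F(G)` to filtered spaces which sends `H` to
`C_G H \ X^H`, filtered by the images of the skeleta of `X`. -/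
def centFilt (X : SmoothGCW G) (F : OpenFamily G) : (SubCat F)ᵒᵖ ⥤ FiltSpace.{u} where
  obj a :=
    { Y := TopCat.of (CentQuotient X a.unop.H)
      fil := fun n => Quotient.mk (centSetoid X a.unop.H) '' {x | (x : X.carrier) ∈ X.cw.skLT n}
      mono := fun n => Set.image_mono fun x h => X.cw.skLT_subset n h }
  map {a b} f :=
    { map := TopCat.ofHom
        { toFun := centMap X f.unop
          continuous_toFun := by
            refine Continuous.quotient_map' (s := centSetoid X a.unop.H)
              (t := centSetoid X b.unop.H) (Continuous.subtype_mk ?_ _) _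
            exact (continuous_const_smul _).comp continuous_subtype_val }
      mapsTo := by
        rintro n _ ⟨x, hx, rfl⟩
        exact ⟨_, (X.cw.isSubcomplex_skLT n).smul_mem _ hx, rfl⟩ }
  map_id a := by
    refine FiltSpace.Hom.ext ?_
    ext x
    obtain ⟨x, rfl⟩ := Quotient.exists_rep (s := centSetoid X a.unop.H) x
    change centMap X (𝟙 a.unop) (Quotient.mk (centSetoid X a.unop.H) x) =
      Quotient.mk (centSetoid X a.unop.H) x
    rw [SubCat.id_eq_homMk, centMap_homMk]
    refine congrArg (Quotient.mk (centSetoid X a.unop.H)) (Subtype.ext ?_)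
    change (1 : G)⁻¹ • (x : X.carrier) = x
    rw [inv_one, one_smul]
  map_comp {a b c} f f' := by
    refine FiltSpace.Hom.ext ?_
    ext x
    obtain ⟨x, rfl⟩ := Quotient.exists_rep (s := centSetoid X a.unop.H) x
    change centMap X (f'.unop ≫ f.unop) (Quotient.mk (centSetoid X a.unop.H) x) =
      centMap X f'.unop (centMap X f.unop (Quotient.mk (centSetoid X a.unop.H) x))
    obtain ⟨g, hg, h⟩ := SubCat.exists_homMk f.unop
    obtain ⟨g', hg', h'⟩ := SubCat.exists_homMk f'.unop
    rw [h, h', SubCat.homMk_comp, centMap_homMk, centMap_homMk, centMap_homMk]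
    refine congrArg (Quotient.mk (centSetoid X c.unop.H)) (Subtype.ext ?_)
    change (g * g')⁻¹ • (x : X.carrier) = g'⁻¹ • g⁻¹ • (x : X.carrier)
    rw [mul_inv_rev, mul_smul]

/-- Bredon homology `BH^{G,F}_n(X; M)` with coefficients in a covariant `ℤOr_F(G)`-module `M`. -/
abbrev bredonH (X : SmoothGCW G) (F : OpenFamily G) (M : OrbitCat F ⥤ AddCommGrpCat.{u}) (n : ℕ) :
    AddCommGrpCat.{u} :=
  tensorHomology (fixedFilt X F) M n

/-- The homology `SH^{G,F}_n(X; N)` with coefficients in a covariant `ℤSub_F(G)`-module `N`. -/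
abbrev subH (X : SmoothGCW G) (F : OpenFamily G) (N : SubCat F ⥤ AddCommGrpCat.{u}) (n : ℕ) :
    AddCommGrpCat.{u} :=
  tensorHomology (centFilt X F) N n

end Bredon

/-! ### The edge homomorphism of the equivariant Atiyah-Hirzebruch spectral sequence -/

section Edge

/-- The `n`-skeleton `X_n`. -/
def SmoothGCW.skel (X : SmoothGCW G) (n : ℕ) : SmoothGCW G :=
  X.restrict (X.cw.skLT (n + 1)) (X.cw.isSubcomplex_skLT (n + 1))

/-- The inclusion `X_n → X`. -/
def SmoothGCW.skelIncl (X : SmoothGCW G) (n : ℕ) : (X.skel n).toPair ⟶ X.toPair where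
  toFun := Subtype.val
  continuous_toFun := continuous_subtype_val
  map_smul _ _ := rfl
  mapsTo _ h := h.elim

/-- The pair `(X_1, X_0)`. -/
abbrev SmoothGCW.skelPair (X : SmoothGCW G) : SmoothGCWPair G :=
  ⟨X.skel 1, (X.skel 1).cw.skLT 1, (X.skel 1).cw.isSubcomplex_skLT 1⟩

/-- The identification of the subcomplex `X_0` of `X_1` with the subcomplex `X_0` of `X`. -/
def SmoothGCW.skelZeroMap (X : SmoothGCW G) :
    SmoothGCWPair.bd.obj X.skelPair ⟶ (X.skel 0).toPair where
  toFun := fun x : (X.skel 1).cw.skLT 1 => (⟨x.1.1, x.2⟩ : X.cw.skLT 1)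
  continuous_toFun := Continuous.subtype_mk (p := fun x => x ∈ X.cw.skLT 1)
    ((continuous_subtype_val (p := fun x => x ∈ X.cw.skLT 2)).comp
      (continuous_subtype_val (p := fun x => x ∈ (X.skel 1).cw.skLT 1))) _
  map_smul _ _ := rfl
  mapsTo _ h := h.elim

namespace SmoothGHomologyTheory

variable (ℋ : SmoothGHomologyTheory G) (X : SmoothGCW G) (q : ℤ)

/-- The first differential `d^1 : E^1_{1,q} = ℋ_{q+1}(X_1, X_0) → ℋ_q(X_0) = E^1_{0,q}` of the
spectral sequence of the skeletal filtration of `X`. -/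
def dOne : (ℋ.H (q + 1)).obj X.skelPair ⟶ ℋ.abs q (X.skel 0) :=
  (ℋ.boundary q).app X.skelPair ≫ (ℋ.H q).map X.skelZeroMap

/-- The term `E^2_{0,q}`, the cokernel of `d^1 : E^1_{1,q} → E^1_{0,q}`. -/
def ETwo : AddCommGrpCat.{u} := cokernel (ℋ.dOne X q)

/-- The projection `E^1_{0,q} = ℋ_q(X_0) → E^2_{0,q}`. -/
def toETwo : ℋ.abs q (X.skel 0) ⟶ ℋ.ETwo X q := cokernel.π (ℋ.dOne X q)

lemma dOne_comp : ℋ.dOne X q ≫ (ℋ.H q).map (X.skelIncl 0) = 0 := by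
  have h1 : X.skelZeroMap ≫ X.skelIncl 0 = X.skelPair.bdIncl ≫ X.skelIncl 1 := rfl
  have h2 : (ℋ.boundary q).app X.skelPair ≫ (ℋ.H q).map X.skelPair.bdIncl = 0 := by
    ext z
    exact (ℋ.exact_bd q X.skelPair).apply_apply_eq_zero z
  change ((ℋ.boundary q).app X.skelPair ≫ (ℋ.H q).map X.skelZeroMap) ≫ _ = 0
  rw [Category.assoc, ← Functor.map_comp, h1, Functor.map_comp]
  exact (Category.assoc _ _ _).symm.trans ((congrArg (· ≫ _) h2).trans zero_comp)

/-- The edge homomorphism `E^2_{0,q} → ℋ_q(X)` of the spectral sequence of the skeletal filtration,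
induced by the inclusion `X_0 → X`. -/
def edge : ℋ.ETwo X q ⟶ ℋ.abs q X :=
  cokernel.desc (ℋ.dOne X q) ((ℋ.H q).map (X.skelIncl 0)) (ℋ.dOne_comp X q)

variable [IsTopologicalGroup G]

/-- The defining property of the canonical identification of `BH^{G,F}_0(X; ℋ_q)` with `E^2_{0,q}`:
for `x ∈ X_0^H` and `m ∈ ℋ_q(G/H)`, the class of `[x] ⊗ m` goes to the class of the image of `m`
under the map induced by `G/H → X_0`, `gH ↦ gx`. -/
def IsBredonIdentification (F : OpenFamily G)
    (Θ : bredonH X F (ℋ.orbitModule F q) 0 ⟶ ℋ.ETwo X q) : Prop :=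
  ∀ (a : OrbitCat F) (x : MulAction.fixedPoints a.H X.carrier) (hx : (x : X.carrier) ∈ X.cw.skLT 1)
    (m : ℋ.abs q (orbit a.H (F.isOpen a.H a.mem))),
    Θ (pointTensorClass (fixedFilt X F) (ℋ.orbitModule F q) (k := a) ⟨x, hx⟩ m) =
      ℋ.toETwo X q ((ℋ.H q).map (pointMap (X.skel 0) (F.isOpen a.H a.mem)
        ⟨⟨x, hx⟩, fun h => Subtype.ext (x.2 h)⟩) m)

/-- The defining property of the canonical identification of `SH^{G,F}_0(X; ℋ_q)` with `E^2_{0,q}`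
under Condition (Sub): for `x ∈ X_0^H` and `m ∈ ℋ_q(G/H)`, the class of `[C_G H x] ⊗ m` goes to the
class of the image of `m` under the map induced by `G/H → X_0`, `gH ↦ gx`. -/
def IsSubIdentification {F : OpenFamily G} (hS : ℋ.ConditionSub F)
    (Θ : subH X F (ℋ.subModule hS q) 0 ⟶ ℋ.ETwo X q) : Prop :=
  ∀ (a : SubCat F) (x : MulAction.fixedPoints a.H X.carrier) (hx : (x : X.carrier) ∈ X.cw.skLT 1)
    (m : ℋ.abs q (orbit a.H (F.isOpen a.H a.mem))),
    Θ (pointTensorClass (centFilt X F) (ℋ.subModule hS q) (k := a)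
        ⟨Quotient.mk (centSetoid X a.H) x, x, hx, rfl⟩ m) =
      ℋ.toETwo X q ((ℋ.H q).map (pointMap (X.skel 0) (F.isOpen a.H a.mem)
        ⟨⟨x, hx⟩, fun h => Subtype.ext (x.2 h)⟩) m)

end SmoothGHomologyTheory

end Edge

/-! ### The classifying space for smooth proper actions -/

/-- A space is weakly contractible if it is non-empty and all its homotopy sets and groups are
trivial. -/
def WeaklyContractible (Z : Type u) [TopologicalSpace Z] : Prop :=
  Nonempty Z ∧ ∀ (n : ℕ) (z : Z), Subsingleton (HomotopyGroup.Pi n Z z)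

/-- `X` is a model for the classifying space `E_Cop(G)` for smooth proper `G`-actions. -/
def IsClassifyingSpaceCop (X : SmoothGCW G) : Prop :=
  (∀ x : X.carrier, IsOpen (MulAction.stabilizer G x : Set G) ∧
    IsCompact (MulAction.stabilizer G x : Set G)) ∧
  ∀ H : Subgroup G, IsOpen (H : Set G) → IsCompact (H : Set G) →
    WeaklyContractible (MulAction.fixedPoints H X.carrier)

end SmoothBredon

end

/-! The core is one vanishing statement, `Connective.vanish_skLT`: if the orbits G/H belonging to
the cells of X have homology only in degrees ≥ 0, then ℋ_q(X, X_{m-1}) = 0 for all q < m. For the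
equivariant cells G/H × (D^n, S^{n-1}) this follows by suspending n times, since D^{n+1} is
homeomorphic to D^n × [0,1]. Excision passes from cells to the layers (X_n, X_{n-1}), and exact
sequences of triples pass from layers to (X_n, X_{m-1}). For infinite-dimensional X the telescope T
= ⋃ X_{n-1} × [n, ∞) inside X × ℝ takes the place of a colimit argument. Its integral levels form a
disjoint union of skeleta, the rest of T is relatively a suspension of these levels, and X is a
homotopy retract of T. The space X × ℝ receives a G-CW-structure so that the axioms apply to all
these pieces.

Three values of m suffice. For m = 0 the statement is the vanishing in negative degrees. For m = 1
it says that ℋ_0(X_0) → ℋ_0(X) is onto, and for m = 2 that its kernel is the image of d^1. Hence the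
edge homomorphism from the cokernel of d^1 is an isomorphism, and no convergence of a spectral
sequence is needed.

It follows that ℋ_0(X) has a presentation. Generators are pairs (x, m) with x ∈ X_0^H and m ∈
ℋ_0(G/H), additive in m. Relations are naturality in G/H and independence of x along paths in X_1^H
(`Connective.induction_on`, `Connective.exists_hom_of_points`). Bredon homology in degree 0 has the
same presentation, because singular H_0 is free on path components, so the two universal properties
give mutually inverse maps. Under Condition (Sub) a generator depends only on the C_GH-orbit of x,
and the same argument works with C_GH\X^H. Paths in that quotient are not lifted: a function on X^H
which is constant along paths is locally constant, and local constancy descends to the quotient.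

For the classifying space and H ∈ I the set X^H is path connected and meets X_0. Then x no longer
matters, and the presentation becomes that of the colimit of the groups ℋ_0(G/H). -/

noncomputable section

namespace SmoothBredon

/-! ### Closed subsets of products with a locally compact space -/

section Slices

variable {Z Y Λ : Type*} [TopologicalSpace Y] [TopologicalSpace Λ]

/-- The complement of a closed subset of `Λ`, as a map to the Sierpinski space. -/
def sliceMap (C : Set (Z × Λ)) (hC : ∀ z, IsClosed {l | (z, l) ∈ C}) (z : Z) : C(Λ, Prop) :=
  ⟨fun l => (z, l) ∉ C, by
    have h := (hC z).isOpen_compl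
    rwa [isOpen_iff_continuous_mem] at h⟩

/-- This is the exponential law for the locally compact space Λ, with values in the Sierpinski
space: closed subsets of Y × Λ correspond to continuous maps Y → C(Λ, Prop). -/
lemma continuous_sliceMap_comp [LocallyCompactSpace Λ] {C : Set (Z × Λ)}
    (hC : ∀ z, IsClosed {l | (z, l) ∈ C}) (g : Y → Z) :
    Continuous (fun y => sliceMap C hC (g y)) ↔ IsClosed {p : Y × Λ | (g p.1, p.2) ∈ C} := by
  rw [← isOpen_compl_iff, isOpen_iff_continuous_mem]
  constructor
  · intro h
    exact ContinuousMap.continuous_uncurry_of_continuous ⟨_, h⟩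
  · intro h
    exact ContinuousMap.continuous_of_continuous_uncurry _ h

lemma isClosed_inter_prod_iff [TopologicalSpace Z] [LocallyCompactSpace Λ] {C : Set (Z × Λ)}
    (hC : ∀ z, IsClosed {l | (z, l) ∈ C}) {s : Set Z} (hs : IsClosed s) :
    IsClosed (C ∩ s ×ˢ Set.univ) ↔ ContinuousOn (sliceMap C hC) s := by
  rw [continuousOn_iff_continuous_domRestrict]
  refine Iff.trans ?_ (continuous_sliceMap_comp hC (Subtype.val : s → Z)).symm
  have hemb : Topology.IsClosedEmbedding (fun p : s × Λ => ((p.1 : Z), p.2)) :=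
    hs.isClosedEmbedding_subtypeVal.prodMap Topology.IsClosedEmbedding.id
  rw [hemb.isClosed_iff_image_isClosed]
  have : (fun p : s × Λ => ((p.1 : Z), p.2)) '' {p : s × Λ | ((p.1 : Z), p.2) ∈ C} =
      C ∩ s ×ˢ Set.univ := by
    ext ⟨z, l⟩
    constructor
    · rintro ⟨⟨⟨z, hz⟩, l⟩, h, h'⟩
      cases h'
      exact ⟨h, hz, trivial⟩
    · rintro ⟨h, hz, -⟩
      exact ⟨⟨⟨z, hz⟩, l⟩, h, rfl⟩
  rw [this]

end Slices

/-! ### Products of a G-CW-complex with a locally compact space. -/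

namespace GCWStructure

variable {G : Type u} [Group G] [TopologicalSpace G]
  {X : Type u} [TopologicalSpace X] [MulAction G X] (cw : GCWStructure G X)

lemma mem_skLT_or_exists {n : ℕ} {x : X} (hx : x ∈ cw.skLT (n + 1)) :
    x ∈ cw.skLT n ∨ ∃ i p, p.2.norm < 1 ∧ cw.char n i p = x := by
  by_cases h : x ∈ cw.skLT n
  · exact Or.inl h
  · obtain ⟨⟨i, p⟩, hp, hpx⟩ := (cw.bijOn_char n).surjOn ⟨hx, h⟩
    exact Or.inr ⟨i, p, hp, hpx⟩

lemma char_not_mem {n : ℕ} {i : cw.cell n} {p : (G ⧸ cw.typ n i) × Disk n} (hp : p.2.norm < 1) :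
    cw.char n i p ∉ cw.skLT n :=
  (cw.openCell_subset n i ⟨p, hp, rfl⟩).2

lemma exists_mem_skLT (x : X) : ∃ n, x ∈ cw.skLT n := by
  have : x ∈ ⋃ n, cw.skLT n := by rw [cw.iUnion_skLT]; trivial
  simpa using this

variable {Λ : Type*} [TopologicalSpace Λ] [LocallyCompactSpace Λ]

/-- `X_n × Λ` carries the quotient topology of `X_{n-1} × Λ` and the cells times `Λ`. -/
lemma isClosed_prod_of_char (n : ℕ) (C : Set (X × Λ)) (hC : C ⊆ cw.skLT (n + 1) ×ˢ Set.univ)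
    (h0 : IsClosed (C ∩ cw.skLT n ×ˢ Set.univ))
    (h1 : ∀ i, IsClosed {p : ((G ⧸ cw.typ n i) × Disk n) × Λ | (cw.char n i p.1, p.2) ∈ C}) :
    IsClosed C := by
  -- Closed slices are needed before `sliceMap` can be formed at all; slices over points outside X_n
  -- are empty.
  have hs : ∀ x, IsClosed {l | (x, l) ∈ C} := by
    intro x
    by_cases hx : x ∈ cw.skLT (n + 1)
    · rcases cw.mem_skLT_or_exists hx with h | ⟨i, p, -, rfl⟩
      · convert h0.preimage (Continuous.prodMk_right x) using 1
        ext l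
        exact ⟨fun hl => ⟨hl, h, trivial⟩, fun hl => hl.1⟩
      · exact (h1 i).preimage (Continuous.prodMk_right p)
    · convert isClosed_empty (X := Λ) using 1
      ext l
      exact ⟨fun hl => hx (hC hl).1, fun hl => hl.elim⟩
  -- The quotient topology of X_n tests continuity of maps into any space, in particular into C(Λ,
  -- Prop). Continuity there is closedness of C by the exponential law.
  have key : ContinuousOn (sliceMap C hs) (cw.skLT (n + 1)) := by
    rw [continuousOn_iff_isClosed]
    intro K hK
    refine ⟨sliceMap C hs ⁻¹' K ∩ cw.skLT (n + 1), ?_, by rw [Set.inter_assoc, Set.inter_self]⟩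
    refine cw.isClosed_of_char n _ Set.inter_subset_right ?_ fun i => ?_
    · rw [Set.inter_assoc, Set.inter_eq_right.2 (cw.skLT_subset n)]
      rw [isClosed_inter_prod_iff hs (cw.isClosed_skLT n), continuousOn_iff_isClosed] at h0
      obtain ⟨u, hu, huK⟩ := h0 K hK
      rw [huK]
      exact hu.inter (cw.isClosed_skLT n)
    · have hc := (continuous_sliceMap_comp hs (cw.char n i)).2 (h1 i)
      refine (hK.preimage hc).inter ?_
      exact (cw.isClosed_skLT (n + 1)).preimage (cw.continuous_char n i)
  rw [← isClosed_inter_prod_iff hs (cw.isClosed_skLT _), Set.inter_eq_left.2 hC] at key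
  exact key

/-- `X × Λ` is the colimit of the `X_n × Λ`. -/
lemma isClosed_prod_of_skLT (C : Set (X × Λ))
    (h : ∀ n, IsClosed (C ∩ cw.skLT n ×ˢ Set.univ)) : IsClosed C := by
  have hs : ∀ x, IsClosed {l | (x, l) ∈ C} := by
    intro x
    obtain ⟨n, hn⟩ := cw.exists_mem_skLT x
    convert (h n).preimage (Continuous.prodMk_right x) using 1
    ext l
    exact ⟨fun hl => ⟨hl, hn, trivial⟩, fun hl => hl.1⟩
  have key : Continuous (sliceMap C hs) := by
    rw [continuous_iff_isClosed]
    intro K hK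
    refine cw.isClosed_of_skLT _ fun n => ?_
    have h0 := h n
    rw [isClosed_inter_prod_iff hs (cw.isClosed_skLT n), continuousOn_iff_isClosed] at h0
    obtain ⟨u, hu, huK⟩ := h0 K hK
    rw [huK]
    exact hu.inter (cw.isClosed_skLT n)
  exact (continuous_sliceMap_comp hs id).1 key

variable {cw} in
/-- A map on `X × Λ` is continuous on `X_n × Λ` if its composites with all characteristic maps
of cells of dimension less than `n` are. -/
lemma continuousOn_prod_succ {Y : Type*} [TopologicalSpace Y] {f : X × Λ → Y} {n : ℕ}
    (h0 : ContinuousOn f (cw.skLT n ×ˢ Set.univ))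
    (h1 : ∀ i, Continuous fun p : ((G ⧸ cw.typ n i) × Disk n) × Λ => f (cw.char n i p.1, p.2)) :
    ContinuousOn f (cw.skLT (n + 1) ×ˢ Set.univ) := by
  rw [continuousOn_iff_isClosed]
  intro K hK
  refine ⟨f ⁻¹' K ∩ cw.skLT (n + 1) ×ˢ Set.univ, ?_, by rw [Set.inter_assoc, Set.inter_self]⟩
  refine cw.isClosed_prod_of_char n _ Set.inter_subset_right ?_ fun i => ?_
  · rw [Set.inter_assoc, Set.inter_eq_right.2 (Set.prod_mono_left (cw.skLT_subset n))]
    obtain ⟨u, hu, huK⟩ := continuousOn_iff_isClosed.1 h0 K hK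
    rw [huK]
    exact hu.inter ((cw.isClosed_skLT n).prod isClosed_univ)
  · convert hK.preimage (h1 i) using 1
    ext p
    exact ⟨fun hp => hp.1, fun hp => ⟨hp, cw.char_mem_skLT_succ i p.1, trivial⟩⟩

variable {cw} in
lemma continuous_prod_of_skLT {Y : Type*} [TopologicalSpace Y] {f : X × Λ → Y}
    (h : ∀ n, ContinuousOn f (cw.skLT n ×ˢ Set.univ)) : Continuous f := by
  rw [continuous_iff_isClosed]
  intro K hK
  refine cw.isClosed_prod_of_skLT _ fun n => ?_
  obtain ⟨u, hu, huK⟩ := continuousOn_iff_isClosed.1 (h n) K hK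
  rw [huK]
  exact hu.inter ((cw.isClosed_skLT n).prod isClosed_univ)

end GCWStructure

/-! ### The product of a disk with an interval -/

lemma Disk.norm_le_one {n : ℕ} (d : Disk n) : d.norm ≤ 1 := by
  have := d.2
  rwa [mem_closedBall_zero_iff] at this

lemma Disk.norm_nonneg {n : ℕ} (d : Disk n) : 0 ≤ d.norm := _root_.norm_nonneg _

lemma Disk.continuous_norm {n : ℕ} : Continuous (Disk.norm (n := n)) :=
  _root_.continuous_norm.comp continuous_subtype_val

/-- Two bounded convex bodies with interior points in the same finite-dimensional space are matched
by a homeomorphism of the ambient space that respects interiors. The norm condition records that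
open cells go to products of open cells. -/
lemma exists_disk_homeomorph (n : ℕ) : ∃ θ : Disk (n + 1) ≃ₜ Disk n × Set.Icc (0 : ℝ) 1,
    ∀ d, d.norm < 1 ↔ (θ d).1.norm < 1 ∧ 0 < ((θ d).2 : ℝ) ∧ ((θ d).2 : ℝ) < 1 := by
  let E := EuclideanSpace ℝ (Fin n)
  let L : EuclideanSpace ℝ (Fin (n + 1)) ≃L[ℝ] E × ℝ :=
    ContinuousLinearEquiv.ofFinrankEq (by simp [E])
  let s : Set (E × ℝ) := L '' Metric.closedBall 0 1
  let t : Set (E × ℝ) := Metric.closedBall 0 1 ×ˢ Set.Icc 0 1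
  have hsi : interior s = L '' Metric.ball 0 1 := by
    have := L.toHomeomorph.image_interior (Metric.closedBall 0 1)
    rw [interior_closedBall _ one_ne_zero] at this
    exact this.symm
  have hti : interior t = Metric.ball 0 1 ×ˢ Set.Ioo 0 1 := by
    rw [interior_prod_eq, interior_closedBall _ one_ne_zero, interior_Icc]
  have hsc : closure s = s :=
    ((isCompact_closedBall _ _).image L.continuous).isClosed.closure_eq
  have htc : closure t = t := (Metric.isClosed_closedBall.prod isClosed_Icc).closure_eq
  obtain ⟨e, h1, h2, -⟩ := exists_homeomorph_image_eq (s := s) (t := t)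
    ((convex_closedBall _ _).linear_image L.toLinearMap)
    (by rw [hsi]; exact ⟨L 0, 0, by simp, rfl⟩)
    (((isCompact_closedBall _ _).image L.continuous).isVonNBounded ℝ)
    ((convex_closedBall _ _).prod (convex_Icc _ _))
    (by rw [hti]; exact ⟨(0, 1 / 2), by simp, by norm_num⟩)
    (((isCompact_closedBall _ _).prod isCompact_Icc).isVonNBounded ℝ)
  rw [hsc, htc] at h2
  rw [hsi, hti] at h1
  let f : EuclideanSpace ℝ (Fin (n + 1)) ≃ₜ E × ℝ := L.toHomeomorph.trans e
  have hf : ∀ v, v ∈ Metric.closedBall 0 1 ↔ f v ∈ t := fun v => by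
    rw [← h2]
    change _ ↔ e (L v) ∈ _
    rw [e.injective.mem_set_image, L.injective.mem_set_image]
  have hf' : ∀ v, v ∈ Metric.ball 0 1 ↔ f v ∈ Metric.ball 0 1 ×ˢ Set.Ioo (0 : ℝ) 1 := fun v => by
    rw [← h1]
    change _ ↔ e (L v) ∈ _
    rw [e.injective.mem_set_image, L.injective.mem_set_image]
  have hg : ∀ w ∈ t, f.symm w ∈ Metric.closedBall 0 1 := fun w hw => by
    rw [hf, f.apply_symm_apply]; exact hw
  refine ⟨{ toFun := fun d => (⟨(f d).1, ((hf _).1 d.2).1⟩, ⟨(f d).2, ((hf _).1 d.2).2⟩)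
            invFun := fun p => ⟨f.symm (p.1, p.2), hg _ ⟨p.1.2, p.2.2⟩⟩
            left_inv := fun d => Subtype.ext (f.symm_apply_apply d)
            right_inv := fun p => ?_
            continuous_toFun := ?_
            continuous_invFun := ?_ }, fun d => ?_⟩
  · have := f.apply_symm_apply ((p.1 : E), (p.2 : ℝ))
    exact Prod.ext (Subtype.ext (congrArg Prod.fst this)) (Subtype.ext (congrArg Prod.snd this))
  · have hc : Continuous fun d : Disk (n + 1) => f d := f.continuous.comp continuous_subtype_val
    exact (hc.fst.subtype_mk _).prodMk (hc.snd.subtype_mk _)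
  · refine Continuous.subtype_mk (f.symm.continuous.comp ?_) _
    fun_prop
  · have := hf' d
    rw [mem_ball_zero_iff] at this
    refine this.trans ?_
    rw [Set.mem_prod, mem_ball_zero_iff]
    rfl

end SmoothBredon

end

/-! ### The G-CW-structure on X × ℝ. -/

noncomputable section

namespace SmoothBredon

/-! ### Closed subsets of `B × ℝ` -/

section Slabs

variable {B : Type*} [TopologicalSpace B]

lemma locallyFinite_Icc_intCast : LocallyFinite fun k : ℤ => Set.Icc (k : ℝ) (k + 1) := by
  intro t
  refine ⟨Set.Ioo (t - 1) (t + 1), Ioo_mem_nhds (by linarith) (by linarith),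
    (Set.finite_Icc (⌊t⌋ - 2) (⌊t⌋ + 2)).subset ?_⟩
  rintro k ⟨s, ⟨h1, h2⟩, h3, h4⟩
  have h5 := Int.floor_le t
  have h6 := Int.lt_floor_add_one t
  constructor
  · have : ((⌊t⌋ - 2 : ℤ) : ℝ) ≤ k := by push_cast; linarith
    exact_mod_cast this
  · have : (k : ℝ) < ((⌊t⌋ + 2 : ℤ) : ℝ) := by push_cast; linarith
    exact (Int.cast_lt.1 this).le

lemma iUnion_Icc_intCast (t : ℝ) : ∃ k : ℤ, t ∈ Set.Icc (k : ℝ) (k + 1) :=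
  ⟨⌊t⌋, Int.floor_le t, (Int.lt_floor_add_one t).le⟩

lemma isClosed_iUnion_slab {S : ℤ → Set (B × ℝ)} (h : ∀ k, IsClosed (S k))
    (hS : ∀ k, S k ⊆ Set.univ ×ˢ Set.Icc (k : ℝ) (k + 1)) : IsClosed (⋃ k, S k) := by
  refine LocallyFinite.isClosed_iUnion ?_ h
  refine (locallyFinite_Icc_intCast.preimage_continuous (continuous_snd (X := B))).subset ?_
  intro k p hp
  exact (hS k hp).2

lemma isClosed_of_slab {C : Set (B × ℝ)}
    (h : ∀ k : ℤ, IsClosed (C ∩ Set.univ ×ˢ Set.Icc (k : ℝ) (k + 1))) : IsClosed C := by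
  have := isClosed_iUnion_slab h fun k => Set.inter_subset_right
  convert this
  ext p
  constructor
  · intro hp
    obtain ⟨k, hk⟩ := iUnion_Icc_intCast p.2
    exact Set.mem_iUnion.2 ⟨k, hp, trivial, hk⟩
  · intro hp
    obtain ⟨k, hk⟩ := Set.mem_iUnion.1 hp
    exact hk.1

lemma isClosed_slab_of_preimage {C : Set (B × ℝ)} {k : ℤ}
    (h : IsClosed {p : B × Set.Icc (0 : ℝ) 1 | (p.1, (k : ℝ) + p.2) ∈ C}) :
    IsClosed (C ∩ Set.univ ×ˢ Set.Icc (k : ℝ) (k + 1)) := by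
  have hemb : Topology.IsClosedEmbedding
      (fun p : B × Set.Icc (0 : ℝ) 1 => (p.1, (k : ℝ) + p.2)) :=
    Topology.IsClosedEmbedding.id.prodMap
      ((Homeomorph.addLeft (k : ℝ)).isClosedEmbedding.comp isClosed_Icc.isClosedEmbedding_subtypeVal)
  have := hemb.isClosedMap _ h
  convert this using 1
  ext ⟨b, t⟩
  constructor
  · rintro ⟨h1, -, h2, h3⟩
    refine ⟨(b, ⟨t - k, by linarith, by linarith⟩), ?_, ?_⟩
    · change (b, (k : ℝ) + (t - k)) ∈ C
      rwa [add_sub_cancel]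
    · change (b, (k : ℝ) + (t - k)) = _
      rw [add_sub_cancel]
  · rintro ⟨⟨b', s⟩, h1, h2⟩
    rw [← h2]
    have h3 := s.2.1
    have h4 := s.2.2
    exact ⟨h1, trivial, by linarith, by linarith⟩

lemma isClosed_range_intCast_real : IsClosed (Set.range ((↑) : ℤ → ℝ)) :=
  Int.isClosedEmbedding_coe_real.isClosed_range

end Slabs

/-! ### The product of a `G`-CW-complex with the real line -/

namespace GCWStructure

variable {G : Type u} [Group G] [TopologicalSpace G]
  {X : Type u} [TopologicalSpace X] [MulAction G X] (cw : GCWStructure G X)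

/-- The action on `X × ℝ` which is trivial on the second factor. -/
abbrev lineAction : MulAction G (X × ℝ) where
  smul g p := (g • p.1, p.2)
  one_smul p := Prod.ext (one_smul G p.1) rfl
  mul_smul g h p := Prod.ext (mul_smul g h p.1) rfl

/-- The cells of `X × ℝ`: products of the cells of `X` with integers and with the intervals
between successive integers. -/
inductive LineCell : ℕ → Type u
  | vert {n : ℕ} (i : cw.cell n) (k : ℤ) : LineCell n
  | edge {n : ℕ} (i : cw.cell n) (k : ℤ) : LineCell (n + 1)

/-- A homeomorphism `D^{n+1} ≅ D^n × [0,1]`. -/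
def diskHomeo (n : ℕ) : Disk (n + 1) ≃ₜ Disk n × Set.Icc (0 : ℝ) 1 :=
  (exists_disk_homeomorph n).choose

lemma norm_lt_one_iff_diskHomeo {n : ℕ} (d : Disk (n + 1)) : d.norm < 1 ↔
    (diskHomeo n d).1.norm < 1 ∧ 0 < ((diskHomeo n d).2 : ℝ) ∧ ((diskHomeo n d).2 : ℝ) < 1 :=
  (exists_disk_homeomorph n).choose_spec d

/-- The subgroups belonging to the cells of `X × ℝ`. -/
def lineTyp : ∀ n, cw.LineCell n → Subgroup G
  | _, .vert (n := n) i _ => cw.typ n i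
  | _, .edge (n := n) i _ => cw.typ n i

/-- The characteristic maps of `X × ℝ`. -/
def lineChar : ∀ (n : ℕ) (c : cw.LineCell n), (G ⧸ cw.lineTyp n c) × Disk n → X × ℝ
  | _, .vert (n := n) i k => fun p => (cw.char n i p, k)
  | _, .edge (n := n) i k => fun p =>
      (cw.char n i (p.1, (diskHomeo n p.2).1), k + (diskHomeo n p.2).2)

/-- The skeleta of `X × ℝ`. -/
def lineSk (n : ℕ) : Set (X × ℝ) :=
  -- The subtraction is truncated, which is harmless: for n = 0 and n = 1 the first factor is `skLT
  -- 0`, the empty set.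
  cw.skLT (n - 1) ×ˢ Set.univ ∪ cw.skLT n ×ˢ Set.range ((↑) : ℤ → ℝ)

lemma lineSk_subset_prod (n : ℕ) : cw.lineSk n ⊆ cw.skLT n ×ˢ Set.univ := by
  rintro p (⟨h1, -⟩ | ⟨h1, -⟩)
  · exact ⟨cw.skLT_mono (Nat.sub_le n 1) h1, trivial⟩
  · exact ⟨h1, trivial⟩

lemma isClosed_lineSk (n : ℕ) : IsClosed (cw.lineSk n) :=
  ((cw.isClosed_skLT _).prod isClosed_univ).union
    ((cw.isClosed_skLT _).prod isClosed_range_intCast_real)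

lemma continuous_lineChar (n : ℕ) (c : cw.LineCell n) : Continuous (cw.lineChar n c) := by
  cases c with
  | vert i k => exact (cw.continuous_char n i).prodMk continuous_const
  | @edge n i k =>
    have h : Continuous fun p : (G ⧸ cw.typ n i) × Disk (n + 1) => diskHomeo n p.2 :=
      (diskHomeo n).continuous.comp continuous_snd
    exact ((cw.continuous_char n i).comp (continuous_fst.prodMk h.fst)).prodMk
      (continuous_const.add (continuous_subtype_val.comp h.snd))

lemma not_mem_range_intCast {t : ℝ} {k : ℤ} (h1 : (k : ℝ) < t) (h2 : t < k + 1) :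
    t ∉ Set.range ((↑) : ℤ → ℝ) := by
  rintro ⟨l, rfl⟩
  have h3 : k < l := by exact_mod_cast h1
  have h4 : l < k + 1 := by exact_mod_cast h2
  omega

lemma lineChar_mapsTo (n : ℕ) : Set.MapsTo
    (fun p : Σ c : cw.LineCell n, (G ⧸ cw.lineTyp n c) × Disk n => cw.lineChar n p.1 p.2)
    {p | p.2.2.norm < 1} (cw.lineSk (n + 1) \ cw.lineSk n) := by
  rintro ⟨c, p⟩ hp
  cases c with
  | vert i k =>
    have hx := cw.openCell_subset n i ⟨p, hp, rfl⟩
    refine ⟨Or.inr ⟨hx.1, k, rfl⟩, fun h => hx.2 (cw.lineSk_subset_prod n h).1⟩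
  | @edge n i k =>
    obtain ⟨h1, h2, h3⟩ := (norm_lt_one_iff_diskHomeo p.2).1 hp
    have hx := cw.openCell_subset n i ⟨(p.1, (diskHomeo n p.2).1), h1, rfl⟩
    refine ⟨Or.inl ⟨hx.1, trivial⟩, ?_⟩
    rintro (h | h)
    · exact hx.2 h.1
    · exact not_mem_range_intCast (lt_add_of_pos_right (k : ℝ) h2)
        (add_lt_add_right h3 (k : ℝ)) h.2

lemma lineChar_injOn (n : ℕ) : Set.InjOn
    (fun p : Σ c : cw.LineCell n, (G ⧸ cw.lineTyp n c) × Disk n => cw.lineChar n p.1 p.2)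
    {p | p.2.2.norm < 1} := by
  rintro ⟨c, p⟩ hp ⟨c', p'⟩ hp' h
  cases c with
  | vert i k =>
    cases c' with
    | vert i' k' =>
      have h1 := cw.char_injective (i := i) (j := i') hp hp' (congrArg Prod.fst h)
      have h2 : k = k' := Int.cast_injective (α := ℝ) (congrArg Prod.snd h)
      subst h2
      obtain ⟨rfl, h3⟩ := Sigma.mk.inj h1
      obtain rfl := eq_of_heq h3
      rfl
    | @edge n i' k' =>
      obtain ⟨-, h2, h3⟩ := (norm_lt_one_iff_diskHomeo p'.2).1 hp'
      exact absurd ⟨k, congrArg Prod.snd h⟩ (not_mem_range_intCast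
        (lt_add_of_pos_right (k' : ℝ) h2) (add_lt_add_right h3 (k' : ℝ)))
  | @edge n i k =>
    obtain ⟨h1, h2, h3⟩ := (norm_lt_one_iff_diskHomeo p.2).1 hp
    cases c' with
    | vert i' k' =>
      exact absurd ⟨k', (congrArg Prod.snd h).symm⟩ (not_mem_range_intCast
        (lt_add_of_pos_right (k : ℝ) h2) (add_lt_add_right h3 (k : ℝ)))
    | edge i' k' =>
      obtain ⟨h1', h2', h3'⟩ := (norm_lt_one_iff_diskHomeo p'.2).1 hp'
      have e1 := cw.char_injective (i := i) (j := i') (p := (p.1, (diskHomeo n p.2).1))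
        (q := (p'.1, (diskHomeo n p'.2).1)) h1 h1' (congrArg Prod.fst h)
      have e2 : (k : ℝ) + (diskHomeo n p.2).2 = k' + (diskHomeo n p'.2).2 := congrArg Prod.snd h
      have e3 : k = k' := by
        have a1 : (k : ℝ) < k' + 1 := by linarith
        have a2 : (k' : ℝ) < k + 1 := by linarith
        have a1' : k < k' + 1 := by exact_mod_cast a1
        have a2' : k' < k + 1 := by exact_mod_cast a2
        omega
      subst e3
      obtain ⟨rfl, h4⟩ := Sigma.mk.inj e1
      have h5 := eq_of_heq h4
      obtain ⟨h6, h7⟩ := Prod.mk.inj h5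
      have h8 : p = p' :=
        Prod.ext h6 ((diskHomeo n).injective (Prod.ext h7 (Subtype.ext (add_left_cancel e2))))
      rw [h8]

lemma lineChar_surjOn (n : ℕ) : Set.SurjOn
    (fun p : Σ c : cw.LineCell n, (G ⧸ cw.lineTyp n c) × Disk n => cw.lineChar n p.1 p.2)
    {p | p.2.2.norm < 1} (cw.lineSk (n + 1) \ cw.lineSk n) := by
  rintro ⟨x, t⟩ ⟨h, h'⟩
  -- Integral heights lie in cells `vert`. At other heights the point is interior to an `edge` cell
  -- over the interval starting at ⌊t⌋, whose X-factor has one dimension less.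
  by_cases ht : t ∈ Set.range ((↑) : ℤ → ℝ)
  · have hx : x ∈ cw.skLT (n + 1) := (cw.lineSk_subset_prod _ h).1
    obtain ⟨k, rfl⟩ := ht
    rcases cw.mem_skLT_or_exists hx with hx' | ⟨i, p, hp, rfl⟩
    · exact absurd (Or.inr ⟨hx', k, rfl⟩) h'
    · exact ⟨⟨.vert i k, p⟩, hp, rfl⟩
  · have hx : x ∈ cw.skLT n := h.elim (fun h => h.1) fun h => absurd h.2 ht
    have hx' : x ∉ cw.skLT (n - 1) := fun hx' => h' (Or.inl ⟨hx', trivial⟩)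
    cases n with
    | zero => rw [cw.skLT_zero] at hx; exact hx.elim
    | succ n =>
      rcases cw.mem_skLT_or_exists hx with hx'' | ⟨i, p, hp, rfl⟩
      · exact absurd hx'' hx'
      · have h1 : (0 : ℝ) < t - ⌊t⌋ := by
          refine sub_pos.2 (lt_of_le_of_ne (Int.floor_le t) fun h => ht ⟨_, h⟩)
        have h2 : t - ⌊t⌋ < 1 := by linarith [Int.lt_floor_add_one t]
        let q : Disk n × Set.Icc (0 : ℝ) 1 := (p.2, ⟨t - ⌊t⌋, h1.le, h2.le⟩)
        have hq : diskHomeo n ((diskHomeo n).symm q) = q := (diskHomeo n).apply_symm_apply q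
        refine ⟨⟨.edge i ⌊t⌋, (p.1, (diskHomeo n).symm q)⟩, ?_, ?_⟩
        · refine (norm_lt_one_iff_diskHomeo _).2 ?_
          rw [hq]
          exact ⟨hp, h1, h2⟩
        · change (cw.char n i (p.1, (diskHomeo n ((diskHomeo n).symm q)).1),
            (⌊t⌋ : ℝ) + (diskHomeo n ((diskHomeo n).symm q)).2) = _
          rw [hq]
          exact Prod.ext rfl (add_sub_cancel _ _)

/-- The slabs between successive integers form a locally finite closed cover of the line, and over
each slab the set is a preimage under the characteristic map of an edge cell, by D^n × [0,1] ≅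
D^{n+1}. -/
lemma isClosed_edge {C : Set (X × ℝ)} {n : ℕ} {i : cw.cell n}
    (h : ∀ k, IsClosed (cw.lineChar (n + 1) (.edge i k) ⁻¹' C)) :
    IsClosed {p : ((G ⧸ cw.typ n i) × Disk n) × ℝ | (cw.char n i p.1, p.2) ∈ C} := by
  refine isClosed_of_slab fun k => isClosed_slab_of_preimage ?_
  let e : ((G ⧸ cw.typ n i) × Disk n) × Set.Icc (0 : ℝ) 1 → (G ⧸ cw.typ n i) × Disk (n + 1) :=
    fun p => (p.1.1, (diskHomeo n).symm (p.1.2, p.2))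
  have he : Continuous e := by fun_prop
  convert (h k).preimage he using 1
  ext p
  change _ ↔ (cw.char n i (p.1.1, (diskHomeo n ((diskHomeo n).symm (p.1.2, p.2))).1),
            (k : ℝ) + (diskHomeo n ((diskHomeo n).symm (p.1.2, p.2))).2) ∈ C
  rw [(diskHomeo n).apply_symm_apply]
  rfl

/-- The new part of this skeleton consists of edge cells over (n-1)-cells of X and of vertical
copies of n-cells. They are treated by two applications of `isClosed_prod_of_char` with Λ = ℝ, one
over X_{n-1} and one over X_n. -/
lemma line_isClosed_of_char (n : ℕ) (C : Set (X × ℝ)) (hC : C ⊆ cw.lineSk (n + 1))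
    (h0 : IsClosed (C ∩ cw.lineSk n)) (h1 : ∀ c, IsClosed (cw.lineChar n c ⁻¹' C)) :
    IsClosed C := by
  -- Over X_{n-1} only the edge cells are new, since the part over X_{n-2} lies in `lineSk n`
  -- already.
  have hsub : IsClosed (C ∩ cw.skLT n ×ˢ Set.univ) := by
    cases n with
    | zero => rw [cw.skLT_zero, Set.empty_prod, Set.inter_empty]; exact isClosed_empty
    | succ n =>
      refine cw.isClosed_prod_of_char n _ Set.inter_subset_right ?_ fun i => ?_
      · have : C ∩ cw.skLT (n + 1) ×ˢ Set.univ ∩ cw.skLT n ×ˢ Set.univ =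
            (C ∩ cw.lineSk (n + 1)) ∩ cw.skLT n ×ˢ Set.univ := by
          ext p
          constructor
          · rintro ⟨⟨h, -⟩, h'⟩
            exact ⟨⟨h, Or.inl h'⟩, h'⟩
          · rintro ⟨⟨h, -⟩, h'⟩
            exact ⟨⟨h, cw.skLT_subset n h'.1, trivial⟩, h'⟩
        rw [this]
        exact h0.inter ((cw.isClosed_skLT n).prod isClosed_univ)
      · convert cw.isClosed_edge fun k => h1 (.edge i k) using 1
        ext p
        exact ⟨fun h => h.1, fun h => ⟨h, cw.char_mem_skLT_succ i p.1, trivial⟩⟩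
  refine cw.isClosed_prod_of_char n C (hC.trans (cw.lineSk_subset_prod _)) hsub fun i => ?_
  -- Over an n-cell the pullback of C is the union of a part over the boundary sphere, controlled by
  -- `hsub`, and a part at integral heights, controlled by the cells `vert`. A point of C over the
  -- open cell has integral height because C lies in `lineSk (n + 1)`.
  have hb : IsClosed {p : ((G ⧸ cw.typ n i) × Disk n) × ℝ | 1 ≤ p.1.2.norm} :=
    isClosed_le continuous_const (Disk.continuous_norm.comp (by fun_prop))
  have hc : Continuous fun p : ((G ⧸ cw.typ n i) × Disk n) × ℝ => (cw.char n i p.1, p.2) :=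
    ((cw.continuous_char n i).comp continuous_fst).prodMk continuous_snd
  have hv : IsClosed (⋃ k : ℤ, {p : ((G ⧸ cw.typ n i) × Disk n) × ℝ |
      p.2 = k ∧ (cw.char n i p.1, (k : ℝ)) ∈ C}) := by
    refine isClosed_iUnion_slab (fun k => ?_) fun k => ?_
    · exact (isClosed_eq continuous_snd continuous_const).inter
        ((h1 (.vert i k)).preimage continuous_fst)
    · rintro p ⟨h, -⟩
      exact ⟨trivial, h.ge, by rw [h]; linarith⟩
  convert (hb.inter (hsub.preimage hc)).union hv using 1
  ext p
  constructor
  · intro hp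
    by_cases ht : p.2 ∈ Set.range ((↑) : ℤ → ℝ)
    · obtain ⟨k, hk⟩ := ht
      refine Or.inr (Set.mem_iUnion.2 ⟨k, hk.symm, ?_⟩)
      rw [hk]; exact hp
    · have hx : cw.char n i p.1 ∈ cw.skLT n :=
        (hC hp).elim (fun h => h.1) fun h => absurd h.2 ht
      refine Or.inl ⟨?_, hp, hx, trivial⟩
      by_contra hlt
      exact cw.char_not_mem (not_le.1 hlt) hx
  · rintro (h | h)
    · exact h.2.1
    · obtain ⟨k, hk, h⟩ := Set.mem_iUnion.1 h
      rw [← hk] at h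
      exact h

lemma line_isClosed_of_skLT (C : Set (X × ℝ)) (h : ∀ n, IsClosed (C ∩ cw.lineSk n)) :
    IsClosed C := by
  refine cw.isClosed_prod_of_skLT C fun n => ?_
  have : C ∩ cw.skLT n ×ˢ Set.univ = (C ∩ cw.lineSk (n + 1)) ∩ cw.skLT n ×ˢ Set.univ := by
    ext p
    exact ⟨fun h => ⟨⟨h.1, Or.inl h.2⟩, h.2⟩, fun h => ⟨h.1.1, h.2⟩⟩
  rw [this]
  exact (h _).inter ((cw.isClosed_skLT n).prod isClosed_univ)

/-- The `G`-CW-structure of `X × ℝ`. -/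
def line : letI := lineAction (G := G) (X := X); GCWStructure G (X × ℝ) :=
  letI := lineAction (G := G) (X := X)
  { cell := cw.LineCell
    typ := cw.lineTyp
    isClosed_typ := by
      rintro n (⟨i, k⟩ | ⟨i, k⟩)
      · exact cw.isClosed_typ _ i
      · exact cw.isClosed_typ _ i
    skLT := cw.lineSk
    char := cw.lineChar
    continuous_char := cw.continuous_lineChar
    char_smul := by
      rintro n (⟨i, k⟩ | ⟨i, k⟩) g a d
      · exact Prod.ext (cw.char_smul _ i g a d) rfl
      · exact Prod.ext (cw.char_smul _ i g a _) rfl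
    char_boundary := by
      rintro n c a d h
      cases c with
      | vert i k => exact Or.inr ⟨cw.char_boundary n i a d h, k, rfl⟩
      | @edge n i k =>
        -- The boundary of D^n × [0,1] consists of the sides, which land over X_{n-1}, and the two
        -- ends, which land at the integral heights k and k + 1.
        by_cases h1 : (diskHomeo n d).1.norm = 1
        · exact Or.inl ⟨cw.char_boundary n i a _ h1, trivial⟩
        · refine Or.inr ⟨cw.char_mem_skLT_succ i _, ?_⟩
          have h2 := mt (norm_lt_one_iff_diskHomeo d).2 h.not_lt
          have h3 : (diskHomeo n d).1.norm < 1 := lt_of_le_of_ne (Disk.norm_le_one _) h1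
          by_cases h4 : 0 < ((diskHomeo n d).2 : ℝ)
          · have h5 : ((diskHomeo n d).2 : ℝ) = 1 :=
              le_antisymm (diskHomeo n d).2.2.2 (not_lt.1 fun h5 => h2 ⟨h3, h4, h5⟩)
            refine ⟨k + 1, ?_⟩
            change _ = (k : ℝ) + (diskHomeo n d).2
            rw [h5]; push_cast; rfl
          · have h5 : ((diskHomeo n d).2 : ℝ) = 0 :=
              le_antisymm (not_lt.1 h4) (diskHomeo n d).2.2.1
            refine ⟨k, ?_⟩
            change _ = (k : ℝ) + (diskHomeo n d).2
            rw [h5, add_zero]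
    bijOn_char := fun n => ⟨cw.lineChar_mapsTo n, cw.lineChar_injOn n, cw.lineChar_surjOn n⟩
    skLT_zero := by
      unfold lineSk
      rw [Nat.zero_sub, cw.skLT_zero, Set.empty_prod, Set.empty_prod, Set.union_empty]
    skLT_subset := fun n => by
      rintro p (h | h)
      · exact Or.inl ⟨cw.skLT_mono (by omega) h.1, trivial⟩
      · exact Or.inr ⟨cw.skLT_subset n h.1, h.2⟩
    iUnion_skLT := by
      refine Set.eq_univ_of_forall fun p => ?_
      obtain ⟨n, hn⟩ := cw.exists_mem_skLT p.1
      exact Set.mem_iUnion.2 ⟨n + 1, Or.inl ⟨hn, trivial⟩⟩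
    isClosed_skLT := cw.isClosed_lineSk
    isClosed_of_char := cw.line_isClosed_of_char
    isClosed_of_skLT := cw.line_isClosed_of_skLT }

lemma line_openCell (n : ℕ) (c : cw.LineCell n) :
    letI := lineAction (G := G) (X := X)
    cw.line.openCell n c = cw.lineChar n c '' {p | p.2.norm < 1} := rfl

variable {cw}

/-- The product of a subcomplex of `X` with a closed union of integers and of intervals between
successive integers is a subcomplex of `X × ℝ`. -/
lemma IsSubcomplex.prod {A : Set X} (hA : cw.IsSubcomplex A) {J : Set ℝ} (hJ : IsClosed J)
    (hJ' : ∀ k : ℤ, Set.Ioo (k : ℝ) (k + 1) ⊆ J ∨ Disjoint (Set.Ioo (k : ℝ) (k + 1)) J) :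
    letI := lineAction (G := G) (X := X)
    cw.line.IsSubcomplex (A ×ˢ J) := by
  let := lineAction (G := G) (X := X)
  refine ⟨hA.1.prod hJ, fun n c => ?_⟩
  cases c with
  | vert i k =>
    have key : cw.line.openCell n (.vert i k) ⊆ cw.openCell n i ×ˢ {(k : ℝ)} := by
      rw [line_openCell]
      rintro _ ⟨p, hp, rfl⟩
      exact ⟨⟨p, hp, rfl⟩, rfl⟩
    rcases hA.2 n i with h | h
    · by_cases hk : (k : ℝ) ∈ J
      · exact Or.inl (key.trans (Set.prod_mono h (Set.singleton_subset_iff.2 hk)))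
      · exact Or.inr (Set.disjoint_left.2 fun p hp hp' => hk ((key hp).2 ▸ hp'.2))
    · exact Or.inr (Set.disjoint_left.2 fun p hp hp' => Set.disjoint_left.1 h (key hp).1 hp'.1)
  | @edge n i k =>
    have key : cw.line.openCell (n + 1) (.edge i k) ⊆
        cw.openCell n i ×ˢ Set.Ioo (k : ℝ) (k + 1) := by
      rw [line_openCell]
      rintro _ ⟨p, hp, rfl⟩
      obtain ⟨h1, h2, h3⟩ := (norm_lt_one_iff_diskHomeo p.2).1 hp
      have h4 : cw.char n i (p.1, (diskHomeo n p.2).1) ∈ cw.openCell n i :=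
        ⟨(p.1, (diskHomeo n p.2).1), h1, rfl⟩
      have h5 : (k : ℝ) + (diskHomeo n p.2).2 ∈ Set.Ioo (k : ℝ) (k + 1) :=
        ⟨lt_add_of_pos_right (k : ℝ) h2, add_lt_add_right h3 (k : ℝ)⟩
      exact Set.mk_mem_prod h4 h5
    rcases hA.2 n i with h | h
    · rcases hJ' k with hk | hk
      · exact Or.inl (key.trans (Set.prod_mono h hk))
      · exact Or.inr (Set.disjoint_left.2 fun p hp hp' =>
          Set.disjoint_left.1 hk (key hp).2 hp'.2)
    · exact Or.inr (Set.disjoint_left.2 fun p hp hp' => Set.disjoint_left.1 h (key hp).1 hp'.1)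

lemma isSubcomplex_univ : cw.IsSubcomplex Set.univ :=
  ⟨isClosed_univ, fun _ _ => Or.inl (Set.subset_univ _)⟩

lemma IsSubcomplex.inter {A B : Set X} (hA : cw.IsSubcomplex A) (hB : cw.IsSubcomplex B) :
    cw.IsSubcomplex (A ∩ B) := by
  refine ⟨hA.1.inter hB.1, fun n i => ?_⟩
  rcases hA.2 n i with h | h
  · rcases hB.2 n i with h' | h'
    · exact Or.inl (Set.subset_inter h h')
    · exact Or.inr (h'.mono_right Set.inter_subset_right)
  · exact Or.inr (h.mono_right Set.inter_subset_left)

lemma IsSubcomplex.union {A B : Set X} (hA : cw.IsSubcomplex A) (hB : cw.IsSubcomplex B) :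
    cw.IsSubcomplex (A ∪ B) := by
  refine ⟨hA.1.union hB.1, fun n i => ?_⟩
  rcases hA.2 n i with h | h
  · exact Or.inl (h.trans Set.subset_union_left)
  · rcases hB.2 n i with h' | h'
    · exact Or.inl (h'.trans Set.subset_union_right)
    · exact Or.inr (Set.disjoint_union_right.2 ⟨h, h'⟩)

/-- Closedness of the union is assumed; for the telescope it comes from local finiteness in the
ℝ-direction. -/
lemma IsSubcomplex.iUnion {ι : Type*} {A : ι → Set X} (hA : ∀ i, cw.IsSubcomplex (A i))
    (hc : IsClosed (⋃ i, A i)) : cw.IsSubcomplex (⋃ i, A i) := by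
  refine ⟨hc, fun n j => ?_⟩
  by_cases h : ∃ i, cw.openCell n j ⊆ A i
  · obtain ⟨i, hi⟩ := h
    exact Or.inl (hi.trans (Set.subset_iUnion A i))
  · push Not at h
    exact Or.inr (Set.disjoint_iUnion_right.2 fun i => ((hA i).2 n j).resolve_left (h i))

lemma IsSubcomplex.preimage_restrict {A B : Set X} (hA : cw.IsSubcomplex A)
    (hB : cw.IsSubcomplex B) :
    letI := subAction (G := G) hA.smul_mem
    (cw.restrict hA).IsSubcomplex (Subtype.val ⁻¹' B : Set A) := by
  let := subAction (G := G) hA.smul_mem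
  refine ⟨hB.1.preimage continuous_subtype_val, fun n i => ?_⟩
  have key : ∀ x ∈ (cw.restrict hA).openCell n i, (x : X) ∈ cw.openCell n i.1 := by
    rintro _ ⟨p, hp, rfl⟩
    exact ⟨p, hp, rfl⟩
  rcases hB.2 n i.1 with h | h
  · exact Or.inl fun x hx => h (key x hx)
  · exact Or.inr (Set.disjoint_left.2 fun x hx hx' => Set.disjoint_left.1 h (key x hx) hx')

end GCWStructure

variable {G : Type u} [Group G] [TopologicalSpace G]

/-- The product of a smooth `G`-CW-complex with the real line. -/
def SmoothGCW.line (X : SmoothGCW G) : SmoothGCW G :=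
  letI := GCWStructure.lineAction (G := G) (X := X.carrier)
  { carrier := X.carrier × ℝ
    contAct := ⟨show Continuous fun p : G × (X.carrier × ℝ) => (p.1 • p.2.1, p.2.2) from
      (continuous_fst.smul continuous_snd.fst).prodMk continuous_snd.snd⟩
    cw := X.cw.line
    isOpen_stabilizer := fun x => by
      have : MulAction.stabilizer G x = MulAction.stabilizer G x.1 := by
        ext g
        exact ⟨fun h => congrArg Prod.fst h, fun h => Prod.ext h rfl⟩
      rw [this]
      exact X.isOpen_stabilizer x.1 }

end SmoothBredon

end

/-! ### Excision for subcomplexes and vanishing in the exact sequence of a triple. -/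

noncomputable section

namespace SmoothBredon

variable {G : Type u} [Group G] [TopologicalSpace G]

/-! ### Pairs of subcomplexes -/

/-- The pair `(S, S ∩ R)` for subcomplexes `S` and `R` of `W`. -/
def relPair {W : SmoothGCW G} {S R : Set W.carrier} (hS : W.cw.IsSubcomplex S)
    (hR : W.cw.IsSubcomplex R) : SmoothGCWPair G :=
  ⟨W.restrict S hS, Subtype.val ⁻¹' R, hS.preimage_restrict hR⟩

section RelMap

variable {W : SmoothGCW G} {S S' R R' : Set W.carrier} (hS : W.cw.IsSubcomplex S)
    (hR : W.cw.IsSubcomplex R) (hS' : W.cw.IsSubcomplex S') (hR' : W.cw.IsSubcomplex R')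

/-- The inclusion `(S, S ∩ R) → (S', S' ∩ R')`. -/
def relMap (h : S ⊆ S') (h' : S ∩ R ⊆ R') : relPair hS hR ⟶ relPair hS' hR' where
  toFun := fun x : S => (⟨x.1, h x.2⟩ : S')
  continuous_toFun := Continuous.subtype_mk (continuous_subtype_val (p := fun x => x ∈ S)) _
  map_smul _ _ := rfl
  mapsTo := fun (x : S) hx => h' ⟨x.2, hx⟩

/-- This is the source of all excisions between subcomplexes: S and R are closed and cover S', so a
subset is closed as soon as its traces on both are. -/
lemma isPushout_relMap (h : S ⊆ S') (h' : S' ⊆ S ∪ R) :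
    SmoothGCWPair.IsPushout (relMap hS hR hS' hR h Set.inter_subset_right) := by
  refine ⟨⟨fun x hx => hx, fun x _ y _ hxy => ?_, ?_⟩, ?_⟩
  · exact Subtype.ext (congrArg (fun z : S' => (z : W.carrier)) hxy)
  · rintro (x : S') hx
    exact ⟨(⟨x.1, (h' x.2).resolve_right hx⟩ : S), hx, rfl⟩
  · intro (C : Set S') h1 h2
    have e1 : IsClosed (Subtype.val '' (C ∩ Subtype.val ⁻¹' R) : Set W.carrier) :=
      hS'.1.isClosedEmbedding_subtypeVal.isClosedMap _ h1
    have e2 := hS.1.isClosedEmbedding_subtypeVal.isClosedMap _ h2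
    refine hS'.1.isClosedEmbedding_subtypeVal.isClosed_iff_image_isClosed.2 ?_
    convert e1.union e2 using 1
    ext x
    constructor
    · rintro ⟨y, hy, rfl⟩
      rcases h' y.2 with hx | hx
      · exact Or.inr ⟨⟨y.1, hx⟩, hy, rfl⟩
      · exact Or.inl ⟨y, ⟨hy, hx⟩, rfl⟩
    · rintro (⟨y, ⟨hy, -⟩, rfl⟩ | ⟨y, hy, rfl⟩)
      · exact ⟨y, hy, rfl⟩
      · exact ⟨_, hy, rfl⟩

end RelMap

/-- The map of absolute complexes underlying a map of pairs. -/
def absMap {P Q : SmoothGCWPair G} (f : P ⟶ Q) : P.X.toPair ⟶ Q.X.toPair where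
  toFun := f.toFun
  continuous_toFun := f.continuous_toFun
  map_smul := f.map_smul
  mapsTo _ h := h.elim

namespace SmoothGHomologyTheory

variable (ℋ : SmoothGHomologyTheory G)

lemma map_comp_apply (q : ℤ) {P Q R : SmoothGCWPair G} (f : P ⟶ Q) (g : Q ⟶ R)
    (z : (ℋ.H q).obj P) : (ℋ.H q).map (f ≫ g) z = (ℋ.H q).map g ((ℋ.H q).map f z) := by
  rw [Functor.map_comp]; rfl

lemma map_id_apply (q : ℤ) (P : SmoothGCWPair G) (z : (ℋ.H q).obj P) :
    (ℋ.H q).map (𝟙 P) z = z := by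
  rw [CategoryTheory.Functor.map_id]; rfl

lemma map_map_of_comp_eq (q : ℤ) {P Q Q' R : SmoothGCWPair G} {f : P ⟶ Q} {g : Q ⟶ R}
    {f' : P ⟶ Q'} {g' : Q' ⟶ R} (h : f ≫ g = f' ≫ g') (z : (ℋ.H q).obj P) :
    (ℋ.H q).map g ((ℋ.H q).map f z) = (ℋ.H q).map g' ((ℋ.H q).map f' z) := by
  rw [← map_comp_apply, h, map_comp_apply]

lemma map_map_of_comp_eq_id (q : ℤ) {P Q : SmoothGCWPair G} {f : P ⟶ Q} {g : Q ⟶ P}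
    (h : f ≫ g = 𝟙 P) (z : (ℋ.H q).obj P) :
    (ℋ.H q).map g ((ℋ.H q).map f z) = z := by
  rw [← map_comp_apply, h, map_id_apply]

lemma boundary_map (q : ℤ) {P Q : SmoothGCWPair G} (f : P ⟶ Q) (z : (ℋ.H (q + 1)).obj P) :
    (ℋ.boundary q).app Q ((ℋ.H (q + 1)).map f z) =
      (ℋ.H q).map (SmoothGCWPair.bd.map f) ((ℋ.boundary q).app P z) :=
  ConcreteCategory.congr_hom ((ℋ.boundary q).naturality f) z

lemma bijective_of_isPushout (q : ℤ) {P Q : SmoothGCWPair G} {f : P ⟶ Q}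
    (h : SmoothGCWPair.IsPushout f) : Function.Bijective ((ℋ.H q).map f) := by
  have := ℋ.excision q P Q f h
  exact ConcreteCategory.bijective_of_isIso _

/-- `ℋ_q(P) = 0`, elementwise. -/
def Vanish (q : ℤ) (P : SmoothGCWPair G) : Prop := ∀ z : (ℋ.H q).obj P, z = 0

variable {ℋ}

lemma vanish_iff_isZero {q : ℤ} {P : SmoothGCWPair G} :
    ℋ.Vanish q P ↔ IsZero ((ℋ.H q).obj P) := by
  constructor
  · intro h
    have : Subsingleton ((ℋ.H q).obj P) := ⟨fun a b => (h a).trans (h b).symm⟩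
    exact AddCommGrpCat.isZero_of_subsingleton _
  · intro h z
    have := AddCommGrpCat.subsingleton_of_isZero h
    exact Subsingleton.elim _ _

lemma Vanish.of_isPushout {q : ℤ} {P Q : SmoothGCWPair G} {f : P ⟶ Q}
    (h : SmoothGCWPair.IsPushout f) (hP : ℋ.Vanish q P) : ℋ.Vanish q Q := by
  intro z
  obtain ⟨w, rfl⟩ := (ℋ.bijective_of_isPushout q h).2 z
  rw [hP w, map_zero]

/-- Vanishing passes to homotopy retracts. -/
lemma Vanish.of_retract {q : ℤ} {P Q : SmoothGCWPair G} (s : P ⟶ Q) (p : Q ⟶ P)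
    (h : SmoothGCWPair.GHomotopic (s ≫ p) (𝟙 P)) (hQ : ℋ.Vanish q Q) : ℋ.Vanish q P := by
  intro z
  have := ℋ.homotopy_invariance q _ _ _ _ h
  rw [← ℋ.map_id_apply q P z, ← this, map_comp_apply, hQ ((ℋ.H q).map s z), map_zero]

lemma map_absIncl_bdIncl (q : ℤ) (P : SmoothGCWPair G) (z : (ℋ.H q).obj (SmoothGCWPair.bd.obj P)) :
    (ℋ.H q).map P.absIncl ((ℋ.H q).map P.bdIncl z) = 0 :=
  (ℋ.exact_abs q P).apply_apply_eq_zero z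

lemma vanish_of_abs {q : ℤ} {P : SmoothGCWPair G} (h : ℋ.Vanish (q + 1) P.X.toPair)
    (h' : ℋ.Vanish q (SmoothGCWPair.bd.obj P)) : ℋ.Vanish (q + 1) P := by
  intro z
  obtain ⟨y, rfl⟩ := (ℋ.exact_pair q P z).1 (h' _)
  rw [h y, map_zero]

section Triple

variable {W : SmoothGCW G} {S R₁ R₂ : Set W.carrier} (hS : W.cw.IsSubcomplex S)
  (h₁ : W.cw.IsSubcomplex R₁) (h₂ : W.cw.IsSubcomplex R₂) (h : R₁ ⊆ R₂)

/-- The identification of the second member of the pair `(S, S ∩ R₂)` with the first member of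
`(S ∩ R₂, R₁)`. -/
def bdToRel : SmoothGCWPair.bd.obj (relPair hS h₂) ⟶ (relPair (hS.inter h₂) h₁).X.toPair where
  toFun := fun x : (Subtype.val ⁻¹' R₂ : Set S) => (⟨x.1.1, x.1.2, x.2⟩ : (S ∩ R₂ : Set _))
  continuous_toFun := Continuous.subtype_mk
    ((continuous_subtype_val (p := fun x => x ∈ S)).comp
      (continuous_subtype_val (p := fun x : S => x.1 ∈ R₂))) _
  map_smul _ _ := rfl
  mapsTo _ h := h.elim

/-- The inverse of `bdToRel`. -/
def relToBd : (relPair (hS.inter h₂) h₁).X.toPair ⟶ SmoothGCWPair.bd.obj (relPair hS h₂) where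
  toFun := fun x : (S ∩ R₂ : Set _) => (⟨⟨x.1, x.2.1⟩, x.2.2⟩ : (Subtype.val ⁻¹' R₂ : Set S))
  continuous_toFun := Continuous.subtype_mk (Continuous.subtype_mk
    (continuous_subtype_val (p := fun x => x ∈ S ∩ R₂)) _) _
  map_smul _ _ := rfl
  mapsTo _ h := h.elim

lemma bdToRel_relToBd : bdToRel hS h₁ h₂ ≫ relToBd hS h₁ h₂ = 𝟙 _ := rfl

/-- The inclusion `(S ∩ R₂, R₁) → (S, R₁)`. -/
def tripleLeft : relPair (hS.inter h₂) h₁ ⟶ relPair hS h₁ :=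
  relMap _ _ _ _ Set.inter_subset_left Set.inter_subset_right

/-- The inclusion `(S, R₁) → (S, R₂)`. -/
def tripleRight (h : R₁ ⊆ R₂) : relPair hS h₁ ⟶ relPair hS h₂ :=
  relMap _ _ _ _ subset_rfl (Set.inter_subset_right.trans h)

/-- The inverse of the identification of the second members of `(S ∩ R₂, R₁)` and `(S, R₁)`. -/
def bdLeftInv (h : R₁ ⊆ R₂) : SmoothGCWPair.bd.obj (relPair hS h₁) ⟶
    SmoothGCWPair.bd.obj (relPair (hS.inter h₂) h₁) where
  toFun := fun x : (Subtype.val ⁻¹' R₁ : Set S) =>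
    (⟨⟨x.1.1, x.1.2, h x.2⟩, x.2⟩ : (Subtype.val ⁻¹' R₁ : Set (S ∩ R₂ : Set _)))
  continuous_toFun := Continuous.subtype_mk (Continuous.subtype_mk
    ((continuous_subtype_val (p := fun x => x ∈ S)).comp
      (continuous_subtype_val (p := fun x : S => x.1 ∈ R₁))) _) _
  map_smul _ _ := rfl
  mapsTo _ h := h.elim

-- Exactness of the triple at its middle term, ℋ_{q+1}(S ∩ R₂, R₁) → ℋ_{q+1}(S, R₁) → ℋ_{q+1}(S,
-- R₂). The axioms provide sequences of pairs only, so the needed portion is chased by hand.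
include h in
lemma Vanish.triple_middle {q : ℤ} (v₁ : ℋ.Vanish (q + 1) (relPair (hS.inter h₂) h₁))
    (v₃ : ℋ.Vanish (q + 1) (relPair hS h₂)) : ℋ.Vanish (q + 1) (relPair hS h₁) := by
  intro z
  let j := tripleLeft hS h₁ h₂
  let k := tripleRight hS h₁ h₂ h
  let v := bdLeftInv hS h₁ h₂ h
  let u := bdToRel hS h₁ h₂
  let dz := (ℋ.boundary q).app _ z
  -- The boundary of z dies in ℋ_q(S ∩ R₂), hence is a boundary from ℋ_{q+1}(S ∩ R₂, R₁) = 0. So it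
  -- is zero and z lifts to some y in ℋ_{q+1}(S).
  have hk0 : (ℋ.H q).map (SmoothGCWPair.bd.map k) dz = 0 := by
    rw [← boundary_map, v₃ ((ℋ.H (q + 1)).map k z), map_zero]
  have hdz : (ℋ.H q).map (SmoothGCWPair.bd.map j) ((ℋ.H q).map v dz) = dz :=
    ℋ.map_map_of_comp_eq_id q (f := v) (g := SmoothGCWPair.bd.map j) rfl dz
  have ha : (ℋ.H q).map (relPair (hS.inter h₂) h₁).bdIncl ((ℋ.H q).map v dz) = 0 := by
    refine (ℋ.map_map_of_comp_eq q (f := v) (g := (relPair (hS.inter h₂) h₁).bdIncl)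
      (f' := SmoothGCWPair.bd.map k) (g' := u) rfl dz).trans ?_
    rw [hk0, map_zero]
  obtain ⟨w, hw⟩ := (ℋ.exact_bd q _ _).1 ha
  rw [v₁ w, map_zero] at hw
  rw [← hw, map_zero] at hdz
  obtain ⟨y, rfl⟩ := (ℋ.exact_pair q _ z).1 hdz.symm
  -- The lift y dies in ℋ_{q+1}(S, R₂), so it comes from S ∩ R₂. Its image in ℋ_{q+1}(S, R₁) then
  -- factors through the zero group ℋ_{q+1}(S ∩ R₂, R₁).
  have hy : (ℋ.H (q + 1)).map (relPair hS h₂).absIncl y = 0 := v₃ _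
  obtain ⟨b, rfl⟩ := (ℋ.exact_abs (q + 1) (relPair hS h₂) y).1 hy
  refine (ℋ.map_map_of_comp_eq (q + 1) (f := (relPair hS h₂).bdIncl)
    (g := (relPair hS h₁).absIncl) (f' := u ≫ (relPair (hS.inter h₂) h₁).absIncl) (g' := j)
    rfl b).trans ?_
  rw [v₁ ((ℋ.H (q + 1)).map (u ≫ (relPair (hS.inter h₂) h₁).absIncl) b), map_zero]

-- Exactness of the triple one term further on, ℋ_{q+1}(S, R₁) → ℋ_{q+1}(S, R₂) → ℋ_q(S ∩ R₂, R₁).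
include h in
lemma Vanish.triple_right {q : ℤ} (v₁ : ℋ.Vanish q (relPair (hS.inter h₂) h₁))
    (v₂ : ℋ.Vanish (q + 1) (relPair hS h₁)) : ℋ.Vanish (q + 1) (relPair hS h₂) := by
  intro z
  let j := tripleLeft hS h₁ h₂
  let k := tripleRight hS h₁ h₂ h
  let v := bdLeftInv hS h₁ h₂ h
  let u := bdToRel hS h₁ h₂
  let dz := (ℋ.boundary q).app _ z
  -- The boundary of z comes from a class a on S ∩ R₁. This a dies in ℋ_q(S), so it is a boundary
  -- from ℋ_{q+1}(S, R₁) = 0 and vanishes itself. Then z lifts to ℋ_{q+1}(S), and the map from there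
  -- passes through ℋ_{q+1}(S, R₁).
  obtain ⟨a, ha⟩ := (ℋ.exact_abs q _ ((ℋ.H q).map u dz)).1 (v₁ _)
  have h0 : (ℋ.H q).map (relPair hS h₁).bdIncl ((ℋ.H q).map (SmoothGCWPair.bd.map j) a) = 0 := by
    refine (ℋ.map_map_of_comp_eq q (f := SmoothGCWPair.bd.map j) (g := (relPair hS h₁).bdIncl)
      (f' := (relPair (hS.inter h₂) h₁).bdIncl) (g' := absMap j) rfl a).trans ?_
    rw [ha]
    refine (ℋ.map_map_of_comp_eq q (f := u) (g := absMap j) (f' := (relPair hS h₂).bdIncl)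
      (g' := 𝟙 _) rfl dz).trans ?_
    rw [(ℋ.exact_bd q (relPair hS h₂)).apply_apply_eq_zero z, map_zero]
  obtain ⟨y, hy⟩ := (ℋ.exact_bd q _ _).1 h0
  rw [v₂ y, map_zero] at hy
  have ha0 : a = 0 := by
    rw [← ℋ.map_map_of_comp_eq_id q (f := SmoothGCWPair.bd.map j) (g := v) rfl a, ← hy, map_zero]
  rw [ha0, map_zero] at ha
  have hdz : dz = 0 := by
    rw [← ℋ.map_map_of_comp_eq_id q (bdToRel_relToBd hS h₁ h₂) dz]
    exact (congrArg _ ha.symm).trans (map_zero _)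
  obtain ⟨y', rfl⟩ := (ℋ.exact_pair q _ z).1 hdz
  have e : (ℋ.H (q + 1)).map (relPair hS h₂).absIncl y' =
      (ℋ.H (q + 1)).map k ((ℋ.H (q + 1)).map (relPair hS h₁).absIncl y') :=
    ℋ.map_comp_apply (q + 1) (relPair hS h₁).absIncl k y'
  exact e.trans ((congrArg _ (v₂ _)).trans (map_zero _))

end Triple

end SmoothGHomologyTheory

end SmoothBredon

end

/-! ### Suspension of pairs and vanishing on disjoint unions. -/

noncomputable section

namespace SmoothBredon

variable {G : Type u} [Group G] [TopologicalSpace G]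

/-! ### Relative suspension -/

lemma Ioo_subset_or_disjoint_Icc (a b k : ℤ) : Set.Ioo (k : ℝ) (k + 1) ⊆ Set.Icc (a : ℝ) b ∨
    Disjoint (Set.Ioo (k : ℝ) (k + 1)) (Set.Icc (a : ℝ) b) := by
  by_cases h : a ≤ k ∧ k < b
  · refine Or.inl fun t ht => ⟨?_, ?_⟩
    · have : (a : ℝ) ≤ k := by exact_mod_cast h.1
      linarith [ht.1]
    · have : (k : ℝ) + 1 ≤ b := by exact_mod_cast h.2
      linarith [ht.2]
  · refine Or.inr (Set.disjoint_left.2 fun t ht ht' => h ⟨?_, ?_⟩)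
    · have : (a : ℝ) < ((k + 1 : ℤ) : ℝ) := by push_cast; linarith [ht.2, ht'.1]
      have := Int.cast_lt.1 this
      omega
    · have : (k : ℝ) < b := by linarith [ht.1, ht'.2]
      exact_mod_cast this

section Line

variable {X : SmoothGCW G} {A : Set X.carrier}

lemma isSubcomplex_prod_Icc (hA : X.cw.IsSubcomplex A) (a b : ℤ) :
    X.line.cw.IsSubcomplex (A ×ˢ Set.Icc (a : ℝ) b : Set (X.carrier × ℝ)) :=
  hA.prod isClosed_Icc (Ioo_subset_or_disjoint_Icc a b)

lemma isSubcomplex_prod_unit (hA : X.cw.IsSubcomplex A) :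
    X.line.cw.IsSubcomplex (A ×ˢ Set.Icc (0 : ℝ) 1 : Set (X.carrier × ℝ)) := by
  have := isSubcomplex_prod_Icc hA 0 1
  rwa [Int.cast_zero, Int.cast_one] at this

lemma isSubcomplex_prod_zero (hA : X.cw.IsSubcomplex A) :
    X.line.cw.IsSubcomplex (A ×ˢ {0} : Set (X.carrier × ℝ)) := by
  have := isSubcomplex_prod_Icc hA 0 0
  rwa [Int.cast_zero, Set.Icc_self] at this

lemma isSubcomplex_prod_one (hA : X.cw.IsSubcomplex A) :
    X.line.cw.IsSubcomplex (A ×ˢ {1} : Set (X.carrier × ℝ)) := by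
  have := isSubcomplex_prod_Icc hA 1 1
  rwa [Int.cast_one, Set.Icc_self] at this

lemma isSubcomplex_prod_univ (hA : X.cw.IsSubcomplex A) :
    X.line.cw.IsSubcomplex (A ×ˢ Set.univ : Set (X.carrier × ℝ)) :=
  hA.prod isClosed_univ fun _ => Or.inl (Set.subset_univ _)

/-- The subcomplex `X × {0} ∪ A × ℝ` of `X × ℝ`. -/
lemma isSubcomplex_bottom (hA : X.cw.IsSubcomplex A) :
    X.line.cw.IsSubcomplex
      (Set.univ ×ˢ {0} ∪ A ×ˢ Set.univ : Set (X.carrier × ℝ)) :=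
  (isSubcomplex_prod_zero GCWStructure.isSubcomplex_univ).union (isSubcomplex_prod_univ hA)

/-- The subcomplex `X × {0, 1} ∪ A × ℝ` of `X × ℝ`. -/
lemma isSubcomplex_ends (hA : X.cw.IsSubcomplex A) :
    X.line.cw.IsSubcomplex
      (Set.univ ×ˢ {1} ∪ (Set.univ ×ˢ {0} ∪ A ×ˢ Set.univ) : Set (X.carrier × ℝ)) :=
  (isSubcomplex_prod_one GCWStructure.isSubcomplex_univ).union (isSubcomplex_bottom hA)

end Line

/-- The pair `(X, A) × ([0, 1], {0, 1})`. -/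
def suspPair (P : SmoothGCWPair G) : SmoothGCWPair G :=
  relPair (isSubcomplex_prod_unit (X := P.X) GCWStructure.isSubcomplex_univ)
    (isSubcomplex_ends P.isSubcomplex)

lemma mem_suspPair_iff {P : SmoothGCWPair G}
    (p : (Set.univ ×ˢ Set.Icc (0 : ℝ) 1 : Set (P.X.carrier × ℝ))) :
    p ∈ (suspPair P).A ↔ p.1.1 ∈ P.A ∨ p.1.2 = 0 ∨ p.1.2 = 1 := by
  change (_ ∨ (_ ∨ _)) ↔ _
  constructor
  · rintro (h | h | h)
    · exact Or.inr (Or.inr h.2)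
    · exact Or.inr (Or.inl h.2)
    · exact Or.inl h.1
  · rintro (h | h | h)
    · exact Or.inr (Or.inr ⟨h, trivial⟩)
    · exact Or.inr (Or.inl ⟨trivial, h⟩)
    · exact Or.inl ⟨trivial, h⟩

namespace SmoothGHomologyTheory

variable {ℋ : SmoothGHomologyTheory G}

lemma vanish_of_bdIncl {q : ℤ} {P : SmoothGCWPair G}
    (h : Function.Injective ((ℋ.H q).map P.bdIncl))
    (h' : Function.Surjective ((ℋ.H (q + 1)).map P.bdIncl)) : ℋ.Vanish (q + 1) P := by
  intro z
  have h0 : (ℋ.boundary q).app P z = 0 :=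
    h (((ℋ.exact_bd q P).apply_apply_eq_zero z).trans (map_zero _).symm)
  obtain ⟨y, rfl⟩ := (ℋ.exact_pair q P z).1 h0
  obtain ⟨b, rfl⟩ := h' y
  exact map_absIncl_bdIncl (q + 1) P b

/-- A pair whose second member is a deformation retract of the first has no homology. -/
lemma vanish_of_deformation {P : SmoothGCWPair G} (r : P.X.toPair ⟶ SmoothGCWPair.bd.obj P)
    (h₁ : P.bdIncl ≫ r = 𝟙 _) (h₂ : SmoothGCWPair.GHomotopic (r ≫ P.bdIncl) (𝟙 _)) (q : ℤ) :
    ℋ.Vanish q P := by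
  obtain ⟨q, rfl⟩ : ∃ q', q = q' + 1 := ⟨q - 1, by ring⟩
  refine vanish_of_bdIncl ?_ ?_
  · exact (Function.LeftInverse.injective (g := (ℋ.H q).map r)
      fun z => ℋ.map_map_of_comp_eq_id q h₁ z)
  · refine (Function.RightInverse.surjective (g := (ℋ.H (q + 1)).map r) fun z => ?_)
    rw [← map_comp_apply, ℋ.homotopy_invariance _ _ _ _ _ h₂, map_id_apply]

/-- The cylinder A × [0,1] is pushed down to its bottom by (x, t) ↦ (x, st), which for s = 0 is the
retraction and for s = 1 the identity. -/
lemma vanish_cylinder {X : SmoothGCW G} {A : Set X.carrier} (hA : X.cw.IsSubcomplex A) (q : ℤ) :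
    ℋ.Vanish q (relPair (isSubcomplex_prod_unit hA)
      (isSubcomplex_prod_zero GCWStructure.isSubcomplex_univ)) := by
  let I : Set (X.carrier × ℝ) := A ×ˢ Set.Icc (0 : ℝ) 1
  let P := relPair (isSubcomplex_prod_unit hA)
      (isSubcomplex_prod_zero (X := X) GCWStructure.isSubcomplex_univ)
  have hI : ∀ x : I, (x.1.1, (0 : ℝ)) ∈ I := fun x => ⟨x.2.1, le_rfl, zero_le_one⟩
  let r : P.X.toPair ⟶ SmoothGCWPair.bd.obj P :=
    { toFun := fun x : I => (⟨⟨(x.1.1, 0), hI x⟩, trivial, rfl⟩ :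
        (Subtype.val ⁻¹' (Set.univ ×ˢ {0}) : Set I))
      continuous_toFun := Continuous.subtype_mk (Continuous.subtype_mk
        (Continuous.prodMk (continuous_fst.comp (continuous_subtype_val (p := fun x => x ∈ I)))
          continuous_const) _) _
      map_smul := fun _ _ => rfl
      mapsTo := fun _ h => h.elim }
  refine vanish_of_deformation (P := P) r ?_ ?_ q
  · refine SmoothGCWPair.Hom.ext (funext fun x : (Subtype.val ⁻¹' (Set.univ ×ˢ {0}) : Set I) => ?_)
    exact Subtype.ext (Subtype.ext (Prod.ext rfl x.2.2.symm))
  · have hJ : ∀ (x : I) (s : unitInterval), (x.1.1, (s : ℝ) * x.1.2) ∈ I := fun x s =>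
      ⟨x.2.1, mul_nonneg s.2.1 x.2.2.1, mul_le_one₀ s.2.2 x.2.2.1 x.2.2.2⟩
    refine ⟨fun p : I × unitInterval => (⟨(p.1.1.1, (p.2 : ℝ) * p.1.1.2), hJ p.1 p.2⟩ : I),
      ?_, fun _ _ _ => rfl, fun _ _ h => h.elim, fun (x : I) => ?_, fun (x : I) => ?_⟩
    · refine Continuous.subtype_mk (p := fun x => x ∈ I) ?_ _
      have : Continuous fun p : I × unitInterval => (p.1 : X.carrier × ℝ) :=
        continuous_subtype_val.comp continuous_fst
      exact this.fst.prodMk ((continuous_subtype_val.comp continuous_snd).mul this.snd)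
    · exact Subtype.ext (Prod.ext rfl (zero_mul x.1.2))
    · exact Subtype.ext (Prod.ext rfl (one_mul x.1.2))

/-- Relative suspension, for the vanishing of homology groups. -/
lemma Vanish.suspPair {q : ℤ} {P : SmoothGCWPair G} (hP : ℋ.Vanish q P) :
    ℋ.Vanish (q + 1) (suspPair P) := by
  have hu := P.X.cw.isSubcomplex_univ
  have hA := P.isSubcomplex
  have hS := isSubcomplex_prod_unit hu
  have h0 := isSubcomplex_prod_zero hu
  have hb := isSubcomplex_bottom hA
  have he := isSubcomplex_ends hA
  -- By excision (X × {0} ∪ A × [0,1], X × {0}) has the homology of the cylinder (A × [0,1], A ×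
  -- {0}).
  have v1 : ℋ.Vanish q (relPair (hS.inter hb) h0) := by
    refine (vanish_cylinder hA q).of_isPushout
      (isPushout_relMap (isSubcomplex_prod_unit hA) h0 (hS.inter hb) ?_ ?_)
    · exact fun p hp => ⟨⟨trivial, hp.2⟩, Or.inr ⟨hp.1, trivial⟩⟩
    · rintro p ⟨hp, hp' | hp'⟩
      · exact Or.inr hp'
      · exact Or.inl ⟨hp'.1, hp.2⟩
  -- Comparing with the full cylinder (X × [0,1], X × {0}) through a triple kills (X × [0,1], X ×
  -- {0} ∪ A × [0,1]).
  have v2 : ℋ.Vanish (q + 1) (relPair hS hb) :=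
    Vanish.triple_right hS h0 hb Set.subset_union_left v1 (vanish_cylinder hu (q + 1))
  let top : P ⟶ relPair (isSubcomplex_prod_one hu) hb :=
    { toFun := fun x => (⟨(x, 1), trivial, rfl⟩ : (Set.univ ×ˢ {1} : Set (P.X.carrier × ℝ)))
      continuous_toFun := Continuous.subtype_mk (continuous_id.prodMk continuous_const) _
      map_smul := fun _ _ => rfl
      mapsTo := fun x hx => Or.inr ⟨hx, trivial⟩ }
  have htop : SmoothGCWPair.IsPushout top := by
    refine ⟨⟨?_, ?_, ?_⟩, ?_⟩
    · rintro x hx (h | h)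
      · exact one_ne_zero h.2
      · exact hx h.1
    · intro x _ y _ h
      exact congrArg (fun z : (Set.univ ×ˢ {1} : Set (P.X.carrier × ℝ)) => z.1.1) h
    · intro (z : (Set.univ ×ˢ {1} : Set (P.X.carrier × ℝ))) hx
      exact ⟨z.1.1, fun h => hx (Or.inr ⟨h, trivial⟩),
        Subtype.ext (Prod.ext rfl (Eq.symm z.2.2))⟩
    · intro (C : Set (Set.univ ×ˢ {1} : Set (P.X.carrier × ℝ))) _ h
      have e : C = (fun z : (Set.univ ×ˢ {1} : Set (P.X.carrier × ℝ)) => z.1.1) ⁻¹'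
          (top.toFun ⁻¹' C) := by
        ext z
        have hz : top.toFun z.1.1 = z := Subtype.ext (Prod.ext rfl (Eq.symm z.2.2))
        exact iff_of_eq (congrArg (fun w => w ∈ C) hz.symm)
      rw [e]
      exact h.preimage (continuous_fst.comp continuous_subtype_val)
  -- Attaching the upper end X × {1} to X × {0} ∪ A × [0,1] contributes a copy of (X, A). This is
  -- the only place where the hypothesis on P enters, and the last triple shifts it by one degree.
  have v3 : ℋ.Vanish q (relPair (hS.inter he) hb) := by
    refine (hP.of_isPushout htop).of_isPushout
      (isPushout_relMap (isSubcomplex_prod_one hu) hb (hS.inter he) ?_ ?_)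
    · rintro ⟨x, t⟩ ⟨-, rfl⟩
      exact ⟨⟨trivial, zero_le_one, le_rfl⟩, Or.inl ⟨trivial, rfl⟩⟩
    · exact fun p hp => hp.2
  exact Vanish.triple_right hS hb he Set.subset_union_right v3 v2

/-! ### Disjoint unions -/

section DisjointUnion

variable {ι : Type u} {X : ι → SmoothGCW G} {Y : SmoothGCW G} {f : ∀ i, (X i).toPair ⟶ Y.toPair}

lemma induction_disjointUnion (hf : IsDisjointUnion f) {q : ℤ} {p : ℋ.abs q Y → Prop}
    (h0 : p 0) (hadd : ∀ a b, p a → p b → p (a + b))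
    (h : ∀ i (z : ℋ.abs q (X i)), p ((ℋ.H q).map (f i) z)) (y : ℋ.abs q Y) : p y := by
  classical
  obtain ⟨z, rfl⟩ := (ℋ.disjoint_union q ι X Y f hf).2 y
  induction z using DirectSum.induction_on with
  | zero => rw [map_zero]; exact h0
  | of i z => rw [DirectSum.toAddMonoid_of]; exact h i z
  | add a b ha hb => rw [map_add]; exact hadd _ _ ha hb

lemma exists_hom_disjointUnion (hf : IsDisjointUnion f) {q : ℤ} {B : Type*} [AddCommGroup B]
    (φ : ∀ i, ℋ.abs q (X i) →+ B) :
    ∃ Φ : ℋ.abs q Y →+ B, ∀ i (z : ℋ.abs q (X i)), Φ ((ℋ.H q).map (f i) z) = φ i z := by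
  classical
  let e := AddEquiv.ofBijective _ (ℋ.disjoint_union q ι X Y f hf)
  refine ⟨(DirectSum.toAddMonoid φ).comp e.symm.toAddMonoidHom, fun i z => ?_⟩
  have : e (DirectSum.of (fun i => (ℋ.abs q (X i) : Type u)) i z) = (ℋ.H q).map (f i) z :=
    DirectSum.toAddMonoid_of (fun i => ((ℋ.H q).map (f i)).hom) i z
  rw [← this]
  change DirectSum.toAddMonoid φ (e.symm (e _)) = _
  rw [e.symm_apply_apply, DirectSum.toAddMonoid_of]

lemma Vanish.of_isDisjointUnion (hf : IsDisjointUnion f) {q : ℤ}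
    (h : ∀ i, ℋ.Vanish q (X i).toPair) : ℋ.Vanish q Y.toPair := fun y =>
  induction_disjointUnion hf (p := fun y => y = 0) rfl
    (fun a b ha hb => by rw [ha, hb, add_zero])
    (fun i z => by rw [h i z, map_zero]) y

/-- Vanishing of relative homology passes to disjoint unions. -/
lemma Vanish.of_relative_disjointUnion {P : ι → SmoothGCWPair G} {Q : SmoothGCWPair G}
    {f : ∀ i, P i ⟶ Q} (hf : IsDisjointUnion fun i => absMap (f i))
    (hf' : IsDisjointUnion (X := fun i => (P i).X.restrict (P i).A (P i).isSubcomplex)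
      (Y := Q.X.restrict Q.A Q.isSubcomplex) fun i => SmoothGCWPair.bd.map (f i)) {q : ℤ}
    (h : ∀ i, ℋ.Vanish (q + 1) (P i)) : ℋ.Vanish (q + 1) Q := by
  classical
  intro z
  -- The disjoint union axiom concerns absolute complexes, so the relative case is chased through
  -- long exact sequences. First, ℋ_q(A_i) embeds in ℋ_q(X_i).
  have hinj : ∀ i, Function.Injective ((ℋ.H q).map (P i).bdIncl) := fun i => by
    rw [injective_iff_map_eq_zero]
    intro a ha
    obtain ⟨w, rfl⟩ := (ℋ.exact_bd q (P i) a).1 ha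
    rw [h i w, map_zero]
  obtain ⟨a, ha⟩ := (ℋ.disjoint_union q ι _ _ _ hf').2 ((ℋ.boundary q).app Q z)
  -- The map Φ splits ℋ_q of the union into the direct sum of the ℋ_q(X_i). Through it, the
  -- vanishing of the boundary of z in the total space is read off component by component.
  obtain ⟨Φ, hΦ⟩ := exists_hom_disjointUnion (ℋ := ℋ) (q := q) hf
    fun i => DirectSum.of (fun i => (ℋ.abs q (P i).X : Type u)) i
  have hcomp : (Φ.comp ((ℋ.H q).map Q.bdIncl).hom).comp
      (DirectSum.toAddMonoid fun i => ((ℋ.H q).map (SmoothGCWPair.bd.map (f i))).hom) =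
      DirectSum.map fun i => ((ℋ.H q).map (P i).bdIncl).hom := by
    refine DirectSum.addHom_ext fun i b => ?_
    rw [AddMonoidHom.comp_apply, DirectSum.toAddMonoid_of, DirectSum.map_of]
    refine Eq.trans ?_ (hΦ i ((ℋ.H q).map (P i).bdIncl b))
    refine congrArg Φ ?_
    exact ℋ.map_map_of_comp_eq q (f := SmoothGCWPair.bd.map (f i)) (g := Q.bdIncl)
      (f' := (P i).bdIncl) (g' := absMap (f i)) rfl b
  have h0 : DirectSum.map (fun i => ((ℋ.H q).map (P i).bdIncl).hom) a = 0 := by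
    refine (DFunLike.congr_fun hcomp a).symm.trans ?_
    refine (congrArg (fun y => Φ ((ℋ.H q).map Q.bdIncl y)) ha).trans ?_
    exact (congrArg Φ ((ℋ.exact_bd q Q).apply_apply_eq_zero z)).trans (map_zero _)
  have ha0 : a = 0 := by
    refine DFinsupp.ext fun i => hinj i ?_
    refine Eq.trans ?_ (map_zero _).symm
    have := congrArg (fun b => b i) h0
    exact this
  rw [ha0, map_zero] at ha
  obtain ⟨y, rfl⟩ := (ℋ.exact_pair q Q z).1 ha.symm
  -- Now z comes from an absolute class y. By additivity y may be taken on a single X_i, and then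
  -- its image factors through ℋ_{q+1}(X_i, A_i) = 0.
  refine induction_disjointUnion hf (p := fun y => (ℋ.H (q + 1)).map Q.absIncl y = 0)
    (map_zero _) (fun a b ha hb => by rw [map_add, ha, hb, add_zero]) (fun i w => ?_) y
  refine (ℋ.map_map_of_comp_eq (q + 1) (f := absMap (f i)) (g := Q.absIncl)
    (f' := (P i).absIncl) (g' := f i) rfl w).trans ?_
  rw [h i ((ℋ.H (q + 1)).map (P i).absIncl w), map_zero]

end DisjointUnion

end SmoothGHomologyTheory

end SmoothBredon

end

/-! ### Equivariant cells, layers (X_n, X_{n-1}) and pairs of skeleta. -/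

noncomputable section

namespace SmoothBredon

variable {G : Type u} [Group G] [TopologicalSpace G]

/-! ### Disjoint unions of orbits and of equivariant cells -/

section OrbitSum

variable [IsTopologicalGroup G] {ι : Type u} (H : ι → Subgroup G)
  (hH : ∀ i, IsOpen (H i : Set G))

lemma discreteTopology_orbitSum (hH : ∀ i, IsOpen (H i : Set G)) :
    DiscreteTopology (Σ i, G ⧸ H i) := by
  have := fun i => QuotientGroup.discreteTopology (hH i)
  infer_instance

/-- The `0`-dimensional `G`-CW-structure on a disjoint union of orbits. -/
def orbitSumStructure : GCWStructure G (Σ i, G ⧸ H i) where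
  cell n := {_i : ι // n = 0}
  typ _ i := H i.1
  isClosed_typ _ i := (H i.1).isClosed_of_isOpen (hH i.1)
  skLT n := {_x | 0 < n}
  char _ i p := ⟨i.1, p.1⟩
  continuous_char _ i := continuous_sigmaMk.comp continuous_fst
  char_smul _ _ _ _ _ := rfl
  char_boundary n i a d h := by
    obtain ⟨i, rfl⟩ := i
    have : d.norm = 0 := by
      unfold Disk.norm
      rw [Subsingleton.elim (d : EuclideanSpace ℝ (Fin 0)) 0, norm_zero]
    rw [this] at h
    exact absurd h zero_ne_one
  bijOn_char n := by
    refine ⟨?_, ?_, ?_⟩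
    · rintro ⟨⟨i, rfl⟩, p⟩ _
      exact ⟨Nat.one_pos, fun h => lt_irrefl 0 h⟩
    · rintro ⟨⟨i, rfl⟩, a, d⟩ _ ⟨⟨j, _⟩, b, e⟩ _ h
      obtain ⟨rfl, h⟩ := Sigma.mk.inj h
      obtain rfl := eq_of_heq h
      have hd : d = e := Subtype.ext (Subsingleton.elim _ _)
      rw [hd]
    · rintro ⟨i, x⟩ ⟨_, hx⟩
      have hn : n = 0 := Nat.eq_zero_of_not_pos hx
      subst hn
      refine ⟨⟨⟨i, rfl⟩, x, ⟨0, by simp⟩⟩, ?_, rfl⟩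
      rw [Set.mem_ofPred_eq]
      simp [Disk.norm]
  skLT_zero := by ext; simp
  skLT_subset n x h := Nat.lt_succ_of_lt h
  iUnion_skLT := by
    ext x
    simp only [Set.mem_iUnion, Set.mem_univ, iff_true]
    exact ⟨1, Nat.one_pos⟩
  isClosed_skLT n := by
    have := discreteTopology_orbitSum H hH
    exact isClosed_discrete _
  isClosed_of_char n C _ _ _ := by
    have := discreteTopology_orbitSum H hH
    exact isClosed_discrete _
  isClosed_of_skLT C _ := by
    have := discreteTopology_orbitSum H hH
    exact isClosed_discrete _

/-- A disjoint union of orbits, as a smooth `G`-CW-complex. -/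
def orbitSum : SmoothGCW G where
  carrier := Σ i, G ⧸ H i
  contAct := ⟨by
    have := discreteTopology_orbitSum H hH
    refine continuous_prod_of_discrete_right.2 fun ⟨i, x⟩ => ?_
    exact (continuous_sigmaMk (σ := fun i => G ⧸ H i) (i := i)).comp
      (continuous_id.smul continuous_const)⟩
  cw := orbitSumStructure H hH
  isOpen_stabilizer x := by
    have := discreteTopology_orbitSum H hH
    have hc : Continuous fun g : G => g • x :=
      (continuous_sigmaMk (σ := fun i => G ⧸ H i) (i := x.1)).comp
        (continuous_id.smul continuous_const)
    exact (isOpen_discrete ({x} : Set (Σ i, G ⧸ H i))).preimage hc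

/-- The inclusion of an orbit in a disjoint union of orbits. -/
def orbitSumIncl (i : ι) : (orbit (H i) (hH i)).toPair ⟶ (orbitSum H hH).toPair where
  toFun := fun x : G ⧸ H i => (⟨i, x⟩ : Σ i, G ⧸ H i)
  continuous_toFun := continuous_sigmaMk (σ := fun i => G ⧸ H i)
  map_smul _ _ := rfl
  mapsTo _ h := h.elim

lemma isDisjointUnion_orbitSum :
    IsDisjointUnion (X := fun i => orbit (H i) (hH i)) (orbitSumIncl H hH) :=
  (Homeomorph.refl (Σ i, G ⧸ H i)).isHomeomorph

end OrbitSum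

/-- The vanishing of the homology of orbits in negative degrees. -/
def SmoothGHomologyTheory.OrbitConnective [IsTopologicalGroup G] (ℋ : SmoothGHomologyTheory G)
    (H : Subgroup G) : Prop :=
  ∀ (hH : IsOpen (H : Set G)) (q : ℤ), q < 0 → ℋ.Vanish q (orbit H hH).toPair

/-- A pair is a disjoint union of the equivariant cells `G/H_i × (D^n, S^{n-1})`. -/
structure CellPair {ι : Type u} (H : ι → Subgroup G) (n : ℕ) where
  P : SmoothGCWPair G
  e : (Σ i, (G ⧸ H i) × Disk n) ≃ₜ P.X.carrier
  e_smul : ∀ (g : G) i a d, e ⟨i, (g • a, d)⟩ = g • e ⟨i, (a, d)⟩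
  mem_iff : ∀ p, e p ∈ P.A ↔ ¬ p.2.2.norm < 1

namespace CellPair

variable {ι : Type u} {H : ι → Subgroup G} {n : ℕ}

lemma symm_smul (E : CellPair H n) (g : G) (x : E.P.X.carrier) :
    E.e.symm (g • x) = ⟨(E.e.symm x).1, (g • (E.e.symm x).2.1, (E.e.symm x).2.2)⟩ := by
  rw [Homeomorph.symm_apply_eq, E.e_smul]
  exact congrArg (g • ·) (E.e.apply_symm_apply x).symm

lemma mem_iff' (E : CellPair H n) (x : E.P.X.carrier) :
    x ∈ E.P.A ↔ ¬ (E.e.symm x).2.2.norm < 1 := by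
  rw [← E.mem_iff, E.e.apply_symm_apply]

/-- The `0`-dimensional case. -/
def zero [IsTopologicalGroup G] (hH : ∀ i, IsOpen (H i : Set G)) : CellPair H 0 where
  P := (orbitSum H hH).toPair
  e :=
    { toFun := fun p => (⟨p.1, p.2.1⟩ : Σ i, G ⧸ H i)
      invFun := fun p : Σ i, G ⧸ H i => ⟨p.1, (p.2, ⟨0, by simp⟩)⟩
      left_inv := fun p => Sigma.ext rfl
        (heq_of_eq (Prod.ext rfl (Subtype.ext (Subsingleton.elim _ _))))
      right_inv := fun _ => rfl
      continuous_toFun := continuous_sigma fun i => continuous_sigmaMk.comp continuous_fst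
      continuous_invFun := by
        have := discreteTopology_orbitSum H hH
        exact continuous_of_discreteTopology (α := Σ i, G ⧸ H i) }
  e_smul _ _ _ _ := rfl
  mem_iff p := by
    refine ⟨fun h => h.elim, fun h => (h ?_).elim⟩
    unfold Disk.norm
    rw [Subsingleton.elim (p.2.2 : EuclideanSpace ℝ (Fin 0)) 0, norm_zero]
    exact zero_lt_one

/-- The relative homeomorphism underlying the inductive step. -/
def succHomeo (E : CellPair H n) : (Σ i, (G ⧸ H i) × Disk (n + 1)) ≃ₜ
    (Set.univ ×ˢ Set.Icc (0 : ℝ) 1 : Set (E.P.X.carrier × ℝ)) where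
  toFun p := ⟨(E.e ⟨p.1, (p.2.1, (GCWStructure.diskHomeo n p.2.2).1)⟩,
    (GCWStructure.diskHomeo n p.2.2).2), trivial, (GCWStructure.diskHomeo n p.2.2).2.2⟩
  invFun w :=
    (fun p : Σ i, ((G ⧸ H i) × Disk n) × Set.Icc (0 : ℝ) 1 =>
        (⟨p.1, (p.2.1.1, (GCWStructure.diskHomeo n).symm (p.2.1.2, p.2.2))⟩ :
          Σ i, (G ⧸ H i) × Disk (n + 1)))
      (Homeomorph.sigmaProdDistrib (E.e.symm w.1.1, (⟨w.1.2, w.2.2⟩ : Set.Icc (0 : ℝ) 1)))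
  left_inv p := by
    obtain ⟨i, a, d⟩ := p
    dsimp only
    rw [E.e.symm_apply_apply]
    refine Sigma.ext rfl (heq_of_eq (Prod.ext rfl ?_))
    exact (GCWStructure.diskHomeo n).symm_apply_apply d
  right_inv w := by
    refine Subtype.ext (Prod.ext ?_ ?_)
    · refine (congrArg (fun d => E.e ⟨(E.e.symm w.1.1).1, ((E.e.symm w.1.1).2.1, d)⟩) ?_).trans
        (E.e.apply_symm_apply w.1.1)
      exact congrArg Prod.fst ((GCWStructure.diskHomeo n).apply_symm_apply
        ((E.e.symm w.1.1).2.2, (⟨w.1.2, w.2.2⟩ : Set.Icc (0 : ℝ) 1)))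
    · exact congrArg (fun z => (z.2 : ℝ)) ((GCWStructure.diskHomeo n).apply_symm_apply
        ((E.e.symm w.1.1).2.2, (⟨w.1.2, w.2.2⟩ : Set.Icc (0 : ℝ) 1)))
  continuous_toFun := by
    refine Continuous.subtype_mk (continuous_sigma fun i => ?_) _
    have h : Continuous fun p : (G ⧸ H i) × Disk (n + 1) => GCWStructure.diskHomeo n p.2 :=
      (GCWStructure.diskHomeo n).continuous.comp continuous_snd
    exact (E.e.continuous.comp ((continuous_sigmaMk (σ := fun i => (G ⧸ H i) × Disk n)
      (i := i)).comp (continuous_fst.prodMk h.fst))).prodMk (continuous_subtype_val.comp h.snd)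
  continuous_invFun := by
    have h1 : Continuous fun p : Σ i, ((G ⧸ H i) × Disk n) × Set.Icc (0 : ℝ) 1 =>
        (⟨p.1, (p.2.1.1, (GCWStructure.diskHomeo n).symm (p.2.1.2, p.2.2))⟩ :
          Σ i, (G ⧸ H i) × Disk (n + 1)) := by
      refine continuous_sigma fun i => ?_
      refine (continuous_sigmaMk (σ := fun i => (G ⧸ H i) × Disk (n + 1)) (i := i)).comp ?_
      exact continuous_fst.fst.prodMk ((GCWStructure.diskHomeo n).symm.continuous.comp
        (continuous_fst.snd.prodMk continuous_snd))
    refine h1.comp (Homeomorph.sigmaProdDistrib.continuous.comp ?_)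
    exact (E.e.symm.continuous.comp continuous_subtype_val.fst).prodMk
      (continuous_subtype_val.snd.subtype_mk _)

/-- The inductive step. -/
def succ (E : CellPair H n) : CellPair H (n + 1) where
  P := suspPair E.P
  e := E.succHomeo
  e_smul g i a d := Subtype.ext (Prod.ext (E.e_smul g i a _) rfl)
  mem_iff p := by
    refine (mem_suspPair_iff _).trans ?_
    rw [GCWStructure.norm_lt_one_iff_diskHomeo]
    change E.e ⟨p.1, (p.2.1, (GCWStructure.diskHomeo n p.2.2).1)⟩ ∈ E.P.A ∨
      ((GCWStructure.diskHomeo n p.2.2).2 : ℝ) = 0 ∨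
      ((GCWStructure.diskHomeo n p.2.2).2 : ℝ) = 1 ↔ _
    rw [E.mem_iff]
    have h0 := (GCWStructure.diskHomeo n p.2.2).2.2.1
    have h1 := (GCWStructure.diskHomeo n p.2.2).2.2.2
    constructor
    · rintro (h | h | h) ⟨h2, h3, h4⟩
      · exact h h2
      · exact h3.ne' h
      · exact h4.ne h
    · intro h
      by_contra hn
      push Not at hn
      exact h ⟨hn.1, lt_of_le_of_ne h0 hn.2.1.symm, lt_of_le_of_ne h1 hn.2.2⟩

variable [IsTopologicalGroup G]

/-- Each suspension raises both the dimension of the cells and the vanishing range by one, starting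
from a disjoint union of orbits. Some model of the cells is enough, since `attach` accepts any
`CellPair`. -/
lemma exists_vanish {ℋ : SmoothGHomologyTheory G} (hH : ∀ i, IsOpen (H i : Set G))
    (hv : ∀ i, ℋ.OrbitConnective (H i)) (n : ℕ) :
    ∃ E : CellPair H n, ∀ q : ℤ, q < n → ℋ.Vanish q E.P := by
  induction n with
  | zero =>
    refine ⟨zero hH, fun q hq => ?_⟩
    exact SmoothGHomologyTheory.Vanish.of_isDisjointUnion (isDisjointUnion_orbitSum H hH)
      fun i => hv i (hH i) q (by exact_mod_cast hq)
  | succ n ih =>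
    obtain ⟨E, hE⟩ := ih
    refine ⟨E.succ, fun q hq => ?_⟩
    obtain ⟨q, rfl⟩ : ∃ q', q = q' + 1 := ⟨q - 1, by ring⟩
    exact (hE q (by push_cast at hq; omega)).suspPair

end CellPair

/-! ### The skeletal filtration -/

namespace SmoothGCW

variable (X : SmoothGCW G)

/-- The pair `(X_n, X_{n-1})`. -/
def layer (n : ℕ) : SmoothGCWPair G :=
  ⟨X.skel n, (X.skel n).cw.skLT n, (X.skel n).cw.isSubcomplex_skLT n⟩

/-- The characteristic maps of the `n`-cells, as a map of pairs. -/
def attach {n : ℕ} (E : CellPair (X.cw.typ n) n) : E.P ⟶ X.layer n where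
  toFun := fun x => (⟨X.cw.char n (E.e.symm x).1 (E.e.symm x).2,
    X.cw.char_mem_skLT_succ _ _⟩ : X.cw.skLT (n + 1))
  continuous_toFun := by
    refine Continuous.subtype_mk (p := fun x => x ∈ X.cw.skLT (n + 1)) ?_ _
    have : Continuous fun p : Σ i, (G ⧸ X.cw.typ n i) × Disk n => X.cw.char n p.1 p.2 :=
      continuous_sigma fun i => X.cw.continuous_char n i
    exact this.comp E.e.symm.continuous
  map_smul g x := by
    refine Subtype.ext ?_
    change X.cw.char n _ _ = g • X.cw.char n _ _
    rw [E.symm_smul]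
    exact X.cw.char_smul n _ g _ _
  mapsTo x hx := by
    rw [E.mem_iff'] at hx
    exact X.cw.char_boundary n _ _ _ (le_antisymm (Disk.norm_le_one _) (not_lt.1 hx))

/-- The two clauses of a pushout are the axioms `bijOn_char` and `isClosed_of_char`, transported
along the homeomorphism of `E`. -/
lemma isPushout_attach {n : ℕ} (E : CellPair (X.cw.typ n) n) :
    SmoothGCWPair.IsPushout (X.attach E) := by
  have hn : ∀ x ∉ E.P.A, (E.e.symm x).2.2.norm < 1 := fun x hx => by
    by_contra h
    exact hx ((E.mem_iff' x).2 h)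
  refine ⟨⟨?_, ?_, ?_⟩, ?_⟩
  · intro x hx
    exact X.cw.char_not_mem (hn x hx)
  · intro x hx y hy h
    have h' := congrArg (fun z : X.cw.skLT (n + 1) => (z : X.carrier)) h
    exact E.e.symm.injective (X.cw.char_injective (hn x hx) (hn y hy) h')
  · intro (z : X.cw.skLT (n + 1)) hz
    rcases X.cw.mem_skLT_or_exists z.2 with h | ⟨i, p, hp, h⟩
    · exact absurd h hz
    · refine ⟨E.e ⟨i, p⟩, fun h => (E.mem_iff _).1 h hp, Subtype.ext ?_⟩
      change X.cw.char n (E.e.symm (E.e ⟨i, p⟩)).1 (E.e.symm (E.e ⟨i, p⟩)).2 = _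
      rw [E.e.symm_apply_apply]
      exact h
  · intro (C : Set (X.cw.skLT (n + 1))) h1 h2
    have hemb := (X.cw.isClosed_skLT (n + 1)).isClosedEmbedding_subtypeVal
    refine hemb.isClosed_iff_image_isClosed.2 (X.cw.isClosed_of_char n _ ?_ ?_ fun i => ?_)
    · rintro _ ⟨x, -, rfl⟩
      exact x.2
    · convert hemb.isClosedMap _ h1 using 1
      ext x
      constructor
      · rintro ⟨⟨y, hy, rfl⟩, hy'⟩
        exact ⟨y, ⟨hy, hy'⟩, rfl⟩
      · rintro ⟨y, ⟨hy, hy'⟩, rfl⟩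
        exact ⟨⟨y, hy, rfl⟩, hy'⟩
    · have hc : Continuous fun p : (G ⧸ X.cw.typ n i) × Disk n => E.e ⟨i, p⟩ :=
        E.e.continuous.comp continuous_sigmaMk
      convert h2.preimage hc using 1
      ext p
      have hp : (X.attach E).toFun (E.e ⟨i, p⟩) =
          (⟨X.cw.char n i p, X.cw.char_mem_skLT_succ i p⟩ : X.cw.skLT (n + 1)) := by
        refine Subtype.ext ?_
        change X.cw.char n (E.e.symm (E.e ⟨i, p⟩)).1 (E.e.symm (E.e ⟨i, p⟩)).2 = _
        rw [E.e.symm_apply_apply]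
      refine Iff.trans ?_ (iff_of_eq (congrArg (fun w => w ∈ C) hp.symm))
      constructor
      · rintro ⟨y, hy, hyp⟩
        have : y = ⟨X.cw.char n i p, X.cw.char_mem_skLT_succ i p⟩ := Subtype.ext hyp
        rwa [this] at hy
      · exact fun h => ⟨_, h, rfl⟩

/-- The subgroup belonging to a cell is the stabilizer of the points `Q_i(eH_i, d)` of the open
cell. -/
lemma stabilizer_char {n : ℕ} (i : X.cw.cell n) {d : Disk n} (hd : d.norm < 1) :
    MulAction.stabilizer G (X.cw.char n i (((1 : G) : G ⧸ X.cw.typ n i), d)) = X.cw.typ n i := by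
  ext g
  rw [MulAction.mem_stabilizer_iff, ← X.cw.char_smul]
  have : g • ((1 : G) : G ⧸ X.cw.typ n i) = ((1 : G) : G ⧸ X.cw.typ n i) ↔ g ∈ X.cw.typ n i := by
    change ((g * 1 : G) : G ⧸ X.cw.typ n i) = _ ↔ _
    rw [eq_comm, QuotientGroup.eq]
    simp
  rw [← this]
  constructor
  · intro h
    have h' := X.cw.char_injective (i := i) (j := i) (p := (g • ((1 : G) : G ⧸ X.cw.typ n i), d))
      (q := (((1 : G) : G ⧸ X.cw.typ n i), d)) hd hd h
    exact (Prod.mk.inj (eq_of_heq (Sigma.mk.inj h').2)).1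
  · intro h
    rw [h]

/-- The centre of the disk. -/
def center (n : ℕ) : Disk n := ⟨0, by simp⟩

lemma norm_center (n : ℕ) : (center n).norm < 1 := by simp [center, Disk.norm]

lemma typ_mem_isotropy {n : ℕ} (i : X.cw.cell n) : X.cw.typ n i ∈ (isotropyFamily X).mem :=
  ⟨_, X.stabilizer_char i (norm_center n)⟩

lemma isOpen_typ {n : ℕ} (i : X.cw.cell n) : IsOpen (X.cw.typ n i : Set G) :=
  (isotropyFamily X).isOpen _ (X.typ_mem_isotropy i)

end SmoothGCW

section Skeleta

variable [IsTopologicalGroup G] {ℋ : SmoothGHomologyTheory G} {X : SmoothGCW G}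

/-- All the orbits `G/H`, for `H` the type of a cell of `X`, have homology concentrated in
non-negative degrees. -/
def SmoothGHomologyTheory.Connective (ℋ : SmoothGHomologyTheory G) (X : SmoothGCW G) : Prop :=
  ∀ n i, ℋ.OrbitConnective (X.cw.typ n i)

namespace SmoothGHomologyTheory

lemma Connective.vanish_layer (h : ℋ.Connective X) {n : ℕ} {q : ℤ} (hq : q < n) :
    ℋ.Vanish q (X.layer n) := by
  obtain ⟨E, hE⟩ := CellPair.exists_vanish (fun i => X.isOpen_typ i) (h n) n
  exact (hE q hq).of_isPushout (X.isPushout_attach E)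

omit [IsTopologicalGroup G] in
lemma vanish_of_subset {S R : Set X.carrier} (hS : X.cw.IsSubcomplex S)
    (hR : X.cw.IsSubcomplex R) (h : S ⊆ R) (q : ℤ) : ℋ.Vanish q (relPair hS hR) := by
  refine vanish_of_deformation (P := relPair hS hR)
    { toFun := fun x : S => (⟨x, h x.2⟩ : (Subtype.val ⁻¹' R : Set S))
      continuous_toFun := continuous_id.subtype_mk _
      map_smul := fun _ _ => rfl
      mapsTo := fun _ h => h.elim } rfl ?_ q
  exact ⟨fun p => p.1, continuous_fst, fun _ _ _ => rfl, fun _ _ h => h, fun _ => rfl,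
    fun _ => rfl⟩

/-- Induction on n along the triple X_{m-1} ⊆ X_{n-1} ⊆ X_n. The layer (X_n, X_{n-1}) has no
homology below degree n, and only layers with m ≤ n occur; for smaller n the pair has equal members.
-/
lemma Connective.vanish_skeleta (h : ℋ.Connective X) {m : ℕ} {q : ℤ} (hq : q < m) (n : ℕ) :
    ℋ.Vanish q (relPair (X.cw.isSubcomplex_skLT n) (X.cw.isSubcomplex_skLT m)) := by
  induction n with
  | zero =>
    refine vanish_of_subset _ _ ?_ q
    rw [X.cw.skLT_zero]
    exact Set.empty_subset _
  | succ n ih =>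
    rcases le_or_gt (n + 1) m with hm | hm
    · exact vanish_of_subset _ _ (X.cw.skLT_mono hm) q
    · obtain ⟨q, rfl⟩ : ∃ q', q = q' + 1 := ⟨q - 1, by ring⟩
      refine Vanish.triple_middle (X.cw.isSubcomplex_skLT (n + 1)) (X.cw.isSubcomplex_skLT m)
        (X.cw.isSubcomplex_skLT n) (X.cw.skLT_mono (by omega)) ?_ ?_
      · refine ih.of_isPushout (isPushout_relMap _ _ _ ?_ ?_)
        · exact fun x hx => ⟨X.cw.skLT_subset n hx, hx⟩
        · exact fun x hx => Or.inl hx.2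
      · exact h.vanish_layer (by omega)

end SmoothGHomologyTheory

end Skeleta

end SmoothBredon

end

/-! ### A cellwise deformation of X and a height function, giving a map to the telescope. -/

noncomputable section

namespace SmoothBredon

/-! ### Pushing a disk radially outwards -/

namespace Disk

variable {n : ℕ}

/-- The point `d / max(‖d‖, c)`. -/
def push (d : Disk n) (c : ℝ) : Disk n :=
  ⟨(max d.norm c)⁻¹ • (d : EuclideanSpace ℝ (Fin n)), by
    have h : 0 ≤ max d.norm c := le_max_of_le_left d.norm_nonneg
    rw [mem_closedBall_zero_iff, norm_smul, norm_inv, Real.norm_of_nonneg h]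
    exact inv_mul_le_one_of_le₀ (le_max_left d.norm c) h⟩

lemma norm_push {d : Disk n} {c : ℝ} (hc : 0 < c) (h : c ≤ d.norm) : (d.push c).norm = 1 := by
  have h0 : 0 < d.norm := hc.trans_le h
  change ‖(max d.norm c)⁻¹ • (d : EuclideanSpace ℝ (Fin n))‖ = 1
  rw [max_eq_left h, norm_smul, norm_inv, Real.norm_of_nonneg h0.le]
  exact inv_mul_cancel₀ h0.ne'

lemma push_eq_self {d : Disk n} {c : ℝ} (h : max d.norm c = 1) : d.push c = d := by
  refine Subtype.ext ?_
  change (max d.norm c)⁻¹ • (d : EuclideanSpace ℝ (Fin n)) = d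
  rw [h, inv_one, one_smul]

lemma continuous_push {Z : Type*} [TopologicalSpace Z] {f : Z → Disk n} {c : Z → ℝ}
    (hf : Continuous f) (hc : Continuous c) (h : ∀ z, 0 < c z) :
    Continuous fun z => (f z).push (c z) := by
  have h1 : Continuous fun z => max (f z).norm (c z) := (Disk.continuous_norm.comp hf).max hc
  have h2 : Continuous fun z => (max (f z).norm (c z))⁻¹ :=
    h1.inv₀ fun z => (lt_max_of_lt_right (h z)).ne'
  exact Continuous.subtype_mk (h2.smul (continuous_subtype_val.comp hf)) _

end Disk

namespace GCWStructure

variable {G : Type u} [Group G] [TopologicalSpace G]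
  {X : Type u} [TopologicalSpace X] [MulAction G X] (cw : GCWStructure G X)

/-! ### Cellwise induction and recursion -/

/-- Every point is interior to some cell, so a property need only be proved at interior points,
given that it holds on the lower skeleton. -/
lemma cell_induction {p : X → Prop}
    (h : ∀ n i q, q.2.norm < 1 → (∀ x ∈ cw.skLT n, p x) → p (cw.char n i q)) (x : X) : p x := by
  have key : ∀ n, ∀ x ∈ cw.skLT n, p x := by
    intro n
    induction n with
    | zero => intro x hx; rw [cw.skLT_zero] at hx; exact hx.elim
    | succ n ih =>
      intro x hx
      rcases cw.mem_skLT_or_exists hx with hx | ⟨i, q, hq, rfl⟩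
      · exact ih x hx
      · exact h n i q hq ih
  obtain ⟨n, hn⟩ := cw.exists_mem_skLT x
  exact key n x hn

lemma char_mem_skLT_iff {n m : ℕ} {i : cw.cell n} {q : (G ⧸ cw.typ n i) × Disk n}
    (hq : q.2.norm < 1) : cw.char n i q ∈ cw.skLT m ↔ n < m := by
  constructor
  · intro h
    by_contra hm
    exact cw.char_not_mem hq (cw.skLT_mono (not_lt.1 hm) h)
  · exact fun h => cw.skLT_mono h (cw.char_mem_skLT_succ i q)

/-- Functions can be defined cell by cell. -/
lemma exists_cell_recursion {Y : Type*} (y₀ : X → Y)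
    (step : ∀ n (i : cw.cell n), (X → Y) → (G ⧸ cw.typ n i) × Disk n → Y)
    (hb : ∀ n i g p, p.2.norm = 1 → step n i g p = g (cw.char n i p))
    (hc : ∀ n i g g', (∀ x ∈ cw.skLT n, g x = g' x) → ∀ p, step n i g p = step n i g' p) :
    ∃ f : X → Y, ∀ n i p, f (cw.char n i p) = step n i f p := by
  classical
  -- Stage n has its final values on X_{n-1}; elsewhere the values, including the default `y₀`, are
  -- provisional. The next stage changes only the interiors of n-cells.
  let F : ℕ → X → Y := fun n => Nat.rec y₀ (fun n Fn x =>
    if h : ∃ q : Σ i, (G ⧸ cw.typ n i) × Disk n, q.2.2.norm < 1 ∧ cw.char n q.1 q.2 = x then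
      step n h.choose.1 Fn h.choose.2 else Fn x) n
  have F_succ : ∀ n, ∀ x ∈ cw.skLT n, F (n + 1) x = F n x := by
    intro n x hx
    refine dif_neg ?_
    rintro ⟨q, hq, rfl⟩
    exact cw.char_not_mem hq hx
  have F_char : ∀ n i p, p.2.norm < 1 → F (n + 1) (cw.char n i p) = step n i (F n) p := by
    intro n i p hp
    have h : ∃ q : Σ i, (G ⧸ cw.typ n i) × Disk n, q.2.2.norm < 1 ∧
        cw.char n q.1 q.2 = cw.char n i p := ⟨⟨i, p⟩, hp, rfl⟩
    refine (dif_pos h).trans ?_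
    have : h.choose = ⟨i, p⟩ := cw.char_injective h.choose_spec.1 hp h.choose_spec.2
    rw [this]
  have F_le : ∀ n k, ∀ x ∈ cw.skLT n, F (n + k) x = F n x := by
    intro n k x hx
    induction k with
    | zero => rfl
    | succ k ih => exact (F_succ (n + k) x (cw.skLT_mono (Nat.le_add_right n k) hx)).trans ih
  -- Any stage that has reached x gives the same value. The hypothesis `hc` then lets `step` be
  -- evaluated on f in place of stage n, and `hb` covers boundary points of cells.
  let f : X → Y := fun x => F (cw.exists_mem_skLT x).choose x
  have f_eq : ∀ n, ∀ x ∈ cw.skLT n, f x = F n x := by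
    intro n x hx
    have h1 := F_le _ n x (cw.exists_mem_skLT x).choose_spec
    have h2 := F_le n (cw.exists_mem_skLT x).choose x hx
    rw [add_comm] at h2
    exact h1.symm.trans h2
  refine ⟨f, fun n i p => ?_⟩
  rcases (Disk.norm_le_one p.2).lt_or_eq with hp | hp
  · rw [f_eq (n + 1) _ (cw.char_mem_skLT_succ i p), F_char n i p hp]
    exact hc n i _ _ (fun x hx => (f_eq n x hx).symm) p
  · exact (hb n i f p hp).symm

/-! ### A deformation of a `G`-CW-complex -/

lemma one_sub_half_pos (t : unitInterval) : 0 < 1 - (t : ℝ) / 2 := by linarith [t.2.2]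

/-- The time at which the previous stage of the deformation is to be used. -/
def pushTime (r : ℝ) (t : unitInterval) : unitInterval :=
  -- Three requirements fix this formula: time 0 where r = 1 - t/2, so that both branches of the
  -- deformation agree; time t at r = 1, so that the boundary of a cell moves as in the lower
  -- skeleton; and full time 1 for t = 1 and r ≥ 3/4, whence the factor 4.
  Set.projIcc 0 1 zero_le_one (min (t : ℝ) (4 * (r - (1 - (t : ℝ) / 2))))

lemma continuous_pushTime {Z : Type*} [TopologicalSpace Z] {r : Z → ℝ} {t : Z → unitInterval}
    (hr : Continuous r) (ht : Continuous t) : Continuous fun z => pushTime (r z) (t z) := by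
  unfold pushTime
  fun_prop

lemma pushTime_one (t : unitInterval) : pushTime 1 t = t := by
  unfold pushTime
  have : min (t : ℝ) (4 * (1 - (1 - (t : ℝ) / 2))) = t := min_eq_left (by linarith [t.2.1])
  rw [this, Set.projIcc_val]

lemma pushTime_eq_zero {r : ℝ} {t : unitInterval} (h : 1 - (t : ℝ) / 2 = r) :
    pushTime r t = 0 := by
  unfold pushTime
  have : min (t : ℝ) (4 * (r - (1 - (t : ℝ) / 2))) = 0 := by
    rw [h, sub_self, mul_zero]
    exact min_eq_right t.2.1
  rw [this]
  exact Set.projIcc_of_le_left _ le_rfl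

lemma pushTime_eq_one {r : ℝ} (h : 3 / 4 ≤ r) : pushTime r 1 = 1 := by
  unfold pushTime
  refine Set.projIcc_of_right_le _ (le_min le_rfl ?_)
  change (1 : ℝ) ≤ 4 * (r - (1 - 1 / 2))
  linarith

open Classical in
/-- There is an equivariant deformation of `X` through maps preserving the skeleta, which begins
with the identity. -/
lemma exists_deformation : ∃ h : X → unitInterval → X, ∀ n i p t, h (cw.char n i p) t =
    if 1 - (t : ℝ) / 2 ≤ p.2.norm then
      h (cw.char n i (p.1, p.2.push (1 - (t : ℝ) / 2))) (pushTime p.2.norm t)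
    else cw.char n i (p.1, p.2.push (1 - (t : ℝ) / 2)) := by
  -- At time t each disk is stretched by the factor 1/(1 - t/2). Points of norm below 1 - t/2 remain
  -- in the cell. The others reach the boundary sphere and from there follow the deformation of the
  -- lower skeleton for the time `pushTime`.
  refine (cw.exists_cell_recursion (Y := unitInterval → X) (fun x _ => x)
    (fun n i g p t => if 1 - (t : ℝ) / 2 ≤ p.2.norm then
      g (cw.char n i (p.1, p.2.push (1 - (t : ℝ) / 2))) (pushTime p.2.norm t)
      else cw.char n i (p.1, p.2.push (1 - (t : ℝ) / 2))) ?_ ?_).imp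
    fun h hh n i p t => congrFun (hh n i p) t
  · intro n i g p hp
    funext t
    have h1 : 1 - (t : ℝ) / 2 ≤ p.2.norm := by rw [hp]; linarith [t.2.1]
    rw [if_pos h1, Disk.push_eq_self (by rw [max_eq_left h1, hp]), hp, pushTime_one]
  · intro n i g g' hg p
    funext t
    split_ifs with h1
    · rw [hg]
      exact cw.char_boundary n i _ _ (Disk.norm_push (one_sub_half_pos t) h1)
    · rfl

-- The height must dominate an index k with the time-one image of x in `skLT k`. On the inner half
-- of an n-cell it is n + 1. Between norms 1/2 and 3/4 it stays at least n + 1 while the boundary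
-- value is blended in, and between 3/4 and 1 the summand n + 1 fades out, leaving the boundary
-- value at norm 1.
open Classical in
lemma exists_height : ∃ φ : X → ℝ, ∀ n i p, φ (cw.char n i p) =
    if 1 / 2 ≤ p.2.norm then
      min 1 (4 * (p.2.norm - 1 / 2)) * φ (cw.char n i (p.1, p.2.push (1 / 2))) +
        (n + 1) * min 1 (4 * (1 - p.2.norm))
    else (n : ℝ) + 1 := by
  refine cw.exists_cell_recursion (Y := ℝ) (fun _ => 0)
    (fun n i g p => if 1 / 2 ≤ p.2.norm then
      min 1 (4 * (p.2.norm - 1 / 2)) * g (cw.char n i (p.1, p.2.push (1 / 2))) +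
        (n + 1) * min 1 (4 * (1 - p.2.norm))
    else (n : ℝ) + 1) ?_ ?_
  · intro n i g p hp
    have h1 : 1 / 2 ≤ p.2.norm := by rw [hp]; norm_num
    rw [if_pos h1, Disk.push_eq_self (by rw [max_eq_left h1, hp]), hp]
    norm_num [two_mul]
  · intro n i g g' hg p
    split_ifs with h1
    · rw [hg]
      exact cw.char_boundary n i _ _ (Disk.norm_push (by norm_num) h1)
    · rfl

section Deformation

open Classical

variable {cw} {h : X → unitInterval → X} (hh : ∀ n i p t, h (cw.char n i p) t =
    if 1 - (t : ℝ) / 2 ≤ p.2.norm then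
      h (cw.char n i (p.1, p.2.push (1 - (t : ℝ) / 2))) (pushTime p.2.norm t)
    else cw.char n i (p.1, p.2.push (1 - (t : ℝ) / 2)))
  {φ : X → ℝ} (hφ : ∀ n i p, φ (cw.char n i p) =
    if 1 / 2 ≤ p.2.norm then
      min 1 (4 * (p.2.norm - 1 / 2)) * φ (cw.char n i (p.1, p.2.push (1 / 2))) +
        (n + 1) * min 1 (4 * (1 - p.2.norm))
    else (n : ℝ) + 1)

include hh

lemma deformation_zero (x : X) : h x 0 = x := by
  refine cw.cell_induction (p := fun x => h x 0 = x) (fun n i q hq _ => ?_) x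
  rw [hh, if_neg, Disk.push_eq_self]
  · change max q.2.norm (1 - 0 / 2) = 1
    rw [zero_div, sub_zero, max_eq_right hq.le]
  · change ¬ (1 - 0 / 2 ≤ q.2.norm)
    rw [zero_div, sub_zero]
    exact not_le.2 hq

lemma deformation_mem (x : X) {m : ℕ} (hx : x ∈ cw.skLT m) (t : unitInterval) :
    h x t ∈ cw.skLT m := by
  have := cw.cell_induction (p := fun x => ∀ m t, x ∈ cw.skLT m → h x t ∈ cw.skLT m)
    (fun n i q hq ih m t hm => ?_) x
  · exact this m t hx
  · rw [cw.char_mem_skLT_iff hq] at hm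
    rw [hh]
    split_ifs with h1
    · have hy : cw.char n i (q.1, q.2.push (1 - (t : ℝ) / 2)) ∈ cw.skLT n :=
        cw.char_boundary n i _ _ (Disk.norm_push (one_sub_half_pos t) h1)
      exact cw.skLT_mono hm.le (ih _ hy n _ hy)
    · exact cw.skLT_mono hm (cw.char_mem_skLT_succ i _)

lemma deformation_smul (g : G) (x : X) (t : unitInterval) : h (g • x) t = g • h x t := by
  refine cw.cell_induction (p := fun x => ∀ t, h (g • x) t = g • h x t)
    (fun n i q hq ih t => ?_) x t
  rw [← cw.char_smul n i g q.1 q.2, hh n i (g • q.1, q.2) t, hh n i (q.1, q.2) t]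
  dsimp only
  split_ifs with h1
  · rw [cw.char_smul]
    exact ih _ (cw.char_boundary n i _ _ (Disk.norm_push (one_sub_half_pos t) h1)) _
  · exact cw.char_smul n i g _ _

/-- Local compactness of [0,1] allows continuity on X × [0,1] to be checked skeleton by skeleton and
on cells times [0,1], where the map is given by two continuous branches. -/
lemma continuous_deformation : Continuous fun p : X × unitInterval => h p.1 p.2 := by
  refine continuous_prod_of_skLT (cw := cw) fun n => ?_
  induction n with
  | zero => rw [cw.skLT_zero, Set.empty_prod]; exact continuousOn_empty _
  | succ n ih =>
    refine continuousOn_prod_succ ih fun i => ?_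
    refine (continuous_congr (fun p : ((G ⧸ cw.typ n i) × Disk n) × unitInterval => hh n i p.1 p.2)).2 ?_
    have hd : Continuous fun p : ((G ⧸ cw.typ n i) × Disk n) × unitInterval => p.1.2.norm :=
      Disk.continuous_norm.comp (by fun_prop)
    have hc : Continuous fun p : ((G ⧸ cw.typ n i) × Disk n) × unitInterval =>
      1 - (p.2 : ℝ) / 2 := by fun_prop
    have hp : Continuous fun p : ((G ⧸ cw.typ n i) × Disk n) × unitInterval =>
        cw.char n i (p.1.1, p.1.2.push (1 - (p.2 : ℝ) / 2)) :=
      (cw.continuous_char n i).comp ((continuous_fst.fst).prodMk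
        (Disk.continuous_push continuous_fst.snd hc fun z => one_sub_half_pos z.2))
    refine continuous_if_le hc hd ?_ hp.continuousOn ?_
    · have hq := hp.prodMk (continuous_pushTime hd continuous_snd)
      refine ih.comp hq.continuousOn fun p hp' => ⟨?_, trivial⟩
      exact cw.char_boundary n i _ _ (Disk.norm_push (one_sub_half_pos p.2) hp')
    -- The branches meet where the norm equals 1 - t/2. There `pushTime` is 0, and the deformation
    -- at time 0 is the identity.
    · intro p hp'
      rw [pushTime_eq_zero hp', deformation_zero hh]

omit hh
include hφ

lemma continuous_height : Continuous φ := by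
  -- The dummy factor [0,1] makes the gluing lemma for products applicable; it is removed at the end
  -- by restricting to 0.
  have : Continuous fun p : X × unitInterval => φ p.1 := by
    refine continuous_prod_of_skLT (cw := cw) fun n => ?_
    induction n with
    | zero => rw [cw.skLT_zero, Set.empty_prod]; exact continuousOn_empty _
    | succ n ih =>
      refine continuousOn_prod_succ ih fun i => ?_
      refine (continuous_congr (fun p : ((G ⧸ cw.typ n i) × Disk n) × unitInterval => hφ n i p.1)).2 ?_
      have hd : Continuous fun p : ((G ⧸ cw.typ n i) × Disk n) × unitInterval => p.1.2.norm :=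
        Disk.continuous_norm.comp (by fun_prop)
      have hp : Continuous fun p : ((G ⧸ cw.typ n i) × Disk n) × unitInterval =>
          cw.char n i (p.1.1, p.1.2.push (1 / 2)) :=
        (cw.continuous_char n i).comp ((continuous_fst.fst).prodMk
          (Disk.continuous_push continuous_fst.snd continuous_const fun z => by norm_num))
      refine continuous_if_le continuous_const hd ?_ continuousOn_const ?_
      · refine ContinuousOn.add (ContinuousOn.mul (continuous_const.min
          (continuous_const.mul (hd.sub continuous_const))).continuousOn ?_)
          (continuous_const.mul (continuous_const.min
            (continuous_const.mul (continuous_const.sub hd)))).continuousOn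
        have hq := hp.prodMk (continuous_snd (X := (G ⧸ cw.typ n i) × Disk n))
        refine ih.comp (f := fun p : ((G ⧸ cw.typ n i) × Disk n) × unitInterval =>
          (cw.char n i (p.1.1, p.1.2.push (1 / 2)), p.2)) hq.continuousOn fun p hp' => ⟨?_, trivial⟩
        exact cw.char_boundary n i _ _ (Disk.norm_push (by norm_num) hp')
      · intro p hp'
        rw [← hp']
        norm_num
  exact this.comp (Continuous.prodMk_left (0 : unitInterval))

lemma height_smul (g : G) (x : X) : φ (g • x) = φ x := by
  refine cw.cell_induction (p := fun x => φ (g • x) = φ x) (fun n i q hq ih => ?_) x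
  rw [← cw.char_smul n i g q.1 q.2, hφ n i (g • q.1, q.2), hφ n i (q.1, q.2)]
  dsimp only
  split_ifs with h1
  · rw [cw.char_smul, ih _ (cw.char_boundary n i _ _ (Disk.norm_push (by norm_num) h1))]
  · rfl

lemma height_nonneg (x : X) : 0 ≤ φ x := by
  refine cw.cell_induction (p := fun x => 0 ≤ φ x) (fun n i q hq ih => ?_) x
  rw [hφ]
  split_ifs with h1
  · have := ih _ (cw.char_boundary n i q.1 _ (Disk.norm_push (by norm_num) h1))
    have h2 : 0 ≤ min 1 (4 * (q.2.norm - 1 / 2)) := le_min zero_le_one (by linarith)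
    have h3 : 0 ≤ min 1 (4 * (1 - q.2.norm)) := le_min zero_le_one (by linarith)
    positivity
  · positivity

include hh

/-- This is what places the pair (time-one image, height) in the telescope. -/
lemma exists_le_height (x : X) : ∃ k : ℕ, (k : ℝ) ≤ φ x ∧ h x 1 ∈ cw.skLT k := by
  refine cw.cell_induction (p := fun x => ∃ k : ℕ, (k : ℝ) ≤ φ x ∧ h x 1 ∈ cw.skLT k)
    (fun n i q hq ih => ?_) x
  have hmem : h (cw.char n i q) 1 ∈ cw.skLT (n + 1) :=
    deformation_mem hh _ (cw.char_mem_skLT_succ i q) 1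
  -- Below 3/4 the height is at least n + 1, and the image stays in X_n, that is, in `skLT (n + 1)`.
  -- From 3/4 on the point goes to the boundary and runs through the full lower deformation, while
  -- the height is at least that of the boundary point, so the index found there is reused.
  rcases lt_or_ge q.2.norm (3 / 4) with hlt | hge
  · refine ⟨n + 1, ?_, hmem⟩
    rw [hφ]
    push_cast
    split_ifs with h1
    · have h2 : 0 ≤ min 1 (4 * (q.2.norm - 1 / 2)) := le_min zero_le_one (by linarith)
      have h3 : min 1 (4 * (1 - q.2.norm)) = 1 := min_eq_left (by linarith)
      rw [h3, mul_one]
      exact le_add_of_nonneg_left (mul_nonneg h2 (height_nonneg hφ _))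
    · exact le_rfl
  · have hc : 1 - ((1 : unitInterval) : ℝ) / 2 = 1 / 2 := by
      change (1 : ℝ) - 1 / 2 = 1 / 2
      norm_num
    have h1 : 1 / 2 ≤ q.2.norm := by linarith
    obtain ⟨k, hk, hk'⟩ := ih _ (cw.char_boundary n i q.1 _ (Disk.norm_push (by norm_num) h1))
    refine ⟨k, ?_, ?_⟩
    · rw [hφ, if_pos h1]
      have h2 : min 1 (4 * (q.2.norm - 1 / 2)) = 1 := min_eq_left (by linarith)
      have h3 : 0 ≤ min 1 (4 * (1 - q.2.norm)) := le_min zero_le_one (by linarith)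
      rw [h2, one_mul]
      have : 0 ≤ ((n : ℝ) + 1) * min 1 (4 * (1 - q.2.norm)) := by positivity
      linarith
    · rw [hh, hc, if_pos h1, pushTime_eq_one hge]
      exact hk'

end Deformation

end GCWStructure

end SmoothBredon

end

/-! ### The telescope, and the vanishing of ℋ_q(X, X_{m-1}) for q < m. -/

noncomputable section

namespace SmoothBredon

lemma isHomeomorph_sigma {ι Y : Type*} {X : ι → Type*} [∀ i, TopologicalSpace (X i)]
    [TopologicalSpace Y] {f : ∀ i, X i → Y} (hf : ∀ i, Topology.IsClosedEmbedding (f i))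
    (hl : LocallyFinite fun i => Set.range (f i))
    (hb : Function.Bijective fun p : Σ i, X i => f p.1 p.2) :
    IsHomeomorph fun p : Σ i, X i => f p.1 p.2 := by
  refine isHomeomorph_iff_continuous_isClosedMap_bijective.2
    ⟨continuous_sigma fun i => (hf i).continuous, fun C hC => ?_, hb⟩
  have e : (fun p : Σ i, X i => f p.1 p.2) '' C = ⋃ i, f i '' (Sigma.mk i ⁻¹' C) := by
    ext y
    rw [Set.mem_iUnion]
    constructor
    · rintro ⟨⟨i, x⟩, hx, rfl⟩
      exact ⟨i, x, hx, rfl⟩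
    · rintro ⟨i, x, hx, rfl⟩
      exact ⟨⟨i, x⟩, hx, rfl⟩
  rw [e]
  exact (hl.subset fun i => Set.image_subset_range _ _).isClosed_iUnion
    fun i => (hf i).isClosedMap _ (hC.preimage continuous_sigmaMk)

variable {G : Type u} [Group G] [TopologicalSpace G]

/-- If a map of pairs is a disjoint union on the first members, and the second members are the
preimages of the second member of the target, then it is a disjoint union on the second members. -/
lemma IsDisjointUnion.bd {ι : Type u} {P : ι → SmoothGCWPair G} {Q : SmoothGCWPair G}
    {f : ∀ i, P i ⟶ Q} (hf : IsDisjointUnion fun i => absMap (f i))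
    (h : ∀ i (x : (P i).X.carrier), (f i).toFun x ∈ Q.A → x ∈ (P i).A) :
    IsDisjointUnion (X := fun i => (P i).X.restrict (P i).A (P i).isSubcomplex)
      (Y := Q.X.restrict Q.A Q.isSubcomplex) fun i => SmoothGCWPair.bd.map (f i) := by
  let F : (Σ i, (P i).X.carrier) → Q.X.carrier := fun p => (f p.1).toFun p.2
  have hF : IsHomeomorph F := hf
  let F' : (Σ i, (P i).A) → Q.A := fun p => ⟨(f p.1).toFun p.2, (f p.1).mapsTo p.2.2⟩
  let v : (Σ i, (P i).A) → Σ i, (P i).X.carrier := Sigma.map id fun i => Subtype.val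
  have hv : Topology.IsClosedEmbedding v := by
    refine Topology.IsClosedEmbedding.of_continuous_injective_isClosedMap
      (continuous_sigma fun i => continuous_sigmaMk.comp continuous_subtype_val) ?_ ?_
    · rintro ⟨i, x⟩ ⟨j, y⟩ hxy
      obtain ⟨rfl, h'⟩ := Sigma.mk.inj hxy
      exact congrArg (Sigma.mk i) (Subtype.ext (eq_of_heq h'))
    · intro C hC
      refine isClosed_sigma_iff.2 fun i => ?_
      convert (P i).isSubcomplex.1.isClosedEmbedding_subtypeVal.isClosedMap _
        (hC.preimage (continuous_sigmaMk (σ := fun i => (P i).A) (i := i))) using 1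
      ext x
      constructor
      · rintro ⟨⟨j, y⟩, hy, hyx⟩
        obtain ⟨rfl, h'⟩ := Sigma.mk.inj hyx
        exact ⟨y, hy, eq_of_heq h'⟩
      · rintro ⟨y, hy, rfl⟩
        exact ⟨⟨i, y⟩, hy, rfl⟩
  have hcomp : Subtype.val ∘ F' = F ∘ v := rfl
  have hcl : Topology.IsClosedEmbedding (Subtype.val ∘ F') := by
    rw [hcomp]
    exact hF.isClosedEmbedding.comp hv
  have hc : Continuous F' := hcl.continuous.subtype_mk fun p => (f p.1).mapsTo p.2.2
  change IsHomeomorph F'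
  refine isHomeomorph_iff_continuous_isClosedMap_bijective.2 ⟨hc, ?_, ?_, ?_⟩
  · exact (Topology.IsClosedEmbedding.of_comp_iff
      Q.isSubcomplex.1.isClosedEmbedding_subtypeVal).1 hcl |>.isClosedMap
  · exact hcl.injective.of_comp
  · intro y
    obtain ⟨⟨i, x⟩, hx⟩ := hF.surjective y.1
    refine ⟨⟨i, x, h i x ?_⟩, Subtype.ext hx⟩
    change F ⟨i, x⟩ ∈ Q.A
    rw [hx]
    exact y.2

/-! ### The telescope of the skeletal filtration -/

namespace SmoothGCW

variable (X : SmoothGCW G)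

/-- The telescope of the skeletal filtration, in `X × ℝ`. -/
def telescope : Set (X.carrier × ℝ) := ⋃ n : ℕ, X.cw.skLT n ×ˢ Set.Ici (n : ℝ)

variable {X} in
lemma mem_telescope {p : X.carrier × ℝ} :
    p ∈ X.telescope ↔ ∃ n : ℕ, p.1 ∈ X.cw.skLT n ∧ (n : ℝ) ≤ p.2 := Set.mem_iUnion

lemma isSubcomplex_telescope : X.line.cw.IsSubcomplex X.telescope := by
  refine GCWStructure.IsSubcomplex.iUnion (cw := X.line.cw) (fun n => ?_) ?_
  · refine (X.cw.isSubcomplex_skLT n).prod isClosed_Ici fun k => ?_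
    by_cases hk : (n : ℤ) ≤ k
    · have : (n : ℝ) ≤ k := by exact_mod_cast hk
      exact Or.inl fun t ht => this.trans ht.1.le
    · refine Or.inr (Set.disjoint_left.2 fun t ht ht' => hk ?_)
      have : (n : ℝ) < (k : ℝ) + 1 := lt_of_le_of_lt ht' ht.2
      have : (n : ℤ) < k + 1 := by exact_mod_cast this
      omega
  · have hl : LocallyFinite fun n : ℕ => Set.Ici (n : ℝ) := by
      intro t
      refine ⟨Set.Iio (t + 1), Iio_mem_nhds (lt_add_one t), ?_⟩
      obtain ⟨k, hk⟩ := exists_nat_ge (t + 1)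
      refine (Set.finite_Iio k).subset ?_
      rintro n ⟨s, hs, hs'⟩
      have : (n : ℝ) < k := lt_of_le_of_lt hs (hs'.trans_le hk)
      exact_mod_cast this
    refine LocallyFinite.isClosed_iUnion ?_ fun n =>
      (X.cw.isClosed_skLT n).prod isClosed_Ici
    refine (hl.preimage_continuous (continuous_snd (X := X.carrier))).subset ?_
    exact fun n p hp => hp.2

/-- The subcomplex `X × ℤ` of `X × ℝ`. -/
lemma isSubcomplex_integers : X.line.cw.IsSubcomplex
    (Set.univ ×ˢ Set.range ((↑) : ℤ → ℝ) : Set (X.carrier × ℝ)) := by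
  refine X.cw.isSubcomplex_univ.prod isClosed_range_intCast_real fun k => Or.inr ?_
  exact Set.disjoint_left.2 fun t ht ht' =>
    GCWStructure.not_mem_range_intCast ht.1 ht.2 ht'

/-- The inclusion of `(X_{n-1}, X_{n-1} ∩ X_{m-1})` in the integral levels of the telescope. -/
def levelMap (m n : ℕ) : relPair (X.cw.isSubcomplex_skLT n) (X.cw.isSubcomplex_skLT m) ⟶
    relPair (X.isSubcomplex_telescope.inter X.isSubcomplex_integers)
      (isSubcomplex_prod_univ (X.cw.isSubcomplex_skLT m)) where
  toFun := fun x : X.cw.skLT n => (⟨(x.1, (n : ℝ)), mem_telescope.2 ⟨n, x.2, le_rfl⟩, trivial,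
    (n : ℤ), Int.cast_natCast n⟩ : (X.telescope ∩ Set.univ ×ˢ Set.range ((↑) : ℤ → ℝ) : Set _))
  continuous_toFun := Continuous.subtype_mk
    ((continuous_subtype_val (p := fun x => x ∈ X.cw.skLT n)).prodMk continuous_const) _
  map_smul _ _ := rfl
  mapsTo := fun _ hx => ⟨hx, trivial⟩

/-- The skeleta increase, so the slice of the telescope at an integer k ≥ 0 is exactly `skLT k`, and
for k < 0 it is empty. The levels are locally finite, hence topologically disjoint. -/
lemma isDisjointUnion_levelMap (m : ℕ) :
    IsDisjointUnion fun n : ULift.{u} ℕ => absMap (X.levelMap m n.down) := by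
  let S : Set (X.carrier × ℝ) := X.telescope ∩ Set.univ ×ˢ Set.range ((↑) : ℤ → ℝ)
  have hS : IsClosed S := (X.isSubcomplex_telescope.inter X.isSubcomplex_integers).1
  let f : ∀ n : ULift.{u} ℕ, X.cw.skLT n.down → S := fun n => (X.levelMap m n.down).toFun
  change IsHomeomorph fun p : Σ n : ULift.{u} ℕ, X.cw.skLT n.down => f p.1 p.2
  have hf : ∀ n x, ((f n x : S) : X.carrier × ℝ) = (x.1, (n.down : ℝ)) := fun _ _ => rfl
  refine isHomeomorph_sigma (fun n => ?_) ?_ ⟨?_, ?_⟩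
  · refine (Topology.IsClosedEmbedding.of_comp_iff hS.isClosedEmbedding_subtypeVal).1 ?_
    refine Topology.IsClosedEmbedding.of_continuous_injective_isClosedMap
      (continuous_subtype_val.prodMk continuous_const) ?_ ?_
    · intro x y h
      exact Subtype.ext (congrArg Prod.fst h)
    · intro C hC
      have h1 := (X.cw.isClosed_skLT n.down).isClosedEmbedding_subtypeVal.isClosedMap _ hC
      convert h1.prod (isClosed_singleton (x := (n.down : ℝ))) using 1
      ext ⟨x, t⟩
      constructor
      · rintro ⟨y, hy, h⟩
        exact ⟨⟨y, hy, congrArg Prod.fst h⟩, (congrArg Prod.snd h).symm⟩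
      · rintro ⟨⟨y, hy, h⟩, h'⟩
        exact ⟨y, hy, Prod.ext h (Eq.symm h')⟩
  · have h1 : LocallyFinite fun n : ULift.{u} ℕ => ({(n.down : ℝ)} : Set ℝ) := by
      intro t
      refine ⟨Set.Iio (t + 1), Iio_mem_nhds (lt_add_one t), ?_⟩
      obtain ⟨k, hk⟩ := exists_nat_ge (t + 1)
      refine ((Set.finite_Iio k).preimage (f := ULift.down) ULift.down_injective.injOn).subset ?_
      rintro n ⟨s, hs, hs'⟩
      obtain rfl : s = n.down := hs
      have : (n.down : ℝ) < k := hs'.trans_le hk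
      exact Nat.cast_lt.1 this
    refine (h1.preimage_continuous (g := fun x : S => x.1.2)
      (continuous_snd.comp continuous_subtype_val)).subset ?_
    rintro n _ ⟨x, rfl⟩
    rfl
  · rintro ⟨⟨n⟩, x⟩ ⟨⟨k⟩, y⟩ h
    have h' : ((x : X.carrier), (n : ℝ)) = (y.1, (k : ℝ)) := congrArg Subtype.val h
    obtain rfl : n = k := Nat.cast_injective (congrArg Prod.snd h')
    have hxy : x = y := Subtype.ext (congrArg Prod.fst h')
    rw [hxy]
  · rintro ⟨⟨x, t⟩, ht, -, k, hk⟩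
    obtain ⟨n, hn, hn'⟩ := mem_telescope.1 ht
    obtain rfl : (k : ℝ) = t := hk
    have hnk' : (n : ℝ) ≤ k := hn'
    have hnk : (n : ℤ) ≤ k := by exact_mod_cast hnk'
    obtain ⟨k, rfl⟩ := Int.eq_ofNat_of_zero_le ((Int.natCast_nonneg n).trans hnk)
    refine ⟨⟨⟨k⟩, x, X.cw.skLT_mono (show n ≤ k by omega) hn⟩, Subtype.ext (Prod.ext rfl ?_)⟩
    exact (Int.cast_natCast (R := ℝ) k).symm

/-- The map from the suspension of the integral levels of the telescope to the telescope,
`((x, k), s) ↦ (x, k + s)`. -/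
def spreadMap (m : ℕ) :
    suspPair (relPair (X.isSubcomplex_telescope.inter X.isSubcomplex_integers)
      (isSubcomplex_prod_univ (X.cw.isSubcomplex_skLT m))) ⟶
    relPair X.isSubcomplex_telescope
      (X.isSubcomplex_integers.union (isSubcomplex_prod_univ (X.cw.isSubcomplex_skLT m))) where
  toFun := fun p : (Set.univ ×ˢ Set.Icc (0 : ℝ) 1 :
      Set ((X.telescope ∩ Set.univ ×ˢ Set.range ((↑) : ℤ → ℝ) : Set (X.carrier × ℝ)) × ℝ)) =>
    (⟨(p.1.1.1.1, p.1.1.1.2 + p.1.2), by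
      obtain ⟨n, hn, hn'⟩ := mem_telescope.1 p.1.1.2.1
      exact mem_telescope.2 ⟨n, hn, le_add_of_le_of_nonneg hn' p.2.2.1⟩⟩ : X.telescope)
  continuous_toFun := by
    have h1 : Continuous fun p : (Set.univ ×ˢ Set.Icc (0 : ℝ) 1 :
        Set ((X.telescope ∩ Set.univ ×ˢ Set.range ((↑) : ℤ → ℝ) : Set (X.carrier × ℝ)) × ℝ)) =>
        p.1.1.1 := continuous_subtype_val.comp continuous_subtype_val.fst
    exact Continuous.subtype_mk (h1.fst.prodMk (h1.snd.add continuous_subtype_val.snd)) _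
  map_smul _ _ := rfl
  mapsTo := fun (p : (Set.univ ×ˢ Set.Icc (0 : ℝ) 1 :
      Set ((X.telescope ∩ Set.univ ×ˢ Set.range ((↑) : ℤ → ℝ) : Set (X.carrier × ℝ)) × ℝ))) hp => by
    obtain ⟨k, hk⟩ := p.1.1.2.2.2
    rcases (mem_suspPair_iff (P := relPair (X.isSubcomplex_telescope.inter X.isSubcomplex_integers)
      (isSubcomplex_prod_univ (X.cw.isSubcomplex_skLT m))) p).1 hp with h | h | h
    · exact Or.inr ⟨h.1, trivial⟩
    · refine Or.inl ⟨trivial, k, ?_⟩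
      change (k : ℝ) = p.1.1.1.2 + p.1.2
      rw [hk, h, add_zero]
    · refine Or.inl ⟨trivial, k + 1, ?_⟩
      change ((k + 1 : ℤ) : ℝ) = p.1.1.1.2 + p.1.2
      rw [Int.cast_add, hk, h, Int.cast_one]

/-- Between the integers k and k + 1 the slices of the telescope do not change, so away from
integral heights the telescope is the product of level k with the open interval. The upper end of
such a slab is glued into the possibly larger level k + 1. -/
lemma isPushout_spreadMap (m : ℕ) : SmoothGCWPair.IsPushout (X.spreadMap m) := by
  let V : Set (X.carrier × ℝ) := X.telescope ∩ Set.univ ×ˢ Set.range ((↑) : ℤ → ℝ)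
  have hV : IsClosed V := (X.isSubcomplex_telescope.inter X.isSubcomplex_integers).1
  let S : Set (V × ℝ) := Set.univ ×ˢ Set.Icc (0 : ℝ) 1
  have hS : IsClosed S := isClosed_univ.prod isClosed_Icc
  let B : Set (X.carrier × ℝ) := Set.univ ×ˢ Set.range ((↑) : ℤ → ℝ) ∪ X.cw.skLT m ×ˢ Set.univ
  let P := relPair (X.isSubcomplex_telescope.inter X.isSubcomplex_integers)
    (isSubcomplex_prod_univ (X.cw.isSubcomplex_skLT m))
  have hmem : ∀ p : S, p ∉ (suspPair P).A →
      p.1.1.1.1 ∉ X.cw.skLT m ∧ 0 < p.1.2 ∧ p.1.2 < 1 := by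
    intro p hp
    have hp' := mt (mem_suspPair_iff (P := P) p).2 hp
    push Not at hp'
    exact ⟨fun h => hp'.1 ⟨h, trivial⟩, lt_of_le_of_ne p.2.2.1 hp'.2.1.symm,
      lt_of_le_of_ne p.2.2.2 hp'.2.2⟩
  -- A point at non-integral height t comes from level ⌊t⌋. That level still contains its first
  -- coordinate, because a natural number n ≤ t satisfies n ≤ ⌊t⌋.
  have hlift : ∀ q : X.telescope, q.1 ∉ B → ∃ k : ℤ, ∃ hk : (q.1.1, (k : ℝ)) ∈ V,
      ∃ hs : q.1.2 - k ∈ Set.Icc (0 : ℝ) 1, (X.spreadMap m).toFun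
        (⟨(⟨_, hk⟩, q.1.2 - k), trivial, hs⟩ : S) = q ∧ 0 < q.1.2 - k ∧ q.1.2 - k < 1 := by
    intro q hq
    obtain ⟨n, hn, hn'⟩ := mem_telescope.1 q.2
    have h1 : (⌊q.1.2⌋ : ℝ) ≤ q.1.2 := Int.floor_le _
    have h2 := Int.lt_floor_add_one q.1.2
    have h3 : (n : ℤ) ≤ ⌊q.1.2⌋ := Int.le_floor.2 (by exact_mod_cast hn')
    have h6 : (n : ℝ) ≤ (⌊q.1.2⌋ : ℝ) := by exact_mod_cast h3
    have h4 : (⌊q.1.2⌋ : ℝ) ≠ q.1.2 := fun h => hq (Or.inl ⟨trivial, _, h⟩)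
    have h5 := lt_of_le_of_ne h1 h4
    refine ⟨⌊q.1.2⌋, ⟨mem_telescope.2 ⟨n, hn, h6⟩, trivial, _, rfl⟩,
      ⟨by linarith, by linarith⟩, Subtype.ext (Prod.ext rfl ?_), by linarith, by linarith⟩
    exact add_sub_cancel _ _
  refine ⟨⟨?_, ?_, ?_⟩, ?_⟩
  · rintro (p : S) hp (h | h)
    · obtain ⟨h1, h2, h3⟩ := hmem p hp
      obtain ⟨k, hk⟩ := p.1.1.2.2.2
      refine GCWStructure.not_mem_range_intCast (k := k) (t := p.1.1.1.2 + p.1.2) ?_ ?_ h.2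
      · rw [hk]; linarith
      · rw [hk]; linarith
    · exact (hmem p hp).1 h.1
  · intro (p : S) hp (q : S) hq h
    have h' : (p.1.1.1.1, p.1.1.1.2 + p.1.2) = (q.1.1.1.1, q.1.1.1.2 + q.1.2) :=
      congrArg (fun z : X.telescope => z.1) h
    obtain ⟨h1, h2⟩ := Prod.mk.inj h'
    obtain ⟨-, h3, h4⟩ := hmem p hp
    obtain ⟨-, h5, h6⟩ := hmem q hq
    obtain ⟨k, hk⟩ := p.1.1.2.2.2
    obtain ⟨l, hl⟩ := q.1.1.2.2.2
    have hkl : k = l := by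
      have h7 : (k : ℝ) < l + 1 := by rw [hk, hl]; linarith
      have h8 : (l : ℝ) < k + 1 := by rw [hk, hl]; linarith
      have h9 : k < l + 1 := by exact_mod_cast h7
      have h10 : l < k + 1 := by exact_mod_cast h8
      omega
    have h11 : p.1.1.1.2 = q.1.1.1.2 := by rw [← hk, ← hl, hkl]
    exact Subtype.ext (Prod.ext (Subtype.ext (Prod.ext h1 h11)) (by linarith))
  · intro (q : X.telescope) hq
    obtain ⟨k, hk, hs, h, h1, h2⟩ := hlift q hq
    refine ⟨_, fun hA => ?_, h⟩
    rcases (mem_suspPair_iff (P := P) _).1 hA with h' | h' | h'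
    · exact hq (Or.inr ⟨h'.1, trivial⟩)
    · exact h1.ne' h'
    · exact h2.ne h'
  · intro (C : Set X.telescope) h1 h2
    have hT := X.isSubcomplex_telescope.1.isClosedEmbedding_subtypeVal
    refine hT.isClosed_iff_image_isClosed.2 ?_
    let E : Set (V × ℝ) := Subtype.val '' ((X.spreadMap m).toFun ⁻¹' C : Set S)
    have hE : IsClosed E := hS.isClosedEmbedding_subtypeVal.isClosedMap _ h2
    let E' : Set ((X.carrier × ℝ) × ℝ) := Prod.map Subtype.val id '' E
    have hE' : IsClosed E' :=
      (hV.isClosedEmbedding_subtypeVal.prodMap Topology.IsClosedEmbedding.id).isClosedMap _ hE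
    -- The part of C reached from level k. Each piece is closed and lies in one slab, so their union
    -- is closed by local finiteness.
    let D : ℤ → Set (X.carrier × ℝ) := fun k => (fun p => ((p.1, (k : ℝ)), p.2 - k)) ⁻¹' E'
    have hD : ∀ k, IsClosed (D k) := fun k => hE'.preimage (by fun_prop)
    have hmemD : ∀ k p, p ∈ D k → p.2 ∈ Set.Icc (k : ℝ) (k + 1) ∧ ∃ z ∈ C, (z : X.carrier × ℝ) = p := by
      rintro k p ⟨_, ⟨s, hs, rfl⟩, hsp⟩
      have e1 : s.1.1.1 = (p.1, (k : ℝ)) := congrArg Prod.fst hsp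
      have e2 : s.1.2 = p.2 - k := congrArg Prod.snd hsp
      have e3 := s.2.2
      rw [e2] at e3
      have e4 : s.1.1.1.1 = p.1 := by rw [e1]
      refine ⟨⟨by linarith [e3.1], by linarith [e3.2]⟩, _, hs, ?_⟩
      refine Prod.ext e4 ?_
      change s.1.1.1.2 + s.1.2 = p.2
      rw [e1, e2, add_sub_cancel]
    have key : Subtype.val '' C = Subtype.val '' (C ∩ Subtype.val ⁻¹' B) ∪ ⋃ k, D k := by
      ext p
      constructor
      · rintro ⟨z, hz, rfl⟩
        by_cases hB : z.1 ∈ B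
        · exact Or.inl ⟨z, ⟨hz, hB⟩, rfl⟩
        · obtain ⟨k, hk, hs, h, -, -⟩ := hlift z hB
          refine Or.inr (Set.mem_iUnion.2 ⟨k, (⟨_, hk⟩, z.1.2 - k),
            ⟨⟨(⟨_, hk⟩, z.1.2 - k), trivial, hs⟩, ?_, rfl⟩, rfl⟩)
          exact (iff_of_eq (congrArg (fun w => w ∈ C) h)).2 hz
      · rintro (⟨z, hz, rfl⟩ | hp)
        · exact ⟨z, hz.1, rfl⟩
        · obtain ⟨k, hk⟩ := Set.mem_iUnion.1 hp
          obtain ⟨-, z, hz, hzp⟩ := hmemD k p hk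
          exact ⟨z, hz, hzp⟩
    refine (congrArg IsClosed key).mpr ((hT.isClosedMap _ h1).union ?_)
    exact isClosed_iUnion_slab hD fun k p hp => ⟨trivial, (hmemD k p hp).1⟩

end SmoothGCW

namespace SmoothGHomologyTheory

variable [IsTopologicalGroup G] {ℋ : SmoothGHomologyTheory G} {X : SmoothGCW G}

/-- A triple inserts the integral levels between X_{m-1} × ℝ and T. The first pair is, by excision,
a disjoint union of pairs of skeleta; the second is the suspension of that union and so needs its
vanishing one degree lower. -/
lemma Connective.vanish_telescope (h : ℋ.Connective X) {m : ℕ} {q : ℤ} (hq : q < m) :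
    ℋ.Vanish q (relPair X.isSubcomplex_telescope
      (isSubcomplex_prod_univ (X.cw.isSubcomplex_skLT m))) := by
  have hT := X.isSubcomplex_telescope
  have hZ := X.isSubcomplex_integers
  have hA := isSubcomplex_prod_univ (X.cw.isSubcomplex_skLT m)
  have key : ∀ q : ℤ, q < m → ℋ.Vanish q (relPair (hT.inter hZ) hA) := by
    intro q hq
    obtain ⟨q, rfl⟩ : ∃ q', q = q' + 1 := ⟨q - 1, by ring⟩
    have hd := X.isDisjointUnion_levelMap m
    exact Vanish.of_relative_disjointUnion hd (hd.bd fun n x hx => hx.1)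
      fun n => h.vanish_skeleta hq n.down
  obtain ⟨q, rfl⟩ : ∃ q', q = q' + 1 := ⟨q - 1, by ring⟩
  refine Vanish.triple_middle hT hA (hZ.union hA) Set.subset_union_right ?_ ?_
  · refine (key _ hq).of_isPushout (isPushout_relMap _ _ _ ?_ ?_)
    · exact fun p hp => ⟨hp.1, Or.inl hp.2⟩
    · rintro p ⟨hp, hp' | hp'⟩
      · exact Or.inl ⟨hp, hp'⟩
      · exact Or.inr hp'
  · exact (key q (by omega)).suspPair.of_isPushout (X.isPushout_spreadMap m)

/-- The pair `(X, X_{m-1})` has no homology in degrees less than `m`. -/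
lemma Connective.vanish_skLT (h : ℋ.Connective X) {m : ℕ} {q : ℤ} (hq : q < m) :
    ℋ.Vanish q ⟨X, X.cw.skLT m, X.cw.isSubcomplex_skLT m⟩ := by
  obtain ⟨r, hr⟩ := X.cw.exists_deformation
  obtain ⟨φ, hφ⟩ := X.cw.exists_height
  have hrc := GCWStructure.continuous_deformation hr
  -- The section is x ↦ (r(x, 1), φ(x)) and the retraction is the projection to X. Their composite
  -- is the end of the deformation, which preserves X_{m-1} at every time.
  refine Vanish.of_retract (Q := relPair X.isSubcomplex_telescope
      (isSubcomplex_prod_univ (X.cw.isSubcomplex_skLT m)))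
    { toFun := fun x => (⟨(r x 1, φ x), SmoothGCW.mem_telescope.2 ?_⟩ : X.telescope)
      continuous_toFun := Continuous.subtype_mk ((hrc.comp
        (continuous_id.prodMk continuous_const)).prodMk (GCWStructure.continuous_height hφ)) _
      map_smul := fun g x => Subtype.ext (Prod.ext (GCWStructure.deformation_smul hr g x 1)
        (GCWStructure.height_smul hφ g x))
      mapsTo := fun x hx => ⟨GCWStructure.deformation_mem hr x hx 1, trivial⟩ }
    { toFun := fun x : X.telescope => x.1.1
      continuous_toFun := continuous_subtype_val.fst
      map_smul := fun _ _ => rfl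
      mapsTo := fun x hx => hx.1 } ?_ (h.vanish_telescope hq)
  · obtain ⟨k, hk, hk'⟩ := GCWStructure.exists_le_height hr hφ x
    exact ⟨k, hk', hk⟩
  -- Time is reversed because the homotopy has to run from the composite to the identity.
  · refine ⟨fun p => r p.1 (unitInterval.symm p.2), ?_, ?_, ?_, ?_, ?_⟩
    · exact hrc.comp (continuous_fst.prodMk (unitInterval.continuous_symm.comp continuous_snd))
    · exact fun g x t => GCWStructure.deformation_smul hr g x _
    · exact fun x t hx => GCWStructure.deformation_mem hr x hx _
    · intro x
      change r x (unitInterval.symm 0) = r x 1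
      rw [unitInterval.symm_zero]
    · intro x
      change r x (unitInterval.symm 1) = x
      rw [unitInterval.symm_one, GCWStructure.deformation_zero hr]

end SmoothGHomologyTheory

end SmoothBredon

end

/-! ### The edge homomorphism is an isomorphism. -/

noncomputable section

namespace SmoothBredon

variable {G : Type u} [Group G] [TopologicalSpace G]

/-! ### The edge homomorphism -/

namespace SmoothGHomologyTheory

variable {ℋ : SmoothGHomologyTheory G} {X : SmoothGCW G}

section

variable (ℋ X)

lemma toETwo_surjective (q : ℤ) : Function.Surjective (ℋ.toETwo X q) :=
  (AddCommGrpCat.epi_iff_surjective _).1 (inferInstanceAs (Epi (cokernel.π (ℋ.dOne X q))))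

lemma edge_toETwo (q : ℤ) (z : ℋ.abs q (X.skel 0)) :
    ℋ.edge X q (ℋ.toETwo X q z) = (ℋ.H q).map (X.skelIncl 0) z :=
  ConcreteCategory.congr_hom (cokernel.π_desc (ℋ.dOne X q) _ (ℋ.dOne_comp X q)) z

lemma toETwo_eq_zero {q : ℤ} {z : ℋ.abs q (X.skel 0)} (h : ∃ w, ℋ.dOne X q w = z) :
    ℋ.toETwo X q z = 0 := by
  obtain ⟨w, rfl⟩ := h
  exact ConcreteCategory.congr_hom (cokernel.condition (ℋ.dOne X q)) w

end

/-- This mediates between (X, X_{-1}) and (X, ∅), whose second members are equal by an axiom but not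
by definition. -/
lemma vanish_toPair {q : ℤ} {A : Set X.carrier} {hA : X.cw.IsSubcomplex A} (h : A = ∅)
    (hv : ℋ.Vanish q ⟨X, A, hA⟩) : ℋ.Vanish q X.toPair := by
  subst h
  exact hv

variable [IsTopologicalGroup G]

lemma Connective.vanish (h : ℋ.Connective X) {q : ℤ} (hq : q < 0) : ℋ.Vanish q X.toPair :=
  vanish_toPair X.cw.skLT_zero (h.vanish_skLT (m := 0) (by exact_mod_cast hq))

lemma Connective.vanish_pair {P : SmoothGCWPair G} (h : ℋ.Connective P.X) {q : ℤ} (hq : q < 0) :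
    ℋ.Vanish q P := by
  obtain ⟨q, rfl⟩ : ∃ q', q = q' + 1 := ⟨q - 1, by ring⟩
  -- The cells of a subcomplex are among those of the complex, so the absolute case covers both
  -- terms next to ℋ_q(X, A) in the long exact sequence.
  have h' : ℋ.Connective (P.X.restrict P.A P.isSubcomplex) := fun n i => h n i.1
  exact vanish_of_abs (h.vanish hq) (h'.vanish (by omega))

lemma Connective.skelIncl_surjective (h : ℋ.Connective X) :
    Function.Surjective ((ℋ.H 0).map (X.skelIncl 0)) := by
  intro y
  exact (ℋ.exact_abs 0 ⟨X, X.cw.skLT 1, X.cw.isSubcomplex_skLT 1⟩ y).1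
    (h.vanish_skLT (m := 1) (by norm_num) _)

/-- As ℋ_1(X, X_1) = 0, the map ℋ_0(X_1) → ℋ_0(X) is injective. So z already dies in ℋ_0(X_1) and is
a boundary of the pair (X_1, X_0). -/
lemma Connective.exists_dOne (h : ℋ.Connective X) {z : ℋ.abs 0 (X.skel 0)}
    (hz : (ℋ.H 0).map (X.skelIncl 0) z = 0) : ∃ w, ℋ.dOne X 0 w = z := by
  let P : SmoothGCWPair G := ⟨X, X.cw.skLT 2, X.cw.isSubcomplex_skLT 2⟩
  let j : (X.skel 0).toPair ⟶ SmoothGCWPair.bd.obj X.skelPair :=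
    { toFun := fun x : X.cw.skLT 1 => (⟨⟨x.1, X.cw.skLT_subset 1 x.2⟩, x.2⟩ :
        (X.skel 1).cw.skLT 1)
      continuous_toFun := Continuous.subtype_mk (Continuous.subtype_mk
        (continuous_subtype_val (p := fun x => x ∈ X.cw.skLT 1)) _) _
      map_smul := fun _ _ => rfl
      mapsTo := fun _ h => h.elim }
  have h1 : (ℋ.H 0).map P.bdIncl
      ((ℋ.H 0).map X.skelPair.bdIncl ((ℋ.H 0).map j z)) = 0 := by
    refine (congrArg _ (ℋ.map_comp_apply 0 j X.skelPair.bdIncl z).symm).trans ?_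
    exact (ℋ.map_comp_apply 0 (j ≫ X.skelPair.bdIncl) P.bdIncl z).symm.trans hz
  obtain ⟨w, hw⟩ := (ℋ.exact_bd 0 P _).1 h1
  have h2 : (ℋ.H 0).map X.skelPair.bdIncl ((ℋ.H 0).map j z) = 0 := by
    rw [← hw]
    have := h.vanish_skLT (m := 2) (q := 0 + 1) (by norm_num) w
    exact (congrArg _ this).trans (map_zero _)
  obtain ⟨v, hv⟩ := (ℋ.exact_bd 0 X.skelPair _).1 h2
  refine ⟨v, ?_⟩
  change (ℋ.H 0).map X.skelZeroMap ((ℋ.boundary 0).app X.skelPair v) = z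
  rw [hv]
  exact ℋ.map_map_of_comp_eq_id 0 (f := j) (g := X.skelZeroMap) rfl z

lemma Connective.isIso_edge (h : ℋ.Connective X) : IsIso (ℋ.edge X 0) := by
  refine (ConcreteCategory.isIso_iff_bijective _).2 ⟨?_, ?_⟩
  · rw [injective_iff_map_eq_zero]
    intro y hy
    obtain ⟨z, rfl⟩ := ℋ.toETwo_surjective X 0 y
    rw [edge_toETwo] at hy
    exact ℋ.toETwo_eq_zero X (h.exists_dOne hy)
  · intro y
    obtain ⟨z, rfl⟩ := h.skelIncl_surjective y
    exact ⟨ℋ.toETwo X 0 z, ℋ.edge_toETwo X 0 z⟩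

/-- Homomorphisms on `ℋ_0(X)` are homomorphisms on `ℋ_0(X_0)` which vanish on boundaries. -/
lemma Connective.exists_hom (h : ℋ.Connective X) {B : Type*} [AddCommGroup B]
    (φ : ℋ.abs 0 (X.skel 0) →+ B) (hφ : ∀ w, φ (ℋ.dOne X 0 w) = 0) :
    ∃ Φ : ℋ.abs 0 X →+ B, ∀ z, Φ ((ℋ.H 0).map (X.skelIncl 0) z) = φ z := by
  have hk : ((ℋ.H 0).map (X.skelIncl 0)).hom.ker ≤ φ.ker := by
    intro z hz
    obtain ⟨w, rfl⟩ := h.exists_dOne hz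
    exact hφ w
  refine ⟨((ℋ.H 0).map (X.skelIncl 0)).hom.liftOfSurjective h.skelIncl_surjective ⟨φ, hk⟩,
    fun z => ?_⟩
  exact AddMonoidHom.liftOfRightInverse_comp_apply _ _ _ ⟨φ, hk⟩ z

end SmoothGHomologyTheory

/-! ### Cells of dimension zero and one -/

namespace SmoothGCW

variable (X : SmoothGCW G)

lemma discreteTopology_skel_zero [IsTopologicalGroup G] :
    DiscreteTopology (X.cw.skLT 1) := by
  have hd := fun i => QuotientGroup.discreteTopology (X.isOpen_typ (n := 0) i)
  have : Subsingleton (Disk 0) := ⟨fun a b => Subtype.ext (Subsingleton.elim _ _)⟩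
  refine discreteTopology_iff_forall_isClosed.2 fun C => ?_
  refine (X.cw.isClosed_skLT 1).isClosedEmbedding_subtypeVal.isClosed_iff_image_isClosed.2 ?_
  refine X.cw.isClosed_of_char 0 _ ?_ ?_ fun i => ?_
  · rintro _ ⟨x, -, rfl⟩
    exact x.2
  · rw [X.cw.skLT_zero, Set.inter_empty]
    exact isClosed_empty
  · exact isClosed_discrete _

end SmoothGCW

end SmoothBredon

end

/-! ### Vertices, 1-cells and the first differential. -/

noncomputable section

namespace SmoothBredon

variable {G : Type u} [Group G] [TopologicalSpace G]

/-! ### The value of a homology theory on the zero skeleton -/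

lemma isHomeomorph_of_discrete {Y Z : Type*} [TopologicalSpace Y] [TopologicalSpace Z]
    [DiscreteTopology Y] [DiscreteTopology Z] {f : Y → Z} (hf : Function.Bijective f) :
    IsHomeomorph f :=
  ⟨continuous_of_discreteTopology, fun _ _ => isOpen_discrete _, hf⟩

/-- The base point of an orbit. -/
def basePoint {G : Type u} [Group G] (H : Subgroup G) : MulAction.fixedPoints H (G ⧸ H) :=
  ⟨((1 : G) : G ⧸ H), fun h => by
    change ((h * 1 : G) : G ⧸ H) = ((1 : G) : G ⧸ H)
    rw [QuotientGroup.eq]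
    simp⟩

namespace SmoothGCW

variable (X : SmoothGCW G)

/-- The point `Q_i(H_i, d)` of the cell `i`. -/
def cellPoint {n : ℕ} (i : X.cw.cell n) (d : Disk n) :
    MulAction.fixedPoints (X.cw.typ n i) X.carrier :=
  ⟨X.cw.char n i (((1 : G) : G ⧸ X.cw.typ n i), d), fun h => by
    change (h : G) • X.cw.char n i _ = _
    rw [← X.cw.char_smul]
    exact congrArg (fun a => X.cw.char n i (a, d)) ((basePoint (X.cw.typ n i)).2 h)⟩

lemma orbitMap_cellPoint {n : ℕ} (i : X.cw.cell n) (d : Disk n) (a : G ⧸ X.cw.typ n i) :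
    orbitMap (X.cellPoint i d) a = X.cw.char n i (a, d) := by
  obtain ⟨g, rfl⟩ := QuotientGroup.mk_surjective a
  rw [orbitMap_mk]
  change g • X.cw.char n i _ = _
  rw [← X.cw.char_smul]
  exact congrArg (fun a => X.cw.char n i (a, d)) (congrArg (QuotientGroup.mk) (mul_one g))

/-- A point of `X_n`, fixed by `H`, as a fixed point in the skeleton. -/
def skelPoint {n : ℕ} {H : Subgroup G} (x : MulAction.fixedPoints H X.carrier)
    (hx : (x : X.carrier) ∈ X.cw.skLT (n + 1)) : MulAction.fixedPoints H (X.skel n).carrier :=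
  ⟨(⟨x, hx⟩ : X.cw.skLT (n + 1)), fun h => Subtype.ext (x.2 h)⟩

variable [IsTopologicalGroup G]

/-- The inclusion of an orbit of vertices. -/
def vertexMap (i : X.cw.cell 0) : (orbit (X.cw.typ 0 i) (X.isOpen_typ i)).toPair ⟶
    (X.skel 0).toPair :=
  pointMap (X.skel 0) (X.isOpen_typ i)
    (X.skelPoint (X.cellPoint i (center 0)) (X.cw.char_mem_skLT_succ i _))

lemma vertexMap_apply (i : X.cw.cell 0) (a : G ⧸ X.cw.typ 0 i) :
    ((X.vertexMap i).toFun a : X.cw.skLT 1).1 = X.cw.char 0 i (a, center 0) := by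
  obtain ⟨g, rfl⟩ := QuotientGroup.mk_surjective a
  exact X.orbitMap_cellPoint i (center 0) (g : G ⧸ X.cw.typ 0 i)

lemma isDisjointUnion_vertexMap : IsDisjointUnion X.vertexMap := by
  have hd := fun i => QuotientGroup.discreteTopology (X.isOpen_typ (n := 0) i)
  have := X.discreteTopology_skel_zero
  let f : (Σ i : X.cw.cell 0, G ⧸ X.cw.typ 0 i) → X.cw.skLT 1 := fun p => (X.vertexMap p.1).toFun p.2
  have hf : ∀ p, (f p : X.carrier) = X.cw.char 0 p.1 (p.2, center 0) :=
    fun p => X.vertexMap_apply p.1 p.2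
  change IsHomeomorph f
  refine isHomeomorph_of_discrete ⟨fun p q h => ?_, fun z => ?_⟩
  · have h' : X.cw.char 0 p.1 (p.2, center 0) = X.cw.char 0 q.1 (q.2, center 0) := by
      rw [← hf, ← hf, h]
    obtain ⟨i, a⟩ := p
    obtain ⟨j, b⟩ := q
    have h2 := X.cw.char_injective (p := (a, center 0)) (q := (b, center 0)) (norm_center 0)
      (norm_center 0) h'
    obtain ⟨rfl, h3⟩ := Sigma.mk.inj h2
    have h4 : a = b := (Prod.mk.inj (eq_of_heq h3)).1
    rw [h4]
  · rcases X.cw.mem_skLT_or_exists z.2 with h | ⟨i, ⟨a, d⟩, hp, h⟩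
    · rw [X.cw.skLT_zero] at h
      exact h.elim
    · refine ⟨⟨i, a⟩, Subtype.ext ((hf _).trans (Eq.trans ?_ h))⟩
      have : d = center 0 := Subtype.ext (Subsingleton.elim _ _)
      rw [this]

end SmoothGCW

/-! ### The one-dimensional cells -/

/-- Finiteness makes S^0 discrete, so the boundary of the 1-cells is a disjoint union of orbits and
the disjoint union axiom applies to it. -/
lemma finite_sphere_one : Finite {d : Disk 1 // d.norm = 1} := by
  have h : ∀ d : Disk 1, d.norm = 1 →
      (d : EuclideanSpace ℝ (Fin 1)) 0 = 1 ∨ (d : EuclideanSpace ℝ (Fin 1)) 0 = -1 := by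
    intro d hd
    have h1 : ‖(d : EuclideanSpace ℝ (Fin 1)) 0‖ = 1 := by
      refine Eq.trans ?_ hd
      unfold Disk.norm
      rw [EuclideanSpace.norm_eq, Fin.sum_univ_one, Real.sqrt_sq (norm_nonneg _)]
    exact (abs_eq zero_le_one).1 h1
  refine Finite.of_injective (β := ({1, -1} : Set ℝ))
    (fun d => ⟨(d.1 : EuclideanSpace ℝ (Fin 1)) 0, h d.1 d.2⟩) fun d d' hd => ?_
  refine Subtype.ext (Subtype.ext (PiLp.ext fun i => ?_))
  rw [Subsingleton.elim i 0]
  exact congrArg Subtype.val hd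

lemma exists_norm_eq_one (n : ℕ) : ∃ d : Disk (n + 1), d.norm = 1 :=
  ⟨⟨EuclideanSpace.single 0 1, by simp⟩, by simp [Disk.norm]⟩

namespace CellPair

variable {ι : Type u} {H : ι → Subgroup G}

lemma discreteTopology_boundary (E : CellPair H 1) (hH : ∀ i, IsOpen (H i : Set G)) [IsTopologicalGroup G] :
    DiscreteTopology E.P.A := by
  have := discreteTopology_orbitSum H hH
  have := finite_sphere_one
  have hc : Continuous fun x : E.P.A => E.e.symm x := E.e.symm.continuous.comp continuous_subtype_val
  have hn : ∀ x : E.P.A, (E.e.symm x).2.2.norm = 1 := fun x =>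
    le_antisymm (Disk.norm_le_one _) (not_lt.1 ((E.mem_iff' _).1 x.2))
  have h1 : Continuous fun p : Σ i, (G ⧸ H i) × Disk 1 =>
      ((⟨p.1, p.2.1⟩ : Σ i, G ⧸ H i), p.2.2) := continuous_sigma fun i =>
    ((continuous_sigmaMk (σ := fun i => G ⧸ H i) (i := i)).comp continuous_fst).prodMk
      continuous_snd
  refine DiscreteTopology.of_continuous_injective
    (β := (Σ i, G ⧸ H i) × {d : Disk 1 // d.norm = 1})
    (f := fun x => (⟨(E.e.symm x).1, (E.e.symm x).2.1⟩, ⟨(E.e.symm x).2.2, hn x⟩)) ?_ ?_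
  · exact (h1.comp hc).fst.prodMk ((h1.comp hc).snd.subtype_mk _)
  · intro x y hxy
    refine Subtype.ext (E.e.symm.injective ?_)
    obtain ⟨h1, h2⟩ := Prod.mk.inj hxy
    obtain ⟨h3, h4⟩ := Sigma.mk.inj h1
    refine Sigma.ext h3 ?_
    have h5 : (E.e.symm x).2.2 = (E.e.symm y).2.2 := congrArg Subtype.val h2
    clear h1 h2 hxy
    generalize (E.e.symm x) = p at h3 h4 h5 ⊢
    generalize (E.e.symm y) = q at h3 h4 h5 ⊢
    obtain ⟨i, a, d⟩ := p
    obtain ⟨j, b, e⟩ := q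
    obtain rfl : i = j := h3
    exact heq_of_eq (Prod.ext (eq_of_heq h4) h5)

/-- The inclusion of an orbit of boundary points. -/
def boundaryMap (E : CellPair H 1) [IsTopologicalGroup G] (hH : ∀ i, IsOpen (H i : Set G)) (i : ι)
    (d : {d : Disk 1 // d.norm = 1}) :
    (orbit (H i) (hH i)).toPair ⟶ SmoothGCWPair.bd.obj E.P where
  toFun := fun a : G ⧸ H i => (⟨E.e ⟨i, (a, d.1)⟩, (E.mem_iff _).2 d.2.not_lt⟩ : E.P.A)
  continuous_toFun := Continuous.subtype_mk (E.e.continuous.comp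
    ((continuous_sigmaMk (σ := fun i => (G ⧸ H i) × Disk 1) (i := i)).comp
      (continuous_id.prodMk continuous_const))) _
  map_smul g a := Subtype.ext (E.e_smul g i a d)
  mapsTo _ h := h.elim

lemma isDisjointUnion_boundaryMap (E : CellPair H 1) [IsTopologicalGroup G]
    (hH : ∀ i, IsOpen (H i : Set G)) : IsDisjointUnion
      (ι := ι × ULift.{u} {d : Disk 1 // d.norm = 1}) (X := fun p => orbit (H p.1) (hH p.1))
      (Y := E.P.X.restrict E.P.A E.P.isSubcomplex) fun p => E.boundaryMap hH p.1 p.2.down := by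
  have := E.discreteTopology_boundary hH
  have hd := fun i => QuotientGroup.discreteTopology (hH i)
  let f : (Σ p : ι × ULift.{u} {d : Disk 1 // d.norm = 1}, G ⧸ H p.1) → E.P.A :=
    fun p => (E.boundaryMap hH p.1.1 p.1.2.down).toFun p.2
  change IsHomeomorph f
  refine isHomeomorph_of_discrete ⟨?_, ?_⟩
  · rintro ⟨⟨i, ⟨d⟩⟩, a⟩ ⟨⟨j, ⟨d'⟩⟩, b⟩ h
    have h' := E.e.injective (congrArg Subtype.val h)
    obtain ⟨h1, h2⟩ := Sigma.mk.inj h'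
    subst h1
    obtain ⟨h3, h4⟩ := Prod.mk.inj (eq_of_heq h2)
    subst h3
    obtain rfl := Subtype.ext h4
    rfl
  · rintro ⟨x, hx⟩
    obtain ⟨⟨i, a, d⟩, rfl⟩ := E.e.surjective x
    have hd : d.norm = 1 :=
      le_antisymm (Disk.norm_le_one d) (not_lt.1 ((E.mem_iff ⟨i, a, d⟩).1 hx))
    exact ⟨⟨(i, ⟨d, hd⟩), a⟩, rfl⟩

/-- The projection of a disjoint union of equivariant cells to the disjoint union of orbits. -/
def toOrbitSum {n : ℕ} (E : CellPair H n) [IsTopologicalGroup G] (hH : ∀ i, IsOpen (H i : Set G)) :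
    E.P.X.toPair ⟶ (orbitSum H hH).toPair where
  toFun := fun x => (⟨(E.e.symm x).1, (E.e.symm x).2.1⟩ : Σ i, G ⧸ H i)
  continuous_toFun := by
    have h1 : Continuous fun p : Σ i, (G ⧸ H i) × Disk n => (⟨p.1, p.2.1⟩ : Σ i, G ⧸ H i) :=
      continuous_sigma fun i =>
        (continuous_sigmaMk (σ := fun i => G ⧸ H i) (i := i)).comp continuous_fst
    exact h1.comp E.e.symm.continuous
  map_smul g x := by
    exact congrArg (fun p : Σ i, (G ⧸ H i) × Disk n => (⟨p.1, p.2.1⟩ : Σ i, G ⧸ H i))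
      (E.symm_smul g x)
  mapsTo _ h := h.elim

end CellPair

namespace SmoothGHomologyTheory

variable [IsTopologicalGroup G] {ℋ : SmoothGHomologyTheory G} {X : SmoothGCW G}

/-- A homomorphism on `ℋ_0(X_0)` which takes the same values at both ends of every `1`-cell
vanishes on boundaries. -/
lemma hom_dOne_eq_zero {B : Type*} [AddCommGroup B] (φ : ℋ.abs 0 (X.skel 0) →+ B)
    (hφ : ∀ (i : X.cw.cell 1) (d d' : Disk 1) (hd : d.norm = 1) (hd' : d'.norm = 1)
      (m : ℋ.abs 0 (orbit (X.cw.typ 1 i) (X.isOpen_typ i))),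
      φ ((ℋ.H 0).map (pointMap (X.skel 0) (X.isOpen_typ i)
        (X.skelPoint (X.cellPoint i d) (X.cw.char_boundary 1 i _ d hd))) m) =
      φ ((ℋ.H 0).map (pointMap (X.skel 0) (X.isOpen_typ i)
        (X.skelPoint (X.cellPoint i d') (X.cw.char_boundary 1 i _ d' hd'))) m))
    (w : (ℋ.H (0 + 1)).obj X.skelPair) : φ (ℋ.dOne X 0 w) = 0 := by
  have hH := fun i => X.isOpen_typ (n := 1) i
  obtain ⟨E⟩ : Nonempty (CellPair (X.cw.typ 1) 1) := ⟨(CellPair.zero hH).succ⟩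
  obtain ⟨d₀, hd₀⟩ := exists_norm_eq_one 0
  obtain ⟨v, rfl⟩ := (ℋ.bijective_of_isPushout (0 + 1) (X.isPushout_attach E)).2 w
  -- Evaluation of φ at the chosen end `d₀` defines Ψ on the disjoint union of the orbits of
  -- 1-cells.
  obtain ⟨Ψ, hΨ⟩ := exists_hom_disjointUnion (ℋ := ℋ) (q := 0)
    (isDisjointUnion_orbitSum (X.cw.typ 1) hH) fun i =>
      φ.comp ((ℋ.H 0).map (pointMap (X.skel 0) (X.isOpen_typ i)
        (X.skelPoint (X.cellPoint i d₀) (X.cw.char_boundary 1 i _ d₀ hd₀)))).hom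
  let r := SmoothGCWPair.bd.map (X.attach E) ≫ X.skelZeroMap
  -- Since φ takes the same value at both ends, on the boundary of the cells it factors through the
  -- projection to the orbits.
  have key : ∀ b : (ℋ.H 0).obj (SmoothGCWPair.bd.obj E.P),
      φ ((ℋ.H 0).map r b) = Ψ ((ℋ.H 0).map (E.P.bdIncl ≫ E.toOrbitSum hH) b) := by
    intro b
    let Φ₁ : ℋ.abs 0 (E.P.X.restrict E.P.A E.P.isSubcomplex) →+ B := φ.comp ((ℋ.H 0).map r).hom
    let Φ₂ : ℋ.abs 0 (E.P.X.restrict E.P.A E.P.isSubcomplex) →+ B :=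
      Ψ.comp ((ℋ.H 0).map (E.P.bdIncl ≫ E.toOrbitSum hH)).hom
    refine induction_disjointUnion (E.isDisjointUnion_boundaryMap hH) (q := 0)
      (p := fun b => Φ₁ b = Φ₂ b) ?_ ?_ ?_ b
    · rw [map_zero, map_zero]
    · intro a b ha hb
      rw [map_add, map_add, ha, hb]
    · rintro ⟨i, ⟨d, hd⟩⟩ m
      have e1 : E.boundaryMap hH i ⟨d, hd⟩ ≫ r = pointMap (X.skel 0) (X.isOpen_typ i)
          (X.skelPoint (X.cellPoint i d) (X.cw.char_boundary 1 i _ d hd)) := by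
        refine SmoothGCWPair.Hom.ext (funext fun a => Subtype.ext ?_)
        obtain ⟨g, rfl⟩ := QuotientGroup.mk_surjective a
        refine Eq.trans ?_ (X.orbitMap_cellPoint i d (g : G ⧸ X.cw.typ 1 i)).symm
        change X.cw.char 1 (E.e.symm (E.e ⟨i, (g, d)⟩)).1 (E.e.symm (E.e ⟨i, (g, d)⟩)).2 = _
        rw [E.e.symm_apply_apply]
      have e2 : E.boundaryMap hH i ⟨d, hd⟩ ≫ E.P.bdIncl ≫ E.toOrbitSum hH =
          orbitSumIncl (X.cw.typ 1) hH i := by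
        refine SmoothGCWPair.Hom.ext (funext fun (a : G ⧸ X.cw.typ 1 i) => ?_)
        change (⟨(E.e.symm (E.e ⟨i, (a, d)⟩)).1, (E.e.symm (E.e ⟨i, (a, d)⟩)).2.1⟩ :
          Σ i, G ⧸ X.cw.typ 1 i) = ⟨i, a⟩
        rw [E.e.symm_apply_apply]
      have e3 : (ℋ.H 0).map r ((ℋ.H 0).map (E.boundaryMap hH i ⟨d, hd⟩) m) = _ :=
        (ℋ.map_comp_apply 0 _ _ m).symm.trans (by rw [e1])
      have e4 : (ℋ.H 0).map (E.P.bdIncl ≫ E.toOrbitSum hH)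
          ((ℋ.H 0).map (E.boundaryMap hH i ⟨d, hd⟩) m) = _ :=
        (ℋ.map_comp_apply 0 _ _ m).symm.trans (by rw [e2])
      exact (congrArg φ e3).trans ((hφ i d d₀ hd hd₀ m).trans
        ((hΨ i m).symm.trans (congrArg Ψ e4).symm))
  have e5 : ℋ.dOne X 0 ((ℋ.H (0 + 1)).map (X.attach E) v) =
      (ℋ.H 0).map r ((ℋ.boundary 0).app E.P v) := by
    refine Eq.trans ?_ (ℋ.map_comp_apply 0 (SmoothGCWPair.bd.map (X.attach E)) X.skelZeroMap _).symm
    exact congrArg ((ℋ.H 0).map X.skelZeroMap) (ℋ.boundary_map 0 (X.attach E) v)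
  -- The projection to the orbits extends over the whole cells, so it annihilates classes in the
  -- image of the boundary map.
  have e6 : (ℋ.H 0).map (E.P.bdIncl ≫ E.toOrbitSum hH) ((ℋ.boundary 0).app E.P v) = 0 := by
    refine (ℋ.map_comp_apply 0 _ _ _).trans ?_
    exact (congrArg _ ((ℋ.exact_bd 0 E.P).apply_apply_eq_zero v)).trans (map_zero _)
  exact (congrArg φ e5).trans ((key _).trans ((congrArg Ψ e6).trans (map_zero Ψ)))

end SmoothGHomologyTheory

end SmoothBredon

end

/-! ### A presentation of ℋ_0(X) by points of X_0. -/

noncomputable section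

namespace SmoothBredon

variable {G : Type u} [Group G] [TopologicalSpace G]

/-! ### Homology classes given by points -/

section

variable [IsTopologicalGroup G] {X : SmoothGCW G} {F : OpenFamily G}

lemma orbitFunctor_map_pointMap {a b : OrbitCat F} (g : G) (hg : ∀ h ∈ a.H, g * h * g⁻¹ ∈ b.H)
    (x : MulAction.fixedPoints b.H X.carrier) :
    (orbitFunctor F).map (OrbitCat.homMk g hg : a ⟶ b) ≫ pointMap X (F.isOpen b.H b.mem) x =
      pointMap X (F.isOpen a.H a.mem) (fixedMap X g hg x) := by
  refine SmoothGCWPair.Hom.ext (funext fun (z : G ⧸ a.H) => ?_)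
  obtain ⟨y, rfl⟩ := QuotientGroup.mk_surjective z
  change (y * g⁻¹) • (x : X.carrier) = y • g⁻¹ • (x : X.carrier)
  rw [mul_smul]

lemma pointMap_skelIncl {H : Subgroup G} (hH : IsOpen (H : Set G))
    (x : MulAction.fixedPoints H X.carrier) (hx : (x : X.carrier) ∈ X.cw.skLT 1) :
    pointMap (X.skel 0) hH (X.skelPoint x hx) ≫ X.skelIncl 0 = pointMap X hH x := by
  refine SmoothGCWPair.Hom.ext (funext fun (z : G ⧸ H) => ?_)
  obtain ⟨y, rfl⟩ := QuotientGroup.mk_surjective z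
  rfl

/-- A path in X^H is a G-homotopy of maps G/H → X. Since H is open, G/H is discrete and continuity
can be tested on one coset at a time. -/
lemma gHomotopic_pointMap {H : Subgroup G} (hH : IsOpen (H : Set G))
    {x y : MulAction.fixedPoints H X.carrier} (h : Joined x y) :
    SmoothGCWPair.GHomotopic (pointMap X hH x) (pointMap X hH y) := by
  obtain ⟨γ⟩ := h
  have hd := QuotientGroup.discreteTopology hH
  have hc : Continuous fun p : (G ⧸ H) × unitInterval => orbitMap (γ p.2) p.1 := by
    refine continuous_prod_of_discrete_left.2 fun a => ?_
    obtain ⟨g, rfl⟩ := QuotientGroup.mk_surjective a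
    exact (continuous_const_smul g).comp (continuous_subtype_val.comp γ.continuous)
  refine ⟨fun p : (G ⧸ H) × unitInterval => orbitMap (γ p.2) p.1, hc, fun g a t => ?_,
    fun _ _ h => h.elim, fun a => ?_, fun a => ?_⟩
  · exact orbitMap_smul _ g a
  · change orbitMap (γ 0) a = orbitMap x a
    rw [γ.source]
  · change orbitMap (γ 1) a = orbitMap y a
    rw [γ.target]

namespace SmoothGHomologyTheory

variable {ℋ : SmoothGHomologyTheory G}

variable (ℋ) in
/-- The homomorphism `ℋ_q(G/H) → ℋ_q(X)` given by a point `x ∈ X^H`. -/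
def pointHom (q : ℤ) (a : OrbitCat F) (x : MulAction.fixedPoints a.H X.carrier) :
    (ℋ.orbitModule F q).obj a →+ ℋ.abs q X :=
  ((ℋ.H q).map (pointMap X (F.isOpen a.H a.mem) x)).hom

lemma pointHom_of_joined (q : ℤ) (a : OrbitCat F) {x y : MulAction.fixedPoints a.H X.carrier}
    (h : Joined x y) : ℋ.pointHom q a x = ℋ.pointHom q a y := by
  unfold pointHom
  rw [ℋ.homotopy_invariance q _ _ _ _ (gHomotopic_pointMap (F.isOpen a.H a.mem) h)]

lemma pointHom_map (q : ℤ) {a b : OrbitCat F} (g : G) (hg : ∀ h ∈ a.H, g * h * g⁻¹ ∈ b.H)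
    (x : MulAction.fixedPoints b.H X.carrier) (m : (ℋ.orbitModule F q).obj a) :
    ℋ.pointHom q b x ((ℋ.orbitModule F q).map (OrbitCat.homMk g hg : a ⟶ b) m) =
      ℋ.pointHom q a (fixedMap X g hg x) m := by
  refine (ℋ.map_comp_apply q ((orbitFunctor F).map (OrbitCat.homMk g hg : a ⟶ b))
    (pointMap X (F.isOpen b.H b.mem) x) m).symm.trans ?_
  rw [orbitFunctor_map_pointMap]
  rfl

lemma skelIncl_pointMap (q : ℤ) (a : OrbitCat F) (x : MulAction.fixedPoints a.H X.carrier)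
    (hx : (x : X.carrier) ∈ X.cw.skLT 1) (m : (ℋ.orbitModule F q).obj a) :
    (ℋ.H q).map (X.skelIncl 0) ((ℋ.H q).map
      (pointMap (X.skel 0) (F.isOpen a.H a.mem) (X.skelPoint x hx)) m) = ℋ.pointHom q a x m := by
  refine (ℋ.map_comp_apply q _ _ m).symm.trans ?_
  exact congrArg (fun f => (ℋ.H q).map f m) (pointMap_skelIncl (F.isOpen a.H a.mem) x hx)

end SmoothGHomologyTheory

end

/-- Every fixed point in the zero skeleton is a translate of the centre of a cell. -/
lemma SmoothGCW.exists_vertex (X : SmoothGCW G) {H : Subgroup G}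
    (x : MulAction.fixedPoints H X.carrier) (hx : (x : X.carrier) ∈ X.cw.skLT 1) :
    ∃ (i : X.cw.cell 0) (g : G) (hg : ∀ h ∈ H, g * h * g⁻¹ ∈ X.cw.typ 0 i),
      x = fixedMap X g hg (X.cellPoint i (center 0)) := by
  rcases X.cw.mem_skLT_or_exists hx with h | ⟨i, ⟨a, d⟩, hd, h⟩
  · rw [X.cw.skLT_zero] at h
    exact h.elim
  · obtain ⟨g, rfl⟩ := QuotientGroup.mk_surjective a
    obtain rfl : d = center 0 := Subtype.ext (Subsingleton.elim _ _)
    have hx' : (x : X.carrier) = g • (X.cellPoint i (center 0) : X.carrier) :=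
      h.symm.trans (X.orbitMap_cellPoint i (center 0) (g : G ⧸ X.cw.typ 0 i)).symm
    refine ⟨i, g⁻¹, fun k hk => ?_, Subtype.ext ?_⟩
    · rw [← X.stabilizer_char i hd]
      change (g⁻¹ * k * g⁻¹⁻¹) • (X.cellPoint i (center 0) : X.carrier) = X.cellPoint i (center 0)
      have h1 : k • (x : X.carrier) = x := x.2 ⟨k, hk⟩
      rw [inv_inv, mul_smul, ← hx', mul_smul, h1, hx', inv_smul_smul]
    · change (x : X.carrier) = g⁻¹⁻¹ • (X.cellPoint i (center 0) : X.carrier)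
      rw [inv_inv, hx']

/-- For n = 1 this joins the two ends of a 1-cell within X_1, which connects the differential d^1
with path components. -/
lemma SmoothGCW.joinedIn_cellPoint (X : SmoothGCW G) {n : ℕ} (i : X.cw.cell n) (d d' : Disk n) :
    JoinedIn {x : MulAction.fixedPoints (X.cw.typ n i) X.carrier |
      (x : X.carrier) ∈ X.cw.skLT (n + 1)} (X.cellPoint i d) (X.cellPoint i d') := by
  have h1 : PathConnectedSpace (Disk n) :=
    isPathConnected_iff_pathConnectedSpace.1 ((convex_closedBall _ _).isPathConnected ⟨0, by simp⟩)
  have hc : Continuous (X.cellPoint i) := Continuous.subtype_mk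
    ((X.cw.continuous_char n i).comp (continuous_const.prodMk continuous_id)) _
  exact ⟨(PathConnectedSpace.somePath d d').map hc, fun t => X.cw.char_mem_skLT_succ i _⟩

namespace SmoothGHomologyTheory

variable [IsTopologicalGroup G] {ℋ : SmoothGHomologyTheory G} {X : SmoothGCW G} {F : OpenFamily G}

/-- `ℋ_0(X)` is generated by the classes given by points of the zero skeleton. -/
lemma Connective.induction_on (h : ℋ.Connective X) (hF : ∀ n i, X.cw.typ n i ∈ F.mem)
    {p : ℋ.abs 0 X → Prop} (h0 : p 0) (hadd : ∀ a b, p a → p b → p (a + b))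
    (hp : ∀ (a : OrbitCat F) (x : MulAction.fixedPoints a.H X.carrier),
      (x : X.carrier) ∈ X.cw.skLT 1 → ∀ m, p (ℋ.pointHom 0 a x m)) (y : ℋ.abs 0 X) : p y := by
  obtain ⟨z, rfl⟩ := h.skelIncl_surjective y
  refine induction_disjointUnion X.isDisjointUnion_vertexMap (q := 0)
    (p := fun z => p ((ℋ.H 0).map (X.skelIncl 0) z)) ?_ ?_ ?_ z
  · rwa [map_zero]
  · intro a b ha hb
    rw [map_add]
    exact hadd _ _ ha hb
  · intro i m
    have := hp ⟨X.cw.typ 0 i, hF 0 i⟩ (X.cellPoint i (SmoothGCW.center 0))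
      (X.cw.char_mem_skLT_succ i _) m
    exact (iff_of_eq (congrArg p (skelIncl_pointMap 0 ⟨X.cw.typ 0 i, hF 0 i⟩
      (X.cellPoint i (SmoothGCW.center 0)) (X.cw.char_mem_skLT_succ i _) m))).2 this

/-- Homomorphisms from `ℋ_0(X)` are given by compatible families of homomorphisms from the groups
`ℋ_0(G/H)`, indexed by the points of `X_0^H`, which are constant along paths in `X_1^H`. -/
lemma Connective.exists_hom_of_points (h : ℋ.Connective X) (hF : ∀ n i, X.cw.typ n i ∈ F.mem)
    {B : Type*} [AddCommGroup B]
    (β : ∀ (a : OrbitCat F) (x : MulAction.fixedPoints a.H X.carrier),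
      (x : X.carrier) ∈ X.cw.skLT 1 → (ℋ.orbitModule F 0).obj a →+ B)
    (hnat : ∀ (a b : OrbitCat F) (g : G) (hg : ∀ h ∈ a.H, g * h * g⁻¹ ∈ b.H)
      (x : MulAction.fixedPoints b.H X.carrier) (hx : (x : X.carrier) ∈ X.cw.skLT 1)
      (hx' : (fixedMap X g hg x : X.carrier) ∈ X.cw.skLT 1) (m : (ℋ.orbitModule F 0).obj a),
      β b x hx ((ℋ.orbitModule F 0).map (OrbitCat.homMk g hg : a ⟶ b) m) =
        β a (fixedMap X g hg x) hx' m)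
    (hpath : ∀ (a : OrbitCat F) (x y : MulAction.fixedPoints a.H X.carrier) hx hy,
      JoinedIn {x : MulAction.fixedPoints a.H X.carrier | (x : X.carrier) ∈ X.cw.skLT 2} x y →
      β a x hx = β a y hy) :
    ∃ Ψ : ℋ.abs 0 X →+ B, ∀ (a : OrbitCat F) (x : MulAction.fixedPoints a.H X.carrier)
      (hx : (x : X.carrier) ∈ X.cw.skLT 1) (m : (ℋ.orbitModule F 0).obj a),
      Ψ (ℋ.pointHom 0 a x m) = β a x hx m := by
  -- Only the values of β at the base points of the vertex orbits are used to define φ.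
  obtain ⟨φ, hφ⟩ := exists_hom_disjointUnion (ℋ := ℋ) (q := 0) X.isDisjointUnion_vertexMap fun i =>
    β ⟨X.cw.typ 0 i, hF 0 i⟩ (X.cellPoint i (SmoothGCW.center 0)) (X.cw.char_mem_skLT_succ i _)
  -- All other values of β agree with φ, because every point of X_0^H is a translate of a base point
  -- and β is natural.
  have key : ∀ (a : OrbitCat F) (x : MulAction.fixedPoints a.H X.carrier)
      (hx : (x : X.carrier) ∈ X.cw.skLT 1) (m : (ℋ.orbitModule F 0).obj a),
      φ ((ℋ.H 0).map (pointMap (X.skel 0) (F.isOpen a.H a.mem) (X.skelPoint x hx)) m) =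
        β a x hx m := by
    intro a x hx m
    obtain ⟨i, g, hg, rfl⟩ := X.exists_vertex x hx
    let b : OrbitCat F := ⟨X.cw.typ 0 i, hF 0 i⟩
    have h1 := hnat a b g hg (X.cellPoint i (SmoothGCW.center 0)) (X.cw.char_mem_skLT_succ i _) hx m
    refine Eq.trans ?_ h1
    refine Eq.trans ?_ (hφ i ((ℋ.orbitModule F 0).map (OrbitCat.homMk g hg : a ⟶ b) m))
    refine congrArg φ ?_
    have h2 := pointHom_map (ℋ := ℋ) (X := X.skel 0) 0 (a := a) (b := b) g hg
      (X.skelPoint (X.cellPoint i (SmoothGCW.center 0)) (X.cw.char_mem_skLT_succ i _)) m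
    exact h2.symm
  -- The path condition enters only for the ends of 1-cells; it makes φ vanish on boundaries.
  obtain ⟨Ψ, hΨ⟩ := h.exists_hom φ (hom_dOne_eq_zero φ fun i d d' hd hd' m => by
    let a : OrbitCat F := ⟨X.cw.typ 1 i, hF 1 i⟩
    have h1 := key a (X.cellPoint i d) (X.cw.char_boundary 1 i _ d hd) m
    have h2 := key a (X.cellPoint i d') (X.cw.char_boundary 1 i _ d' hd') m
    have h3 := hpath a (X.cellPoint i d) (X.cellPoint i d') (X.cw.char_boundary 1 i _ d hd)
      (X.cw.char_boundary 1 i _ d' hd') (X.joinedIn_cellPoint i d d')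
    exact h1.trans ((DFunLike.congr_fun h3 m).trans h2.symm))
  refine ⟨Ψ, fun a x hx m => ?_⟩
  rw [← skelIncl_pointMap 0 a x hx m, hΨ, key]

end SmoothGHomologyTheory

end SmoothBredon

end

/-! ### Homology in degree zero and path components. -/

noncomputable section

namespace SmoothBredon

/-! ### Homology in degree zero -/

section BottomClass

variable (K : ChainComplex AddCommGrpCat.{u} ℕ)

/-- The projection from the zero chains to the zeroth homology of a chain complex. -/
def bottomClass : K.X 0 ⟶ K.homology 0 :=
  K.liftCycles (𝟙 (K.X 0)) 0 (by simp) (by simp) ≫ K.homologyπ 0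

/-- No differential leaves degree 0, so `homologyι 0` is an isomorphism onto the cokernel of the
incoming differential. The properties of `bottomClass` are read off after composing with it. -/
lemma bottomClass_homologyι : bottomClass K ≫ K.homologyι 0 = K.pOpcycles 0 := by
  simp [bottomClass]

instance : Epi (bottomClass K) := by
  have : Epi (bottomClass K ≫ K.homologyι 0) := by
    rw [bottomClass_homologyι]
    infer_instance
  have h : IsIso (K.homologyι 0) := K.isIso_homologyι 0 0 (by simp) (by simp)
  have e : bottomClass K = (bottomClass K ≫ K.homologyι 0) ≫ inv (K.homologyι 0) := by simp
  rw [e]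
  infer_instance

lemma d_bottomClass : K.d 1 0 ≫ bottomClass K = 0 := by
  rw [← cancel_mono (K.homologyι 0), Category.assoc, bottomClass_homologyι]
  simp

lemma bottomClass_naturality {K L : ChainComplex AddCommGrpCat.{u} ℕ} (φ : K ⟶ L) :
    bottomClass K ≫ HomologicalComplex.homologyMap φ 0 = φ.f 0 ≫ bottomClass L := by
  rw [← cancel_mono (L.homologyι 0)]
  simp [bottomClass]

lemma exists_bottomClass_desc {B : AddCommGrpCat.{u}} (f : K.X 0 ⟶ B) (hf : K.d 1 0 ≫ f = 0) :
    ∃ g : K.homology 0 ⟶ B, bottomClass K ≫ g = f := by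
  refine ⟨K.homologyι 0 ≫ K.descOpcycles f 1 (by simp) hf, ?_⟩
  rw [← Category.assoc, bottomClass_homologyι]
  simp

end BottomClass

/-! ### Singular homology in degree zero -/

lemma ulift_int_hom_ext {B : AddCommGrpCat.{u}} {f g : AddCommGrpCat.of (ULift.{u} ℤ) ⟶ B}
    (h : f (ULift.up (1 : ℤ)) = g (ULift.up (1 : ℤ))) : f = g := by
  ext ⟨n⟩
  have e : (ULift.up n : ULift.{u} ℤ) = n • ULift.up (1 : ℤ) :=
    ULift.ext _ _ (by simp)
  rw [e]
  refine (map_zsmul f.hom n _).trans (Eq.trans ?_ (map_zsmul g.hom n _).symm)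
  exact congrArg (n • ·) h

lemma exists_ulift_int_hom {B : AddCommGrpCat.{u}} (b : B) :
    ∃ f : AddCommGrpCat.of (ULift.{u} ℤ) ⟶ B, f (ULift.up (1 : ℤ)) = b :=
  ⟨AddCommGrpCat.ofHom ((zmultiplesHom B b).comp
    (AddEquiv.ulift : ULift.{u} ℤ ≃+ ℤ).toAddMonoidHom),
    one_zsmul b⟩

namespace FiltSpace

variable {Z W : TopCat.{u}}

/-- The singular zero chain given by a point. -/
def pointChain (Z : TopCat.{u}) (z : Z) : (singularChains.obj Z).X 0 :=
  (TopCat.toSSet.obj Z).ιChainComplex (R := AddCommGrpCat.of (ULift.{u} ℤ))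
    (TopCat.toSSetObj₀Equiv.symm z) (ULift.up (1 : ℤ))

lemma singularPointClass_eq (z : Z) :
    singularPointClass Z z = bottomClass (singularChains.obj Z) (pointChain Z z) := by
  have h : ((TopCat.toSSet.obj Z).chainComplex (AddCommGrpCat.of (ULift.{u} ℤ))).liftCycles
      ((TopCat.toSSet.obj Z).ιChainComplex (TopCat.toSSetObj₀Equiv.symm z)) 0 (by simp)
      (by simp) ≫
      ((TopCat.toSSet.obj Z).chainComplex (AddCommGrpCat.of (ULift.{u} ℤ))).homologyπ 0 =
      (TopCat.toSSet.obj Z).ιChainComplex (TopCat.toSSetObj₀Equiv.symm z) ≫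
        bottomClass ((TopCat.toSSet.obj Z).chainComplex (AddCommGrpCat.of (ULift.{u} ℤ))) := by
    unfold bottomClass
    rw [HomologicalComplex.comp_liftCycles_assoc]
    simp
  exact ConcreteCategory.congr_hom h (ULift.up (1 : ℤ))

lemma chain_hom_ext {B : AddCommGrpCat.{u}} {f g : (singularChains.obj Z).X 0 ⟶ B}
    (h : ∀ z, f (pointChain Z z) = g (pointChain Z z)) : f = g := by
  refine SSet.chainComplex_hom_ext fun x => ulift_int_hom_ext ?_
  obtain ⟨z, rfl⟩ := TopCat.toSSetObj₀Equiv.symm.surjective x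
  exact h z

lemma singular_hom_ext {B : AddCommGrpCat.{u}} {f g : (singularChains.obj Z).homology 0 ⟶ B}
    (h : ∀ z, f (singularPointClass Z z) = g (singularPointClass Z z)) : f = g := by
  rw [← cancel_epi (bottomClass (singularChains.obj Z))]
  refine chain_hom_ext fun z => ?_
  have := h z
  rwa [singularPointClass_eq] at this

lemma d_edge (s : TopCat.I ⟶ Z) :
    ((TopCat.toSSet.obj Z).ιChainComplex (R := AddCommGrpCat.of (ULift.{u} ℤ))
      (TopCat.toSSetObj₁Equiv.symm s) ≫ (singularChains.obj Z).d 1 0) (ULift.up (1 : ℤ)) =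
    pointChain Z (s 1) - pointChain Z (s 0) := by
  have h := (TopCat.toSSet.obj Z).ιChainComplex_d (R := AddCommGrpCat.of (ULift.{u} ℤ))
    (TopCat.toSSetObj₁Equiv.symm s)
  rw [Fin.sum_univ_two] at h
  rw [TopCat.δ_zero_toSSetObj₁Equiv.symm, TopCat.δ_one_toSSetObj₁Equiv.symm] at h
  have h' : (TopCat.toSSet.obj Z).ιChainComplex (R := AddCommGrpCat.of (ULift.{u} ℤ))
      (TopCat.toSSetObj₁Equiv.symm s) ≫ (singularChains.obj Z).d 1 0 =
      (TopCat.toSSet.obj Z).ιChainComplex (TopCat.toSSetObj₀Equiv.symm (s 1)) -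
      (TopCat.toSSet.obj Z).ιChainComplex (TopCat.toSSetObj₀Equiv.symm (s 0)) := by
    refine h.trans ?_
    simp only [Fin.val_zero, pow_zero, one_smul, Fin.val_one, pow_one, neg_smul]
    exact (sub_eq_add_neg _ _).symm
  rw [h']
  rfl

/-- Zero chains are free on points, and the boundary of a singular 1-simplex is the difference of
the ends of a path, so θ kills boundaries. -/
lemma exists_singular_hom {B : AddCommGrpCat.{u}} (θ : Z → B)
    (hθ : ∀ z w, Joined z w → θ z = θ w) :
    ∃ f : (singularChains.obj Z).homology 0 ⟶ B, ∀ z, f (singularPointClass Z z) = θ z := by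
  choose e he using fun b : B => exists_ulift_int_hom b
  let f₀ : (singularChains.obj Z).X 0 ⟶ B :=
    Sigma.desc fun x => e (θ (TopCat.toSSetObj₀Equiv x))
  have hf₀ : ∀ z, f₀ (pointChain Z z) = θ z := by
    intro z
    have h1 : (TopCat.toSSet.obj Z).ιChainComplex (R := AddCommGrpCat.of (ULift.{u} ℤ))
        (TopCat.toSSetObj₀Equiv.symm z) ≫ f₀ = e (θ z) := by
      refine (Sigma.ι_desc _ _).trans ?_
      rw [Equiv.apply_symm_apply]
    exact (ConcreteCategory.congr_hom h1 (ULift.up (1 : ℤ))).trans (he _)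
  obtain ⟨f, hf⟩ := exists_bottomClass_desc (singularChains.obj Z) f₀ (by
    refine SSet.chainComplex_hom_ext fun x => ulift_int_hom_ext ?_
    obtain ⟨s, rfl⟩ := TopCat.toSSetObj₁Equiv.symm.surjective x
    refine (congrArg f₀ (d_edge s)).trans (Eq.trans ?_ (rfl : (0 : B) = _))
    rw [map_sub, hf₀, hf₀, sub_eq_zero]
    · exact hθ _ _ ⟨(TopCat.pathEquiv { hom := s, hom₀ := rfl, hom₁ := rfl }).symm⟩)
  refine ⟨f, fun z => ?_⟩
  rw [singularPointClass_eq, ← hf₀ z, ← hf]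
  rfl

lemma singularPointClass_of_joined {z w : Z} (h : Joined z w) :
    singularPointClass Z z = singularPointClass Z w := by
  obtain ⟨γ⟩ := h
  let p := TopCat.pathEquiv.symm γ
  have h1 := d_edge p.hom
  rw [p.hom₀, p.hom₁] at h1
  have h2 := congrArg (bottomClass (singularChains.obj Z)) h1
  rw [map_sub] at h2
  rw [singularPointClass_eq, singularPointClass_eq, eq_comm, ← sub_eq_zero, ← h2]
  exact ConcreteCategory.congr_hom (d_bottomClass (singularChains.obj Z)) _

lemma map_singularPointClass (f : Z ⟶ W) (z : Z) :
    HomologicalComplex.homologyMap (singularChains.map f) 0 (singularPointClass Z z) =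
      singularPointClass W (f z) := by
  rw [singularPointClass_eq, singularPointClass_eq]
  refine (ConcreteCategory.congr_hom (bottomClass_naturality (singularChains.map f))
    (pointChain Z z)).trans ?_
  refine congrArg (bottomClass (singularChains.obj W)) ?_
  exact ConcreteCategory.congr_hom (SSet.ι_chainComplexMap_f _ _ (TopCat.toSSet.map f)
    (AddCommGrpCat.of (ULift.{u} ℤ)) (TopCat.toSSetObj₀Equiv.symm z)) (ULift.up (1 : ℤ))

end FiltSpace

end SmoothBredon

end

/-! ### The bottom of the cellular chain complex of a filtered space. -/

noncomputable section

namespace SmoothBredon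

/-! ### The cellular chain groups in degree zero -/

namespace FiltSpace

variable {Y : FiltSpace.{u}}

/-- A point of `Y_0` as a point of `Y_1`. -/
def inclPoint (y : Y.fil 1) : Y.fil 2 := ⟨y.1, Y.mono 1 y.2⟩

/-- A singular simplex of Z would have a vertex in Z. -/
lemma singularChains_map_eq_zero {Z W : TopCat.{u}} [IsEmpty Z] (f : Z ⟶ W) :
    singularChains.map f = 0 := by
  ext n : 1
  refine SSet.chainComplex_hom_ext (X := TopCat.toSSet.obj Z) fun x => ?_
  have : Nonempty Z :=
    ⟨TopCat.toSSetObj₀Equiv ((TopCat.toSSet.obj Z).map (SimplexCategory.const _ _ 0).op x)⟩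
  exact (IsEmpty.false this.some).elim

/-- With Y_{-1} empty, H_0(Y_0, Y_{-1}) is H_0(Y_0), so the cellular chain group in degree zero is
described by points. -/
lemma isIso_homologyMap_pairSeq (hY : Y.fil 0 = ∅) :
    IsIso (HomologicalComplex.homologyMap ((pairSeq 0).obj Y).g 0) := by
  have : IsEmpty ((part 0).obj Y) := Set.isEmpty_coe_sort.2 hY
  have h : (chainIncl 0).app Y = 0 := singularChains_map_eq_zero _
  have : IsIso ((pairSeq 0).obj Y).g := by
    change IsIso (cokernel.π ((chainIncl 0).app Y))
    rw [h]
    infer_instance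
  infer_instance

lemma cellGroup_hom_ext (hY : Y.fil 0 = ∅) {B : AddCommGrpCat.{u}}
    {f g : (cellGroup 0).obj Y ⟶ B} (h : ∀ y, f (pointClass Y y) = g (pointClass Y y)) : f = g := by
  have := isIso_homologyMap_pairSeq hY
  have e : HomologicalComplex.homologyMap ((pairSeq 0).obj Y).g 0 ≫ f =
      HomologicalComplex.homologyMap ((pairSeq 0).obj Y).g 0 ≫ g :=
    singular_hom_ext (Z := (part 1).obj Y) h
  exact (cancel_epi (HomologicalComplex.homologyMap ((pairSeq 0).obj Y).g 0)).1 e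

/-- A function on `Y_1` which is constant along paths gives a homomorphism on the zeroth cellular
chain group which vanishes on boundaries. -/
lemma exists_cellGroup_hom (hY : Y.fil 0 = ∅) {B : AddCommGrpCat.{u}} (θ : Y.fil 2 → B)
    (hθ : ∀ y z, Joined y z → θ y = θ z) :
    ∃ f : (cellGroup 0).obj Y ⟶ B, (∀ y, f (pointClass Y y) = θ (inclPoint y)) ∧
      (cellDiff 0).app Y ≫ f = 0 := by
  obtain ⟨φ, hφ⟩ := exists_singular_hom (Z := (part 2).obj Y) θ hθ
  have hiso := isIso_homologyMap_pairSeq hY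
  generalize hg : HomologicalComplex.homologyMap ((pairSeq 0).obj Y).g 0 = g at hiso
  let i := HomologicalComplex.homologyMap ((pairSeq 1).obj Y).f 0
  let i' : ((pairSeq 0).obj Y).X₂.homology 0 ⟶ B := i ≫ φ
  have hg' : g ≫ inv g ≫ i' = i' := IsIso.hom_inv_id_assoc g i'
  refine ⟨@inv _ _ _ _ g hiso ≫ i', fun y => ?_, ?_⟩
  · refine Eq.trans ?_ (hφ (inclPoint y))
    refine Eq.trans ?_ (congrArg φ (map_singularPointClass ((incl 1).app Y) y))
    refine Eq.trans ?_ (ConcreteCategory.congr_hom hg' (singularPointClass ((part 1).obj Y) y))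
    exact congrArg (fun f : ((pairSeq 0).obj Y).X₂.homology 0 ⟶ ((pairSeq 0).obj Y).X₃.homology 0 =>
      (@inv _ _ _ _ g hiso ≫ i') (f (singularPointClass ((part 1).obj Y) y))) hg
  -- The homomorphism factors through H_0(Y_0) → H_0(Y_1), and the connecting map of (Y_1, Y_0)
  -- followed by this map is zero.
  · change ((pairSeq_shortExact 1 Y).δ 1 0 (down_rel 0) ≫
      HomologicalComplex.homologyMap ((pairSeq 0).obj Y).g 0) ≫ inv g ≫ i' = 0
    rw [hg]
    refine (Category.assoc _ _ _).trans ((congrArg (_ ≫ ·) hg').trans ?_)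
    refine (Category.assoc _ _ _).symm.trans ?_
    exact (congrArg (· ≫ φ) ((pairSeq_shortExact 1 Y).δ_comp 1 0 (down_rel 0))).trans zero_comp

/-- Points of `Y_0` joined by a path in `Y_1` differ by a boundary. -/
lemma exists_cellDiff_eq (y z : Y.fil 1) (h : Joined (inclPoint y) (inclPoint z)) :
    ∃ w, (cellDiff 0).app Y w = pointClass Y y - pointClass Y z := by
  let S := singularPointClass ((part 1).obj Y)
  -- The difference of the two classes dies in H_0(Y_1), hence comes from H_1(Y_1, Y_0) by
  -- exactness.
  have h0 : HomologicalComplex.homologyMap ((pairSeq 1).obj Y).f 0 (S y - S z) = 0 := by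
    refine (map_sub (HomologicalComplex.homologyMap ((pairSeq 1).obj Y).f 0).hom _ _).trans
      (sub_eq_zero.2 ?_)
    refine (map_singularPointClass ((incl 1).app Y) y).trans ?_
    refine Eq.trans ?_ (map_singularPointClass ((incl 1).app Y) z).symm
    exact singularPointClass_of_joined h
  have hex := (pairSeq_shortExact 1 Y).homology_exact₁ 1 0 (down_rel 0)
  obtain ⟨w, hw⟩ := (ShortComplex.ab_exact_iff _).1 hex _ h0
  refine ⟨w, ?_⟩
  refine (congrArg (HomologicalComplex.homologyMap ((pairSeq 0).obj Y).g 0) hw).trans ?_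
  exact map_sub _ _ _

lemma cellGroup_map_pointClass {Y Z : FiltSpace.{u}} (f : Y ⟶ Z) (y : Y.fil 1) :
    (cellGroup 0).map f (pointClass Y y) = pointClass Z ⟨f.map y.1, f.mapsTo 1 y.2⟩ := by
  have h := congrArg (fun φ => HomologicalComplex.homologyMap φ 0) ((pairSeq 0).map f).comm₂₃
  simp only [HomologicalComplex.homologyMap_comp] at h
  refine (ConcreteCategory.congr_hom h (singularPointClass ((part 1).obj Y) y)).symm.trans ?_
  exact congrArg (HomologicalComplex.homologyMap ((pairSeq 0).obj Z).g 0)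
    (map_singularPointClass ((part 1).map f) y)

end FiltSpace

end SmoothBredon

end

/-! ### Universal property of H_0 of a cellular complex tensored over a category. -/

noncomputable section

namespace SmoothBredon

/-! ### Tensor products over a category -/

section TensorOver

variable {K : Type u} [Category.{u} K]

lemma tmulClass_map {C : Kᵒᵖ ⥤ AddCommGrpCat.{u}} {M : K ⥤ AddCommGrpCat.{u}} {a b : K} (f : a ⟶ b)
    (c : C.obj (Opposite.op b)) (m : M.obj a) :
    tmulClass (C := C) (C.map f.op c) m = tmulClass (C := C) (M := M) c (M.map f m) := by
  let _ := Classical.decEq K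
  refine (QuotientAddGroup.eq_iff_sub_mem (N := tensorRel C M)).2 ?_
  exact AddSubgroup.subset_closure ⟨a, b, f, c, m, rfl⟩

/-- The homomorphism `c ↦ m ↦ c ⊗ m`. -/
def tmulHom (C : Kᵒᵖ ⥤ AddCommGrpCat.{u}) (M : K ⥤ AddCommGrpCat.{u}) (k : K) :
    C.obj (Opposite.op k) →+ M.obj k →+ (tensorOver M).obj C :=
  AddMonoidHom.mk' (fun c => AddMonoidHom.mk' (fun m => tmulClass c m) (fun m m' => by
      classical
      simp only [tmulClass, TensorProduct.tmul_add, map_add]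
      rfl)) (fun c c' => by
      ext m
      classical
      change tmulClass (c + c') m = tmulClass c m + tmulClass c' m
      simp only [tmulClass, TensorProduct.add_tmul, map_add]
      rfl)

lemma tensorOver_map_tmulClass {C D : Kᵒᵖ ⥤ AddCommGrpCat.{u}} (φ : C ⟶ D)
    {M : K ⥤ AddCommGrpCat.{u}} {k : K} (c : C.obj (Opposite.op k)) (m : M.obj k) :
    (tensorOver M).map φ (tmulClass c m) = tmulClass (φ.app (Opposite.op k) c) m :=
  congrArg (QuotientAddGroup.mk (s := tensorRel D M)) (tensorSumMap_of φ M k c m)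

lemma tensorOver_hom_ext {C : Kᵒᵖ ⥤ AddCommGrpCat.{u}} {M : K ⥤ AddCommGrpCat.{u}}
    {A : AddCommGrpCat.{u}} {f g : (tensorOver M).obj C ⟶ A}
    (h : ∀ k (c : C.obj (Opposite.op k)) (m : M.obj k), f (tmulClass c m) = g (tmulClass c m)) :
    f = g := by
  let _ := Classical.decEq K
  refine AddCommGrpCat.hom_ext ?_
  let π := QuotientAddGroup.mk' (tensorRel C M)
  let f' : ((DirectSum K fun k => (C.obj (Opposite.op k) : Type u) ⊗[ℤ] (M.obj k : Type u)) ⧸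
      tensorRel C M) →+ A := f.hom
  let g' : ((DirectSum K fun k => (C.obj (Opposite.op k) : Type u) ⊗[ℤ] (M.obj k : Type u)) ⧸
      tensorRel C M) →+ A := g.hom
  have : f' = g' := by
    refine QuotientAddGroup.addMonoidHom_ext _ ?_
    refine DirectSum.addHom_ext fun k t => ?_
    induction t with
    | zero => rw [map_zero, map_zero, map_zero]
    | add x y hx hy => rw [map_add, map_add, map_add, hx, hy]
    | tmul c m => exact h k c m
  exact this

lemma exists_tensorOver_hom {C : Kᵒᵖ ⥤ AddCommGrpCat.{u}} {M : K ⥤ AddCommGrpCat.{u}}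
    {A : AddCommGrpCat.{u}} (φ : ∀ k, C.obj (Opposite.op k) →+ M.obj k →+ A)
    (hφ : ∀ (a b : K) (f : a ⟶ b) (c : C.obj (Opposite.op b)) (m : M.obj a),
      φ a (C.map f.op c) m = φ b c (M.map f m)) :
    ∃ h : (tensorOver M).obj C ⟶ A, ∀ k (c : C.obj (Opposite.op k)) (m : M.obj k),
      h (tmulClass c m) = φ k c m := by
  let _ := Classical.decEq K
  let T : (DirectSum K fun k => (C.obj (Opposite.op k) : Type u) ⊗[ℤ] (M.obj k : Type u)) →+ A :=
    DirectSum.toAddMonoid fun k => TensorProduct.liftAddHom (φ k) (fun r m n => by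
      rw [map_zsmul, map_zsmul, AddMonoidHom.zsmul_apply])
  have hT : ∀ k (c : C.obj (Opposite.op k)) (m : M.obj k), T (DirectSum.of
      (fun k => (C.obj (Opposite.op k) : Type u) ⊗[ℤ] (M.obj k : Type u)) k (c ⊗ₜ[ℤ] m)) =
      φ k c m := fun k c m => by
    simp only [T, DirectSum.toAddMonoid_of]
    rfl
  have hle : tensorRel C M ≤ T.ker := by
    refine (AddSubgroup.closure_le _).2 ?_
    rintro _ ⟨a, b, f, c, m, rfl⟩
    refine AddMonoidHom.mem_ker.2 ?_
    rw [map_sub, hT, hT, hφ, sub_self]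
  exact ⟨AddCommGrpCat.ofHom (QuotientAddGroup.lift (tensorRel C M) T hle), hT⟩

end TensorOver

/-! ### The zeroth homology of `C_*(O) ⊗ M` -/

section TensorHomology

variable {K : Type u} [Category.{u} K] {O : Kᵒᵖ ⥤ FiltSpace.{u}} {M : K ⥤ AddCommGrpCat.{u}}

variable (O M) in
/-- The homomorphism `m ↦ [y] ⊗ m`. -/
def pointTensorHom {k : K} (y : (O.obj (Opposite.op k)).fil 1) :
    M.obj k →+ tensorHomology O M 0 :=
  (bottomClass (tensorComplex O M)).hom.comp
    (tmulHom (O ⋙ FiltSpace.cellGroup 0) M k (FiltSpace.pointClass _ y))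

lemma pointTensorClass_map {a b : K} (f : a ⟶ b) (y : (O.obj (Opposite.op b)).fil 1)
    (m : M.obj a) :
    pointTensorClass O M (k := a) ⟨(O.map f.op).map y.1, (O.map f.op).mapsTo 1 y.2⟩ m =
      pointTensorClass O M y (M.map f m) := by
  have h := tmulClass_map (C := O ⋙ FiltSpace.cellGroup 0) (M := M) f
    (FiltSpace.pointClass _ y) m
  refine congrArg (bottomClass (tensorComplex O M)) (Eq.trans ?_ h)
  exact congrArg (fun c => tmulClass (C := O ⋙ FiltSpace.cellGroup 0) (M := M) c m)
    (FiltSpace.cellGroup_map_pointClass (O.map f.op) y).symm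

lemma cellComplex_d : (cellComplex O).d 1 0 = Functor.whiskerLeft O (FiltSpace.cellDiff 0) := by
  simp only [cellComplex]
  exact ChainComplex.of_d (α := ℕ) _ _ 0

lemma tensorComplex_d_tmulClass {k : K} (w : (FiltSpace.cellGroup 1).obj (O.obj (Opposite.op k)))
    (m : M.obj k) : (tensorComplex O M).d 1 0
      (tmulClass (C := (cellComplex O).X 1) (M := M) (k := k) w m) =
    tmulClass (C := (cellComplex O).X 0) (M := M) (k := k)
      ((FiltSpace.cellDiff 0).app (O.obj (Opposite.op k)) w) m := by
  refine (tensorOver_map_tmulClass ((cellComplex O).d 1 0) _ _).trans ?_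
  rw [cellComplex_d]
  rfl

/-- A path in Y_1 yields a relative class w with boundary [y] - [z], and the difference of the two
tensors is the differential of w ⊗ m. -/
lemma pointTensorClass_of_joined {k : K} {y z : (O.obj (Opposite.op k)).fil 1}
    (h : Joined (FiltSpace.inclPoint y) (FiltSpace.inclPoint z)) (m : M.obj k) :
    pointTensorClass O M y m = pointTensorClass O M z m := by
  obtain ⟨w, hw⟩ := FiltSpace.exists_cellDiff_eq y z h
  have h1 := ConcreteCategory.congr_hom (d_bottomClass (tensorComplex O M))
    (tmulClass (C := (cellComplex O).X 1) (M := M) (k := k) w m)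
  have h2 : (tensorComplex O M).d 1 0
      (tmulClass (C := (cellComplex O).X 1) (M := M) (k := k) w m) =
      tmulHom (O ⋙ FiltSpace.cellGroup 0) M k (FiltSpace.pointClass _ y) m -
      tmulHom (O ⋙ FiltSpace.cellGroup 0) M k (FiltSpace.pointClass _ z) m := by
    refine (tensorComplex_d_tmulClass w m).trans ?_
    refine (congrArg (fun c => tmulHom (O ⋙ FiltSpace.cellGroup 0) M k c m) hw).trans ?_
    exact DFunLike.congr_fun (map_sub (tmulHom (O ⋙ FiltSpace.cellGroup 0) M k) _ _) m
  have h3 : (bottomClass (tensorComplex O M)).hom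
      (tmulHom (O ⋙ FiltSpace.cellGroup 0) M k (FiltSpace.pointClass _ y) m -
      tmulHom (O ⋙ FiltSpace.cellGroup 0) M k (FiltSpace.pointClass _ z) m) = 0 :=
    (congrArg (bottomClass (tensorComplex O M)).hom h2).symm.trans h1
  exact sub_eq_zero.1 ((map_sub (bottomClass (tensorComplex O M)).hom _ _).symm.trans h3)

lemma tensorHomology_hom_ext (hO : ∀ k, (O.obj k).fil 0 = ∅) {A : AddCommGrpCat.{u}}
    {f g : tensorHomology O M 0 ⟶ A}
    (h : ∀ k (y : (O.obj (Opposite.op k)).fil 1) (m : M.obj k),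
      f (pointTensorClass O M y m) = g (pointTensorClass O M y m)) : f = g := by
  refine (cancel_epi (bottomClass (tensorComplex O M))).1 ?_
  let f' : (tensorOver M).obj (O ⋙ FiltSpace.cellGroup 0) ⟶ A := bottomClass (tensorComplex O M) ≫ f
  let g' : (tensorOver M).obj (O ⋙ FiltSpace.cellGroup 0) ⟶ A := bottomClass (tensorComplex O M) ≫ g
  have : f' = g' := by
    refine tensorOver_hom_ext fun k c m => ?_
    let F (f' : (tensorOver M).obj (O ⋙ FiltSpace.cellGroup 0) ⟶ A) :
        (FiltSpace.cellGroup 0).obj (O.obj (Opposite.op k)) ⟶ A :=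
      AddCommGrpCat.ofHom
        (f'.hom.comp (((tmulHom (O ⋙ FiltSpace.cellGroup 0) M k).flip) m))
    have e : F f' = F g' := FiltSpace.cellGroup_hom_ext (hO _) fun y => h k y m
    exact ConcreteCategory.congr_hom e c
  exact this

/-- Compatible families of functions which are constant along paths define homomorphisms on the
zeroth homology. -/
lemma exists_tensorHomology_hom (hO : ∀ k, (O.obj k).fil 0 = ∅) {A : AddCommGrpCat.{u}}
    (θ : ∀ k, (O.obj (Opposite.op k)).fil 2 → (M.obj k →+ A))
    (hjoin : ∀ k y z, Joined y z → θ k y = θ k z)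
    (hnat : ∀ (a b : K) (f : a ⟶ b) (y : (O.obj (Opposite.op b)).fil 2) (m : M.obj a),
      θ a ⟨(O.map f.op).map y.1, (O.map f.op).mapsTo 2 y.2⟩ m = θ b y (M.map f m)) :
    ∃ h : tensorHomology O M 0 ⟶ A, ∀ k (y : (O.obj (Opposite.op k)).fil 1) (m : M.obj k),
      h (pointTensorClass O M y m) = θ k (FiltSpace.inclPoint y) m := by
  -- Currying: for fixed k, the family θ is a function on points with values in the abelian group
  -- Hom(M(k), A).
  have H := fun k => FiltSpace.exists_cellGroup_hom (hO (Opposite.op k))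
    (B := AddCommGrpCat.of (M.obj k →+ A)) (θ k) (hjoin k)
  choose φ hφ hφd using H
  let φ' : ∀ k, (FiltSpace.cellGroup 0).obj (O.obj (Opposite.op k)) →+ M.obj k →+ A :=
    fun k => (φ k).hom
  have hφ' : ∀ k y, φ' k (FiltSpace.pointClass _ y) = θ k (FiltSpace.inclPoint y) := hφ
  -- Balancedness over K may be tested on classes of points, which determine homomorphisms on the
  -- chain group; there it is `hnat`.
  obtain ⟨T, hT⟩ := exists_tensorOver_hom (C := O ⋙ FiltSpace.cellGroup 0) (M := M) φ' (by
    intro a b f c m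
    let L : (FiltSpace.cellGroup 0).obj (O.obj (Opposite.op b)) ⟶ A := AddCommGrpCat.ofHom
      (((φ' a).flip m).comp ((FiltSpace.cellGroup 0).map (O.map f.op)).hom)
    let R : (FiltSpace.cellGroup 0).obj (O.obj (Opposite.op b)) ⟶ A := AddCommGrpCat.ofHom
      ((φ' b).flip (M.map f m))
    have e : L = R := FiltSpace.cellGroup_hom_ext (hO _) fun y => by
      refine (congrArg (fun c => φ' a c m)
        (FiltSpace.cellGroup_map_pointClass (O.map f.op) y)).trans ?_
      refine (DFunLike.congr_fun (hφ' a _) m).trans ?_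
      refine Eq.trans ?_ (DFunLike.congr_fun (hφ' b _) (M.map f m)).symm
      exact hnat a b f (FiltSpace.inclPoint y) m
    exact ConcreteCategory.congr_hom e c)
  obtain ⟨h, hh⟩ := exists_bottomClass_desc (tensorComplex O M) T (by
    refine tensorOver_hom_ext (C := (cellComplex O).X 1) fun k c m => ?_
    refine (congrArg T (tensorComplex_d_tmulClass c m)).trans ?_
    refine (hT k _ m).trans ?_
    exact DFunLike.congr_fun (ConcreteCategory.congr_hom (hφd k) c) m)
  refine ⟨h, fun k y m => ?_⟩
  refine (ConcreteCategory.congr_hom hh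
    (tmulClass (C := O ⋙ FiltSpace.cellGroup 0) (FiltSpace.pointClass _ y) m)).trans ?_
  refine (hT k _ m).trans ?_
  exact DFunLike.congr_fun (hφ' k y) m

end TensorHomology

end SmoothBredon

end

/-! ### Comparison of Bredon homology with ℋ_0(X). -/

noncomputable section

namespace SmoothBredon

/-! ### The identification of Bredon homology with the second page -/

section

variable {G : Type u} [Group G] [TopologicalSpace G] {X : SmoothGCW G} {F : OpenFamily G}

lemma fixedFilt_fil_zero (a : (OrbitCat F)ᵒᵖ) : ((fixedFilt X F).obj a).fil 0 = ∅ := by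
  change {x : MulAction.fixedPoints a.unop.H X.carrier | (x : X.carrier) ∈ X.cw.skLT 0} = ∅
  simp [X.cw.skLT_zero]

lemma centFilt_fil_zero (a : (SubCat F)ᵒᵖ) : ((centFilt X F).obj a).fil 0 = ∅ := by
  change Quotient.mk (centSetoid X a.unop.H) '' {x | (x : X.carrier) ∈ X.cw.skLT 0} = ∅
  simp [X.cw.skLT_zero]

lemma fixedFilt_map_homMk {a b : OrbitCat F} (g : G) (hg : ∀ h ∈ a.H, g * h * g⁻¹ ∈ b.H)
    (x : MulAction.fixedPoints b.H X.carrier) :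
    ((fixedFilt X F).map (OrbitCat.homMk g hg : a ⟶ b).op).map x = fixedMap X g hg x := by
  refine Subtype.ext ?_
  change (1 * g⁻¹) • (x : X.carrier) = g⁻¹ • (x : X.carrier)
  rw [one_mul]

namespace SmoothGHomologyTheory

variable {ℋ : SmoothGHomologyTheory G}

/-- An isomorphism to `ℋ_0(X)` lifts to an isomorphism to the second page. -/
lemma Connective.exists_iso_ETwo [IsTopologicalGroup G] (h : ℋ.Connective X) {A : AddCommGrpCat.{u}}
    (T : A ⟶ ℋ.abs 0 X) (hT : IsIso T) :
    ∃ Θ : A ≅ ℋ.ETwo X 0, IsIso (Θ.hom ≫ ℋ.edge X 0) ∧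
      ∀ a z, T a = (ℋ.H 0).map (X.skelIncl 0) z → Θ.hom a = ℋ.toETwo X 0 z := by
  have := h.isIso_edge
  refine ⟨asIso T ≪≫ (asIso (ℋ.edge X 0)).symm, ?_, fun a z hz => ?_⟩
  · simpa using hT
  · have hi : Function.Injective (ℋ.edge X 0) :=
      (AddCommGrpCat.mono_iff_injective (ℋ.edge X 0)).1 inferInstance
    apply hi
    rw [edge_toETwo, ← hz]
    simp

variable [IsTopologicalGroup G]

/-- Both groups are generated by pairs (x, m) subject to naturality and to invariance along paths in
X_1^H, so each universal property supplies a map to the other group. They are inverse on generators,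
and the isomorphism with ℋ_0(X) is carried back to E^2 along the edge isomorphism. -/
lemma Connective.exists_bredon_iso (h : ℋ.Connective X) (hF : ∀ n i, X.cw.typ n i ∈ F.mem) :
    ∃ Θ : bredonH X F (ℋ.orbitModule F 0) 0 ≅ ℋ.ETwo X 0,
      ℋ.IsBredonIdentification X 0 F Θ.hom ∧ IsIso (Θ.hom ≫ ℋ.edge X 0) := by
  obtain ⟨T, hT⟩ := exists_tensorHomology_hom (O := fixedFilt X F) (M := ℋ.orbitModule F 0)
    fixedFilt_fil_zero (A := ℋ.abs 0 X) (fun a y => ℋ.pointHom 0 a y.1)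
    (fun a y z hyz => pointHom_of_joined 0 a (hyz.map continuous_subtype_val)) (by
      intro a b f y m
      obtain ⟨g, hg, rfl⟩ := OrbitCat.exists_homMk f
      refine Eq.trans ?_ (pointHom_map 0 g hg y.1 m).symm
      exact congrArg (fun x => ℋ.pointHom 0 a x m) (fixedFilt_map_homMk g hg y.1))
  obtain ⟨Ψ, hΨ⟩ := h.exists_hom_of_points hF
    (B := tensorHomology (fixedFilt X F) (ℋ.orbitModule F 0) 0)
    (fun a x hx => pointTensorHom (fixedFilt X F) (ℋ.orbitModule F 0) (k := a) ⟨x, hx⟩) (by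
      intro a b g hg x hx hx' m
      refine (pointTensorClass_map (OrbitCat.homMk g hg : a ⟶ b)
        (⟨x, hx⟩ : ((fixedFilt X F).obj (Opposite.op b)).fil 1) m).symm.trans ?_
      refine congrArg (fun y => pointTensorClass (fixedFilt X F) (ℋ.orbitModule F 0) (k := a) y m)
        (Subtype.ext ?_)
      exact fixedFilt_map_homMk g hg x) (by
      intro a x y hx hy hxy
      refine AddMonoidHom.ext fun m => ?_
      exact pointTensorClass_of_joined hxy.joined_subtype m)
  have hiso : IsIso T := by
    refine ⟨AddCommGrpCat.ofHom Ψ, ?_, ?_⟩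
    · refine tensorHomology_hom_ext fixedFilt_fil_zero fun a y m => ?_
      exact (congrArg Ψ (hT a y m)).trans (hΨ a y.1 y.2 m)
    · refine AddCommGrpCat.hom_ext (AddMonoidHom.ext fun z => ?_)
      change T (Ψ z) = z
      refine h.induction_on hF (p := fun z => T (Ψ z) = z) ?_ ?_ ?_ z
      · exact (congrArg T (map_zero Ψ)).trans (map_zero T.hom)
      · intro z w hz hw
        refine (congrArg T (map_add Ψ z w)).trans ((map_add T.hom _ _).trans ?_)
        exact congrArg₂ (· + ·) hz hw
      · intro a x hx m
        exact (congrArg T (hΨ a x hx m)).trans (hT a ⟨x, hx⟩ m)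
  obtain ⟨Θ, h1, h2⟩ := h.exists_iso_ETwo T hiso
  refine ⟨Θ, fun a x hx m => h2 _ _ ?_, h1⟩
  exact (hT a ⟨x, hx⟩ m).trans (skelIncl_pointMap 0 a x hx m).symm

end SmoothGHomologyTheory

/-! ### Functions on fixed point sets -/

lemma SmoothGCW.char_mem_fixedPoints (X : SmoothGCW G) {H : Subgroup G} {n : ℕ} {i : X.cw.cell n}
    {a : G ⧸ X.cw.typ n i} (ha : ∀ k ∈ H, k • a = a) (d : Disk n) :
    X.cw.char n i (a, d) ∈ MulAction.fixedPoints H X.carrier := fun k => by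
  change (k : G) • X.cw.char n i (a, d) = _
  rw [← X.cw.char_smul, ha k k.2]

lemma SmoothGCW.smul_eq_of_char_mem_fixedPoints (X : SmoothGCW G) {H : Subgroup G} {n : ℕ}
    {i : X.cw.cell n} {a : G ⧸ X.cw.typ n i} {d : Disk n} (hd : d.norm < 1)
    (hx : X.cw.char n i (a, d) ∈ MulAction.fixedPoints H X.carrier) (k : G) (hk : k ∈ H) :
    k • a = a := by
  have h1 : X.cw.char n i (k • a, d) = X.cw.char n i (a, d) := by
    rw [X.cw.char_smul]
    exact hx ⟨k, hk⟩
  have h2 := X.cw.char_injective (p := (k • a, d)) (q := (a, d)) hd hd h1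
  exact congrArg Prod.fst (eq_of_heq (Sigma.mk.inj h2).2)

/-- A function on `X^H` which is constant along paths is locally constant. -/
lemma isLocallyConstant_of_joined [IsTopologicalGroup G] {H : Subgroup G} {S : Type*}
    (c : MulAction.fixedPoints H X.carrier → S) (hc : ∀ x y, Joined x y → c x = c y) :
    IsLocallyConstant c := by
  intro s
  rw [← isClosed_compl_iff]
  -- The complement of a level set is taken as a subset of X itself, where closedness can be tested
  -- on skeleta and cells.
  let C : Set X.carrier := {x | ∃ hx : x ∈ MulAction.fixedPoints H X.carrier, c ⟨x, hx⟩ ∉ s}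
  have key : ∀ n, IsClosed (C ∩ X.cw.skLT n) := by
    intro n
    induction n with
    | zero => simp [X.cw.skLT_zero]
    | succ n ih =>
      refine X.cw.isClosed_of_char n _ Set.inter_subset_right ?_ fun i => ?_
      · rwa [Set.inter_assoc, Set.inter_eq_right.2 (X.cw.skLT_subset n)]
      · have := QuotientGroup.discreteTopology (X.isOpen_typ i)
        rw [← isOpen_compl_iff]
        refine (continuous_Prop (p := fun p : (G ⧸ X.cw.typ n i) × Disk n =>
          p ∉ X.cw.char n i ⁻¹' (C ∩ X.cw.skLT (n + 1)))).1 ?_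
        refine continuous_prod_of_discrete_left.2 fun a => continuous_Prop.2 ?_
        refine (isOpen_compl_iff (s := {d : Disk n | X.cw.char n i (a, d) ∈
          C ∩ X.cw.skLT (n + 1)})).2 ?_
        have hcont : Continuous fun d : Disk n => X.cw.char n i (a, d) :=
          (X.cw.continuous_char n i).comp (continuous_const.prodMk continuous_id)
        -- The orbit is discrete, so one coset a may be fixed. If H fixes a, the whole disk over a
        -- maps into X^H and c is constant on it, so the preimage is empty or everything. Otherwise
        -- no interior point is fixed, and the preimage is confined to the boundary sphere, hence
        -- determined by X_{n-1}.
        by_cases ha : ∀ k ∈ H, k • a = a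
        · have hfix := X.char_mem_fixedPoints (i := i) ha
          have hconst : ∀ d d', c ⟨_, hfix d⟩ = c ⟨_, hfix d'⟩ := fun d d' => by
            refine hc _ _ ?_
            have : PathConnectedSpace (Disk n) := isPathConnected_iff_pathConnectedSpace.1
              ((convex_closedBall _ _).isPathConnected ⟨0, by simp⟩)
            exact (PathConnectedSpace.joined d d').map (hcont.subtype_mk hfix)
          by_cases h0 : c ⟨_, hfix (SmoothGCW.center n)⟩ ∈ s
          · convert isClosed_empty
            refine Set.eq_empty_of_forall_notMem ?_
            rintro d ⟨⟨_, hd⟩, _⟩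
            exact hd (hconst d (SmoothGCW.center n) ▸ h0)
          · convert isClosed_univ
            refine Set.eq_univ_of_forall fun d => ⟨⟨hfix d, ?_⟩, X.cw.char_mem_skLT_succ i _⟩
            rwa [hconst d (SmoothGCW.center n)]
        · convert ih.preimage hcont using 1
          ext d
          refine ⟨fun hd => ⟨hd.1, ?_⟩, fun hd => ⟨hd.1, X.cw.skLT_subset n hd.2⟩⟩
          obtain ⟨⟨hx, _⟩, _⟩ := hd
          by_contra hd
          refine ha fun k hk => ?_
          have hlt : d.norm < 1 := by
            have h1 : d.norm ≤ 1 := by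
              have := d.2
              rwa [mem_closedBall_zero_iff] at this
            exact h1.lt_of_ne fun h1 => hd (X.cw.char_boundary n i a d h1)
          exact X.smul_eq_of_char_mem_fixedPoints hlt hx k hk
  have hC := X.cw.isClosed_of_skLT C key
  convert hC.preimage continuous_subtype_val using 1
  ext x
  exact ⟨fun hx => ⟨x.2, hx⟩, fun ⟨_, hx⟩ => hx⟩

/-- A function on `C_G H \ X^H` whose pullback to `X^H` is constant along paths is constant along
paths. -/
lemma eq_of_joined_centQuotient [IsTopologicalGroup G] {H : Subgroup G} {S : Type*} (c : CentQuotient X H → S)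
    (hc : ∀ x y, Joined x y → c (Quotient.mk _ x) = c (Quotient.mk _ y)) {y z : CentQuotient X H}
    (h : Joined y z) : c y = c z := by
  -- Open subsets of the quotient are detected on X^H, so local constancy descends. A locally
  -- constant function is constant along a path, with no lifting of the path required.
  have h1 : IsLocallyConstant c := fun s =>
    isOpen_coinduced.2 (isLocallyConstant_of_joined (fun x => c (Quotient.mk _ x)) hc s)
  obtain ⟨γ⟩ := h
  have := (h1.comp_continuous γ.continuous).apply_eq_of_preconnectedSpace 0 1
  simpa using this

end

end SmoothBredon

end

/-! ### The identification over the subgroup category. -/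

noncomputable section

namespace SmoothBredon

section

variable {G : Type u} [Group G] [TopologicalSpace G] [IsTopologicalGroup G] {X : SmoothGCW G}
  {F : OpenFamily G}

namespace SmoothGHomologyTheory

variable {ℋ : SmoothGHomologyTheory G}

/-- Under Condition (Sub) the homomorphism given by a point of `X^H` depends only on its orbit under
the centralizer. -/
lemma ConditionSub.pointHom_eq (hS : ℋ.ConditionSub F) (q : ℤ) (a : OrbitCat F)
    {x y : MulAction.fixedPoints a.H X.carrier} (h : (centSetoid X a.H).r x y) :
    ℋ.pointHom q a x = ℋ.pointHom q a y := by
  obtain ⟨c, hc, hxy⟩ := h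
  have hc' := inv_mem hc
  have hy : y = fixedMap X c⁻¹ (conj_mem_of_mem_centralizer hc') x := by
    refine Subtype.ext ?_
    change (y : X.carrier) = c⁻¹⁻¹ • (x : X.carrier)
    rw [inv_inv, hxy]
  refine AddMonoidHom.ext fun m => ?_
  rw [hy]
  refine Eq.trans ?_ (pointHom_map q c⁻¹ (conj_mem_of_mem_centralizer hc') x m)
  exact congrArg (ℋ.pointHom q a x) (ConcreteCategory.congr_hom (hS a c⁻¹ hc' q) m).symm

variable (X) in
/-- The homomorphism `ℋ_q(G/H) → ℋ_q(X)` given by a point of `C_G H \ X^H`. -/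
def ConditionSub.centHom (hS : ℋ.ConditionSub F) (q : ℤ) (a : SubCat F) (y : CentQuotient X a.H) :
    (ℋ.subModule hS q).obj a →+ ℋ.abs q X :=
  Quotient.lift (s := centSetoid X a.H) (fun x => ℋ.pointHom q ⟨a.H, a.mem⟩ x)
    (fun _ _ h => hS.pointHom_eq q ⟨a.H, a.mem⟩ h) y

variable (X) in
/-- The class of `[C_G H x] ⊗ m`. -/
def ConditionSub.tensorHom (hS : ℋ.ConditionSub F) (a : SubCat F)
    (x : MulAction.fixedPoints a.H X.carrier) (hx : (x : X.carrier) ∈ X.cw.skLT 1) :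
    (ℋ.subModule hS 0).obj a →+ tensorHomology (centFilt X F) (ℋ.subModule hS 0) 0 :=
  pointTensorHom (centFilt X F) (ℋ.subModule hS 0) (k := a)
    ⟨Quotient.mk (centSetoid X a.H) x, x, hx, rfl⟩

lemma ConditionSub.tensorHom_map (hS : ℋ.ConditionSub F) {a b : SubCat F} (g : G)
    (hg : ∀ h ∈ a.H, g * h * g⁻¹ ∈ b.H) (x : MulAction.fixedPoints b.H X.carrier)
    (hx : (x : X.carrier) ∈ X.cw.skLT 1) (hx' : (fixedMap X g hg x : X.carrier) ∈ X.cw.skLT 1)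
    (m : (ℋ.subModule hS 0).obj a) :
    hS.tensorHom X b x hx ((ℋ.subModule hS 0).map (SubCat.homMk g hg : a ⟶ b) m) =
      hS.tensorHom X a (fixedMap X g hg x) hx' m := by
  let y : ((centFilt X F).obj (Opposite.op b)).fil 1 :=
    ⟨Quotient.mk (centSetoid X b.H) x, x, hx, rfl⟩
  refine (pointTensorClass_map (M := ℋ.subModule hS 0) (SubCat.homMk g hg : a ⟶ b) y m).symm.trans ?_
  refine congrArg (fun y => pointTensorClass (centFilt X F) (ℋ.subModule hS 0) (k := a) y m)
    (Subtype.ext ?_)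
  exact centMap_homMk X g hg x

lemma ConditionSub.tensorHom_of_joinedIn (hS : ℋ.ConditionSub F) (a : SubCat F)
    {x y : MulAction.fixedPoints a.H X.carrier} (hx : (x : X.carrier) ∈ X.cw.skLT 1)
    (hy : (y : X.carrier) ∈ X.cw.skLT 1)
    (h : JoinedIn {x : MulAction.fixedPoints a.H X.carrier | (x : X.carrier) ∈ X.cw.skLT 2} x y) :
    hS.tensorHom X a x hx = hS.tensorHom X a y hy := by
  refine AddMonoidHom.ext fun m => pointTensorClass_of_joined ?_ m
  let p : {x : MulAction.fixedPoints a.H X.carrier | (x : X.carrier) ∈ X.cw.skLT 2} →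
      ((centFilt X F).obj (Opposite.op a)).fil 2 :=
    fun x => ⟨Quotient.mk (centSetoid X a.H) x.1, x.1, x.2, rfl⟩
  have hp : Continuous p :=
    (continuous_quotient_mk'.comp continuous_subtype_val).subtype_mk _
  exact h.joined_subtype.map hp

-- Condition (Sub) makes the homomorphism of a point well defined on C_GH\X^H. Its constancy along
-- paths of the quotient is `eq_of_joined_centQuotient` applied to the constancy along paths in X^H.
variable (X) in
lemma ConditionSub.exists_hom_tensorHom (hS : ℋ.ConditionSub F) :
    ∃ T : subH X F (ℋ.subModule hS 0) 0 ⟶ ℋ.abs 0 X,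
      ∀ (a : SubCat F) (x : MulAction.fixedPoints a.H X.carrier)
        (hx : (x : X.carrier) ∈ X.cw.skLT 1) (m : (ℋ.subModule hS 0).obj a),
        T (hS.tensorHom X a x hx m) = ℋ.pointHom 0 ⟨a.H, a.mem⟩ x m := by
  obtain ⟨T, hT⟩ := exists_tensorHomology_hom (O := centFilt X F) (M := ℋ.subModule hS 0)
    centFilt_fil_zero (A := ℋ.abs 0 X) (fun a y => hS.centHom X 0 a y.1)
    (fun a y z hyz => eq_of_joined_centQuotient (hS.centHom X 0 a)
      (fun x x' hx => pointHom_of_joined 0 ⟨a.H, a.mem⟩ hx)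
      (hyz.map continuous_subtype_val)) (by
      rintro a b f ⟨_, x, hx, rfl⟩ m
      obtain ⟨g, hg, rfl⟩ := SubCat.exists_homMk f
      refine (congrArg (fun y => hS.centHom X 0 a y m) (centMap_homMk X g hg x)).trans ?_
      refine (pointHom_map 0 (a := ⟨a.H, a.mem⟩) (b := ⟨b.H, b.mem⟩) g hg x m).symm.trans ?_
      exact congrArg (ℋ.pointHom 0 ⟨b.H, b.mem⟩ x)
        (ConcreteCategory.congr_hom (ℋ.subModule_map_homMk hS 0 g hg) m).symm)
  exact ⟨T, fun a x hx m => hT a _ m⟩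

lemma Connective.exists_hom_subH (h : ℋ.Connective X) (hF : ∀ n i, X.cw.typ n i ∈ F.mem)
    (hS : ℋ.ConditionSub F) :
    ∃ Ψ : ℋ.abs 0 X →+ subH X F (ℋ.subModule hS 0) 0,
      ∀ (a : SubCat F) (x : MulAction.fixedPoints a.H X.carrier)
        (hx : (x : X.carrier) ∈ X.cw.skLT 1) (m : (ℋ.subModule hS 0).obj a),
        Ψ (ℋ.pointHom 0 ⟨a.H, a.mem⟩ x m) = hS.tensorHom X a x hx m := by
  obtain ⟨Ψ, hΨ⟩ := h.exists_hom_of_points hF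
    (B := tensorHomology (centFilt X F) (ℋ.subModule hS 0) 0)
    (fun a x hx => hS.tensorHom X ⟨a.H, a.mem⟩ x hx)
    (fun a b g hg x hx hx' m => by
      refine Eq.trans ?_ (hS.tensorHom_map (a := ⟨a.H, a.mem⟩) (b := ⟨b.H, b.mem⟩) g hg x hx hx' m)
      exact congrArg (hS.tensorHom X ⟨b.H, b.mem⟩ x hx)
        (ConcreteCategory.congr_hom (ℋ.subModule_map_homMk hS 0
          (a := ⟨a.H, a.mem⟩) (b := ⟨b.H, b.mem⟩) g hg) m).symm)
    (fun a x y hx hy hxy => hS.tensorHom_of_joinedIn ⟨a.H, a.mem⟩ hx hy hxy)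
  exact ⟨Ψ, fun a x hx m => hΨ ⟨a.H, a.mem⟩ x hx m⟩

/-- Passing to C_GH\X^H merges only generators (x, m) and (cx, m) with c ∈ C_GH. Their images in
ℋ_0(X) coincide already, so the comparison for the orbit category carries over. -/
lemma Connective.exists_sub_iso (h : ℋ.Connective X) (hF : ∀ n i, X.cw.typ n i ∈ F.mem)
    (hS : ℋ.ConditionSub F) :
    ∃ Θ : subH X F (ℋ.subModule hS 0) 0 ≅ ℋ.ETwo X 0,
      ℋ.IsSubIdentification X 0 hS Θ.hom ∧ IsIso (Θ.hom ≫ ℋ.edge X 0) := by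
  obtain ⟨T, hT⟩ := hS.exists_hom_tensorHom X
  obtain ⟨Ψ, hΨ⟩ := h.exists_hom_subH hF hS
  have hiso : IsIso T := by
    refine ⟨AddCommGrpCat.ofHom Ψ, ?_, ?_⟩
    · refine tensorHomology_hom_ext centFilt_fil_zero ?_
      rintro a ⟨_, x, hx, rfl⟩ m
      exact (congrArg Ψ (hT a x hx m)).trans (hΨ a x hx m)
    · refine AddCommGrpCat.hom_ext (AddMonoidHom.ext fun z => ?_)
      change T (Ψ z) = z
      refine h.induction_on hF (p := fun z => T (Ψ z) = z) ?_ ?_ ?_ z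
      · exact (congrArg T (map_zero Ψ)).trans (map_zero T.hom)
      · intro z w hz hw
        refine (congrArg T (map_add Ψ z w)).trans ((map_add T.hom _ _).trans ?_)
        exact congrArg₂ (· + ·) hz hw
      · intro a x hx m
        exact (congrArg T (hΨ ⟨a.H, a.mem⟩ x hx m)).trans (hT ⟨a.H, a.mem⟩ x hx m)
  obtain ⟨Θ, h1, h2⟩ := h.exists_iso_ETwo T hiso
  refine ⟨Θ, fun a x hx m => h2 _ _ ?_, h1⟩
  exact (hT a x hx m).trans (skelIncl_pointMap 0 ⟨a.H, a.mem⟩ x hx m).symm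

end SmoothGHomologyTheory

end

end SmoothBredon

end

/-! ### The colimit descriptions of ℋ_0(X). -/

noncomputable section

namespace SmoothBredon

/-! ### The colimits over the orbit category and the subgroup category -/

/-- Only non-emptiness and the triviality of π_0 are used; the higher homotopy groups play no role
for ℋ_0. -/
lemma WeaklyContractible.pathConnectedSpace {Z : Type u} [TopologicalSpace Z]
    (h : WeaklyContractible Z) : PathConnectedSpace Z := by
  obtain ⟨⟨z⟩, hz⟩ := h
  have h0 := hz 0 z
  exact pathConnectedSpace_iff_zerothHomotopy.2 ⟨⟨Quotient.mk _ z⟩,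
    (HomotopyGroup.pi0EquivZerothHomotopy (x := z)).symm.subsingleton⟩

lemma isIso_colimit_desc {J : Type u} [Category.{u} J] {M : J ⥤ AddCommGrpCat.{u}}
    {A : AddCommGrpCat.{u}} (ι : M ⟶ (Functor.const J).obj A) (Ψ : A ⟶ colimit M)
    (h1 : ∀ j, ι.app j ≫ Ψ = colimit.ι M j)
    (h2 : Ψ ≫ colimit.desc M (Cocone.mk _ ι) = 𝟙 A) :
    IsIso (colimit.desc M (Cocone.mk _ ι)) := by
  refine ⟨Ψ, colimit.hom_ext fun j => ?_, h2⟩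
  rw [colimit.ι_desc_assoc, Category.comp_id]
  exact h1 j

section

variable {G : Type u} [Group G] [TopologicalSpace G] [IsTopologicalGroup G] {X : SmoothGCW G}
  {F : OpenFamily G}

omit [IsTopologicalGroup G] in
/-- If `X^H` is non-empty, it meets the zero skeleton. -/
lemma SmoothGCW.exists_mem_skLT_one (X : SmoothGCW G) {H : Subgroup G}
    (x : MulAction.fixedPoints H X.carrier) :
    ∃ y : MulAction.fixedPoints H X.carrier, (y : X.carrier) ∈ X.cw.skLT 1 := by
  have key : ∀ n (x : MulAction.fixedPoints H X.carrier), (x : X.carrier) ∈ X.cw.skLT (n + 1) →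
      ∃ y : MulAction.fixedPoints H X.carrier, (y : X.carrier) ∈ X.cw.skLT 1 := by
    intro n
    induction n with
    | zero => exact fun x hx => ⟨x, hx⟩
    | succ n ih =>
      rintro ⟨x, hfix⟩ hx
      by_cases hx' : x ∈ X.cw.skLT (n + 1)
      · exact ih ⟨x, hfix⟩ hx'
      -- If an interior point of a cell is fixed by H, so is its coset a, and with it the whole disk
      -- over a. Any point of the non-empty boundary sphere then gives a fixed point in a lower
      -- skeleton.
      · obtain ⟨⟨i, a, d⟩, hp, rfl⟩ := (X.cw.bijOn_char (n + 1)).surjOn ⟨hx, hx'⟩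
        have ha := X.smul_eq_of_char_mem_fixedPoints hp hfix
        obtain ⟨d', hd'⟩ := exists_norm_eq_one n
        exact ih ⟨_, X.char_mem_fixedPoints ha d'⟩ (X.cw.char_boundary (n + 1) i a d' hd')
  obtain ⟨n, i, hx⟩ := X.cw.exists_openCell (x : X.carrier)
  exact key n x (X.cw.openCell_subset n i hx).1

namespace SmoothGHomologyTheory

variable {ℋ : SmoothGHomologyTheory G}

lemma map_pointMap_eq (q : ℤ) {H : Subgroup G} (hH : IsOpen (H : Set G))
    [PathConnectedSpace (MulAction.fixedPoints H X.carrier)]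
    (x y : MulAction.fixedPoints H X.carrier) :
    (ℋ.H q).map (pointMap X hH x) = (ℋ.H q).map (pointMap X hH y) :=
  ℋ.homotopy_invariance q _ _ _ _ (gHomotopic_pointMap hH (PathConnectedSpace.joined x y))

/-- Path connectedness of X^H makes the map of a point independent of the point, which gives the
cocone. The inverse sends a generator (x, m) to the class of m in the colimit, forgetting x. -/
lemma Connective.exists_colimit_orbit (h : ℋ.Connective X) (hF : ∀ n i, X.cw.typ n i ∈ F.mem)
    (hX : ∀ a : OrbitCat F, PathConnectedSpace (MulAction.fixedPoints a.H X.carrier)) :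
    ∃ ι : ℋ.orbitModule F 0 ⟶ (Functor.const (OrbitCat F)).obj (ℋ.abs 0 X),
      (∀ (a : OrbitCat F) (x : MulAction.fixedPoints a.H X.carrier),
        ι.app a = (ℋ.H 0).map (pointMap X (F.isOpen a.H a.mem) x)) ∧
      IsIso (colimit.desc (ℋ.orbitModule F 0) (Cocone.mk _ ι)) := by
  let pt (a : OrbitCat F) : MulAction.fixedPoints a.H X.carrier := (hX a).nonempty.some
  let ι : ℋ.orbitModule F 0 ⟶ (Functor.const (OrbitCat F)).obj (ℋ.abs 0 X) :=
    { app := fun a => (ℋ.H 0).map (pointMap X (F.isOpen a.H a.mem) (pt a))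
      naturality := fun a b f => by
        obtain ⟨g, hg, rfl⟩ := OrbitCat.exists_homMk f
        have := hX a
        refine AddCommGrpCat.hom_ext (AddMonoidHom.ext fun m => ?_)
        refine (pointHom_map 0 g hg (pt b) m).trans ?_
        exact ConcreteCategory.congr_hom
          (map_pointMap_eq (ℋ := ℋ) 0 (F.isOpen a.H a.mem) (fixedMap X g hg (pt b)) (pt a)) m }
  have hι : ∀ (a : OrbitCat F) (x : MulAction.fixedPoints a.H X.carrier),
      ι.app a = (ℋ.H 0).map (pointMap X (F.isOpen a.H a.mem) x) := fun a x => by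
    have := hX a
    exact map_pointMap_eq 0 (F.isOpen a.H a.mem) (pt a) x
  -- The family does not involve x, so the path condition is trivial and naturality is the colimit
  -- relation.
  obtain ⟨Ψ, hΨ⟩ := h.exists_hom_of_points hF (B := (colimit (ℋ.orbitModule F 0) : AddCommGrpCat.{u}))
    (fun a x hx => (colimit.ι (ℋ.orbitModule F 0) a).hom)
    (fun a b g hg x hx hx' m => ConcreteCategory.congr_hom
      (colimit.w (ℋ.orbitModule F 0) (OrbitCat.homMk g hg : a ⟶ b)) m)
    (fun a x y hx hy hxy => rfl)
  refine ⟨ι, hι, isIso_colimit_desc ι (AddCommGrpCat.ofHom Ψ) (fun a => ?_) ?_⟩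
  -- The value of Ψ is known only on classes of points of X_0, so the base point is first replaced
  -- by one of X_0^H.
  · obtain ⟨x, hx⟩ := X.exists_mem_skLT_one (pt a)
    rw [hι a x]
    exact AddCommGrpCat.hom_ext (AddMonoidHom.ext fun m => hΨ a x hx m)
  · let D : colimit (ℋ.orbitModule F 0) ⟶ ℋ.abs 0 X := colimit.desc _ (Cocone.mk _ ι)
    refine AddCommGrpCat.hom_ext (AddMonoidHom.ext fun z => ?_)
    change D (Ψ z) = z
    refine h.induction_on hF (p := fun z => D (Ψ z) = z) ?_ ?_ ?_ z
    · exact (congrArg D (map_zero Ψ)).trans (map_zero D.hom)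
    · intro z w hz hw
      refine (congrArg D (map_add Ψ z w)).trans ((map_add D.hom _ _).trans ?_)
      exact congrArg₂ (· + ·) hz hw
    · intro a x hx m
      refine (congrArg D (hΨ a x hx m)).trans ?_
      refine (ConcreteCategory.congr_hom
        (colimit.ι_desc (Cocone.mk _ ι : Cocone (ℋ.orbitModule F 0)) a) m).trans ?_
      exact ConcreteCategory.congr_hom (hι a x) m

lemma exists_sub_cocone (hX : ∀ a : OrbitCat F, PathConnectedSpace (MulAction.fixedPoints a.H X.carrier))
    (hS : ℋ.ConditionSub F) :
    ∃ ι : ℋ.subModule hS 0 ⟶ (Functor.const (SubCat F)).obj (ℋ.abs 0 X),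
      ∀ (a : SubCat F) (x : MulAction.fixedPoints a.H X.carrier),
        ι.app a = (ℋ.H 0).map (pointMap X (F.isOpen a.H a.mem) x) := by
  let pt (a : SubCat F) : MulAction.fixedPoints a.H X.carrier := (hX ⟨a.H, a.mem⟩).nonempty.some
  let ι : ℋ.subModule hS 0 ⟶ (Functor.const (SubCat F)).obj (ℋ.abs 0 X) :=
    { app := fun a => (ℋ.H 0).map (pointMap X (F.isOpen a.H a.mem) (pt a))
      naturality := fun a b f => by
        obtain ⟨g, hg, rfl⟩ := SubCat.exists_homMk f
        have := hX ⟨a.H, a.mem⟩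
        refine AddCommGrpCat.hom_ext (AddMonoidHom.ext fun m => ?_)
        refine (congrArg (ℋ.pointHom 0 ⟨b.H, b.mem⟩ (pt b))
          (ConcreteCategory.congr_hom (ℋ.subModule_map_homMk hS 0 g hg) m)).trans ?_
        refine (pointHom_map 0 (a := ⟨a.H, a.mem⟩) (b := ⟨b.H, b.mem⟩) g hg (pt b) m).trans ?_
        exact ConcreteCategory.congr_hom
          (map_pointMap_eq (ℋ := ℋ) 0 (F.isOpen a.H a.mem) (fixedMap X g hg (pt b)) (pt a)) m }
  refine ⟨ι, fun a x => ?_⟩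
  have := hX ⟨a.H, a.mem⟩
  exact map_pointMap_eq 0 (F.isOpen a.H a.mem) (pt a) x

lemma Connective.exists_hom_colimit_sub (h : ℋ.Connective X) (hF : ∀ n i, X.cw.typ n i ∈ F.mem)
    (hS : ℋ.ConditionSub F) :
    ∃ Ψ : ℋ.abs 0 X ⟶ colimit (ℋ.subModule hS 0),
      ∀ (a : SubCat F) (x : MulAction.fixedPoints a.H X.carrier),
        (x : X.carrier) ∈ X.cw.skLT 1 → ∀ m : (ℋ.subModule hS 0).obj a,
        Ψ (ℋ.pointHom 0 ⟨a.H, a.mem⟩ x m) = colimit.ι (ℋ.subModule hS 0) a m := by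
  let D : AddCommGrpCat.{u} := colimit (ℋ.subModule hS 0)
  let j (a : SubCat F) : (ℋ.subModule hS 0).obj a →+ D := (colimit.ι (ℋ.subModule hS 0) a).hom
  have hj : ∀ (a b : SubCat F) (f : a ⟶ b) (m : (ℋ.subModule hS 0).obj a),
      j b ((ℋ.subModule hS 0).map f m) = j a m := fun a b f m =>
    ConcreteCategory.congr_hom (colimit.w (ℋ.subModule hS 0) f) m
  obtain ⟨Ψ, hΨ⟩ := h.exists_hom_of_points hF (B := D)
    (fun a x hx => j ⟨a.H, a.mem⟩)
    (fun a b g hg x hx hx' m => by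
      refine Eq.trans ?_ (hj ⟨a.H, a.mem⟩ ⟨b.H, b.mem⟩ (SubCat.homMk g hg) m)
      exact congrArg (j ⟨b.H, b.mem⟩)
        (ConcreteCategory.congr_hom (ℋ.subModule_map_homMk hS 0
          (a := ⟨a.H, a.mem⟩) (b := ⟨b.H, b.mem⟩) g hg) m).symm)
    (fun a x y hx hy hxy => rfl)
  exact ⟨AddCommGrpCat.ofHom Ψ, fun a x hx m => hΨ ⟨a.H, a.mem⟩ x hx m⟩

lemma Connective.exists_colimit_sub (h : ℋ.Connective X) (hF : ∀ n i, X.cw.typ n i ∈ F.mem)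
    (hX : ∀ a : OrbitCat F, PathConnectedSpace (MulAction.fixedPoints a.H X.carrier))
    (hS : ℋ.ConditionSub F) :
    ∃ ι : ℋ.subModule hS 0 ⟶ (Functor.const (SubCat F)).obj (ℋ.abs 0 X),
      (∀ (a : SubCat F) (x : MulAction.fixedPoints a.H X.carrier),
        ι.app a = (ℋ.H 0).map (pointMap X (F.isOpen a.H a.mem) x)) ∧
      IsIso (colimit.desc (ℋ.subModule hS 0) (Cocone.mk _ ι)) := by
  obtain ⟨ι, hι⟩ := exists_sub_cocone hX hS
  obtain ⟨Ψ, hΨ⟩ := h.exists_hom_colimit_sub hF hS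
  refine ⟨ι, hι, isIso_colimit_desc ι Ψ (fun a => ?_) ?_⟩
  · obtain ⟨x, hx⟩ := X.exists_mem_skLT_one (hX ⟨a.H, a.mem⟩).nonempty.some
    rw [hι a x]
    exact AddCommGrpCat.hom_ext (AddMonoidHom.ext fun m => hΨ a x hx m)
  · let D : colimit (ℋ.subModule hS 0) ⟶ ℋ.abs 0 X := colimit.desc _ (Cocone.mk _ ι)
    refine AddCommGrpCat.hom_ext (AddMonoidHom.ext fun z => ?_)
    change D (Ψ z) = z
    refine h.induction_on hF (p := fun z => D (Ψ z) = z) ?_ ?_ ?_ z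
    · exact (congrArg D (map_zero Ψ.hom)).trans (map_zero D.hom)
    · intro z w hz hw
      refine (congrArg D (map_add Ψ.hom z w)).trans ((map_add D.hom _ _).trans ?_)
      exact congrArg₂ (· + ·) hz hw
    · intro a x hx m
      refine (congrArg D (hΨ ⟨a.H, a.mem⟩ x hx m)).trans ?_
      refine (ConcreteCategory.congr_hom
        (colimit.ι_desc (Cocone.mk _ ι : Cocone (ℋ.subModule hS 0)) ⟨a.H, a.mem⟩) m).trans ?_
      exact ConcreteCategory.congr_hom (hι ⟨a.H, a.mem⟩ x) m

end SmoothGHomologyTheory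

end

end SmoothBredon

end

/-! ### Passage from families and isotropy groups to the orbit types of cells. -/

noncomputable section

namespace SmoothBredon

namespace SmoothGHomologyTheory

variable {G : Type u} [Group G] [TopologicalSpace G] [IsTopologicalGroup G]
  {ℋ : SmoothGHomologyTheory G}

lemma connective_of_isZero {F : OpenFamily G}
    (h0 : ∀ (a : OrbitCat F) (q : ℤ), q < 0 → IsZero ((ℋ.orbitModule F q).obj a))
    {X : SmoothGCW G} (hF : ∀ n i, X.cw.typ n i ∈ F.mem) : ℋ.Connective X :=
  fun n i _ q hq => vanish_iff_isZero.2 (h0 ⟨X.cw.typ n i, hF n i⟩ q hq)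

end SmoothGHomologyTheory

/-- Members of the isotropy family are stabilizers, hence compact open, so weak contractibility
applies to their fixed point sets. -/
lemma IsClassifyingSpaceCop.pathConnectedSpace {G : Type u} [Group G] [TopologicalSpace G]
    {X : SmoothGCW G} (hX : IsClassifyingSpaceCop X) (a : OrbitCat (isotropyFamily X)) :
    PathConnectedSpace (MulAction.fixedPoints a.H X.carrier) := by
  obtain ⟨H, x, rfl⟩ := a
  exact (hX.2 _ (hX.1 x).1 (hX.1 x).2).pathConnectedSpace

end SmoothBredon

end

theorem theorem2p5 {G : Type u} [Group G] [TopologicalSpace G] [IsTopologicalGroup G]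
    [LocallyCompactSpace G] [SecondCountableTopology G] [TotallyDisconnectedSpace G] [T2Space G]
    (ℋ : SmoothBredon.SmoothGHomologyTheory G) :
    -- vanishing in negative degrees
    (∀ F : SmoothBredon.OpenFamily G,
      (∀ (a : SmoothBredon.OrbitCat F) (q : ℤ), q < 0 → IsZero ((ℋ.orbitModule F q).obj a)) →
      ∀ P : SmoothBredon.SmoothGCWPair G,
        (∀ x : P.X.carrier, MulAction.stabilizer G x ∈ F.mem) →
        ∀ q : ℤ, q < 0 → IsZero ((ℋ.H q).obj P)) ∧
    -- the classifying space, with `I` its set of isotropy groups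
    (∀ X : SmoothBredon.SmoothGCW G, SmoothBredon.IsClassifyingSpaceCop X →
      ∀ I : SmoothBredon.OpenFamily G, I = SmoothBredon.isotropyFamily X →
      (∀ (a : SmoothBredon.OrbitCat I) (q : ℤ), q < 0 → IsZero ((ℋ.orbitModule I q).obj a)) →
      -- vanishing in negative degrees
      (∀ q : ℤ, q < 0 → IsZero (ℋ.abs q X)) ∧
      -- the edge homomorphism on Bredon homology, over any family containing `I`
      (∀ F : SmoothBredon.OpenFamily G, I.mem ⊆ F.mem →
        ∃ Θ : SmoothBredon.bredonH X F (ℋ.orbitModule F 0) 0 ≅ ℋ.ETwo X 0,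
          ℋ.IsBredonIdentification X 0 F Θ.hom ∧ IsIso (Θ.hom ≫ ℋ.edge X 0)) ∧
      -- the colimit over the orbit category
      (∃ ι : ℋ.orbitModule I 0 ⟶ (Functor.const (SmoothBredon.OrbitCat I)).obj (ℋ.abs 0 X),
        (∀ (a : SmoothBredon.OrbitCat I) (x : MulAction.fixedPoints a.H X.carrier),
          ι.app a = (ℋ.H 0).map (SmoothBredon.pointMap X (I.isOpen a.H a.mem) x)) ∧
        IsIso (colimit.desc (ℋ.orbitModule I 0) (Cocone.mk _ ι))) ∧
      -- the versions for the subgroup category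
      (∀ hS : ℋ.ConditionSub I,
        (∃ Θ : SmoothBredon.subH X I (ℋ.subModule hS 0) 0 ≅ ℋ.ETwo X 0,
          ℋ.IsSubIdentification X 0 hS Θ.hom ∧ IsIso (Θ.hom ≫ ℋ.edge X 0)) ∧
        (∃ ι : ℋ.subModule hS 0 ⟶ (Functor.const (SmoothBredon.SubCat I)).obj (ℋ.abs 0 X),
          (∀ (a : SmoothBredon.SubCat I) (x : MulAction.fixedPoints a.H X.carrier),
            ι.app a = (ℋ.H 0).map (SmoothBredon.pointMap X (I.isOpen a.H a.mem) x)) ∧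
          IsIso (colimit.desc (ℋ.subModule hS 0) (Cocone.mk _ ι))))) := by
  refine ⟨fun F h0 P hP q hq => ?_, ?_⟩
  -- The subgroup attached to a cell is the stabilizer of a point in that cell, so a condition on
  -- isotropy groups bounds the types of all cells.
  · have hF : ∀ n i, P.X.cw.typ n i ∈ F.mem := fun n i => by
      obtain ⟨x, hx⟩ := P.X.typ_mem_isotropy i
      exact hx ▸ hP x
    exact SmoothBredon.SmoothGHomologyTheory.vanish_iff_isZero.1
      ((SmoothBredon.SmoothGHomologyTheory.connective_of_isZero h0 hF).vanish_pair hq)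
  · rintro X hX I rfl h0
    have hI : ∀ n i, X.cw.typ n i ∈ (SmoothBredon.isotropyFamily X).mem := fun n i =>
      X.typ_mem_isotropy i
    have hc := SmoothBredon.SmoothGHomologyTheory.connective_of_isZero h0 hI
    exact ⟨fun q hq => SmoothBredon.SmoothGHomologyTheory.vanish_iff_isZero.1 (hc.vanish hq),
      -- Vanishing is known only for members of I, and no more is needed: the larger family F has
      -- only to contain the types of the cells.
      fun F hF => hc.exists_bredon_iso fun n i => hF (hI n i),
      hc.exists_colimit_orbit hI hX.pathConnectedSpace,
      fun hS => ⟨hc.exists_sub_iso hI hS,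
        hc.exists_colimit_sub hI hX.pathConnectedSpace hS⟩⟩
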